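/- **Setting.** Let $k$ be a field, $X$ a well-ordered set and $\Omega=\bigcup_{m\ge 1}\Omega_m$ a well-ordered set of operation symbols, where the elements of $\Omega_m$ are $m$-ary. Let $\langle\Omega;X\rangle$ be the set of associative $\Omega$-words: the nonempty associative words $u=u_1\cdots u_n$ whose letters $u_i$ (*primes*) are either elements of $X$ or of the form $\omega(v_1,\dots,v_m)$ with $\omega\in\Omega_m$, $v_j\in\langle\Omega;X\rangle$. Put $\mathrm{bre}(u)=n$ and let $\deg(u)$ be the total number of occurrences of elements of $X$ and $\Omega$ in $u$. The Deg-lex order $<$ on $\langle\Omega;X\rangle$ compares the sequences $(\deg u,\mathrm{bre}\,u,u_1,\dots,u_n)$ lexicographically, where primes are compared first by degree, primes in $X$ by the order of $X$, and primes $\omega(v_1,\dots)$, $\theta(w_1,\dots)$ of equal degree by comparing $(\omega,v_1,\dots)$ and $(\theta,w_1,\dots)$ lexicographically. A $\star$-word $\pi$ is an $\Omega$-word on $X\cup\{\star\}$ with exactly one occurrence of $\star$, and $\pi|_v$ is the result of replacing $\star$ by $v$. Let $<_{lex}$ be the lexicographic order on words in primes in which a proper prefix of a word is larger than the word. The set $ALSW(\Omega;X)$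 consists of the words $u=u_1\cdots u_n$ such that each $u_i$ lies in $X$ or is $\omega(v_1,\dots,v_m)$ with all $v_j\in ALSW(\Omega;X)$, and $u=pq>_{lex}qp$ for every decomposition of the sequence of primes of $u$ into nonempty parts $p,q$. A non-associative $\Omega$-word $(u)$ is a non-associative Lyndon–Shirshov $\Omega$-word if: it is an element of $X$; or it is $\omega((v_1),\dots,(v_m))$ with each $(v_j)$ a non-associative Lyndon–Shirshov $\Omega$-word; or it is $((v)(w))$, where $u=vw\in ALSW(\Omega;X)$, both $(v)$ and $(w)$ are non-associative Lyndon–Shirshov $\Omega$-words, and $v_2\le_{lex}w$ whenever $(v)=((v_1)(v_2))$. Each $u\in ALSW(\Omega;X)$ has exactly one such bracketing, denoted $[u]$. Let $k\langle\Omega;X\rangle$ be the $k$-linear span of $\langle\Omega;X\rangle$ with the induced multiplication and multilinear operations, and let $Lie(\Omega;X)$ be its smallest subspace containing $X$ and closed under the commutator $(fg)=fg-gf$ and all operations in $\Omega$; non-associative words are evaluated in it. For $0\ne f\in k\langle\Omega;X\rangle$ let $\bar f$ be the leading word of $f$ with respect to $<$; $f$ is monic if the coefficient of $\bar f$ is $1$.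 Let $f\in Lie(\Omega;X)$ be monic and $\pi$ a $\star$-word with $\pi|_{\bar f}\in ALSW(\Omega;X)$. Write $[\pi|_{\bar f}]=\pi_1|_{[\bar f c]}$, where $\pi_1$ is a non-associative $\star$-word, the $\bar f$ shown is the one at the position of $\star$ in $\pi$, and $c$ may be empty; write $c=c_1\cdots c_m$ with $c_i\in ALSW(\Omega;X)$ and $c_1\le_{lex}\cdots\le_{lex}c_m$. The special normal $f$-word is $$[\pi|_f]_{\bar f}:=\pi_1|_{[\bar fc]\mapsto(\cdots((f[c_1])[c_2])\cdots[c_m])}.$$ For monic $f,g\in Lie(\Omega;X)$, the intersection composition with respect to $w=\bar fa=b\bar g$ ($a,b\in\langle\Omega;X\rangle$, $\mathrm{bre}(w)<\mathrm{bre}(\bar f)+\mathrm{bre}(\bar g)$) is $\langle f,g\rangle_w=[fa]_{\bar f}-[bg]_{\bar g}$, and the inclusion composition with respect to $w=\bar f=\pi|_{\bar g}$ is $\langle f,g\rangle_w=f-[\pi|_g]_{\bar g}$. For a monic set $S\subseteq Lie(\Omega;X)$, a composition $\langle f,g\rangle_w$ is trivial modulo $(S,w)$ if it is a linear combination of special normal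 words $[\pi_i|_{s_i}]_{\bar s_i}$ with $s_i\in S$ and $\pi_i|_{\bar s_i}<w$; $S$ is a Gröbner–Shirshov basis in $Lie(\Omega;X)$ if all compositions of elements of $S$ are trivial. Let $Id_{Lie}(S)$ be the ideal of the Lie $\Omega$-algebra $Lie(\Omega;X)$ generated by $S$: the smallest subspace containing $S$, closed under the bracket with elements of $Lie(\Omega;X)$, and containing $\omega(f_1,\dots,f_m)$ whenever all $f_j\in Lie(\Omega;X)$ and some $f_i$ lies in it. **Theorem (Composition-Diamond lemma for Lie $\Omega$-algebras).** Let $S\subseteq Lie(\Omega;X)$ be a monic set. The following statements are equivalent: (i) $S$ is a Gröbner–Shirshov basis in $Lie(\Omega;X)$. (ii) For every nonzero $f\in Id_{Lie}(S)$ one has $\bar f\in ALSW(\Omega;X)$ and $\bar f=\pi|_{\bar s}$ for some $s\in S$ and some $\star$-word $\pi$. (iii) The set $Irr(S)=\{[w]\mid w\in ALSW(\Omega;X),\ w\ne\pi|_{\bar s}\text{ for all } s\in S\text{ and all }\star\text{-words }\pi\}$ is a linear basis of $Lie(\Omega;X)/Id_{Lie}(S)$ (that is, the images of its elements form a linearly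 independent spanning family). -/

import Mathlib

namespace OmegaLie

/-! ### Associative `Ω`-words

`Ω` is the set of operation symbols and `ar ω` is the arity of `ω`. -/

/-- Prime `Ω`-words, that is, the elements of `X ∪ Ω(⟨Ω; X⟩)`: either a generator `x`, or
`ω(u₁, …, uₘ)` with `m = ar ω`, where each `uᵢ` is a nonempty associative word in primes. -/
inductive Letter {Ω : Type*} (ar : Ω → ℕ) (X : Type*) where
  | var : X → Letter ar X
  | op : (ω : Ω) → (Fin (ar ω) → FreeSemigroup (Letter ar X)) → Letter ar X

/-- Associative `Ω`-words `⟨Ω; X⟩`: nonempty associative words in primes. -/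
abbrev Word {Ω : Type*} (ar : Ω → ℕ) (X : Type*) := FreeSemigroup (Letter ar X)

/-- The sequence of primes of a word. -/
def letters {α : Type*} (u : FreeSemigroup α) : List α := u.head :: u.tail

mutual
/-- Total number of occurrences of generators and operation symbols in a prime. -/
def Letter.deg {Ω : Type*} {ar : Ω → ℕ} {X : Type*} : Letter ar X → ℕ
  | .var _ => 1
  | .op _ u => 1 + ∑ i, Word.deg (u i)
/-- Total number of occurrences of generators and operation symbols in a word. -/
def Word.deg {Ω : Type*} {ar : Ω → ℕ} {X : Type*} : FreeSemigroup (Letter ar X) → ℕ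
  | ⟨a, l⟩ => Letter.deg a + listDeg l
/-- Total number of occurrences of generators and operation symbols in a list of primes. -/
def listDeg {Ω : Type*} {ar : Ω → ℕ} {X : Type*} : List (Letter ar X) → ℕ
  | [] => 0
  | a :: l => Letter.deg a + listDeg l
end

/-- The breadth: the number of primes in the canonical form `u = u₁ ⋯ uₙ`. -/
def bre {Ω : Type*} {ar : Ω → ℕ} {X : Type*} (u : Word ar X) : ℕ := u.length

/-! ### The Deg-lex order -/

mutual
/-- The Deg-lex order on primes: `a < b`. The degree is compared first; generators are compared
in `X`; `ω(u₁, …)` and `θ(v₁, …)` of the same degree are compared by `(ω, u₁, …)` and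
`(θ, v₁, …)` lexicographically. (All operations having arity at least one, a generator and a
prime of the form `ω(u₁, …)` never have the same degree.) -/
def Letter.lt {Ω : Type*} [LT Ω] {ar : Ω → ℕ} {X : Type*} [LT X] :
    Letter ar X → Letter ar X → Prop
  | .var x, b => Letter.deg (.var x : Letter ar X) < b.deg ∨ ∃ y, b = .var y ∧ x < y
  | .op ω u, b => Letter.deg (.op ω u) < b.deg ∨
      (Letter.deg (.op ω u) = b.deg ∧
        ((∃ θ v, b = .op θ v ∧ ω < θ) ∨
          ∃ v, b = .op ω v ∧ ∃ i, (∀ j, j < i → u j = v j) ∧ Word.lt (u i) (v i)))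
/-- The Deg-lex order on words: `u < v`, by comparing `(deg u, bre u, u₁, u₂, …)` and
`(deg v, bre v, v₁, v₂, …)` lexicographically. -/
def Word.lt {Ω : Type*} [LT Ω] {ar : Ω → ℕ} {X : Type*} [LT X] :
    FreeSemigroup (Letter ar X) → FreeSemigroup (Letter ar X) → Prop
  | ⟨a, l⟩, v => Word.deg ⟨a, l⟩ < Word.deg v ∨ (Word.deg ⟨a, l⟩ = Word.deg v ∧
      (l.length < v.tail.length ∨ (l.length = v.tail.length ∧
        (Letter.lt a v.head ∨ (a = v.head ∧ listLt l v.tail)))))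
/-- Lexicographic comparison of lists of primes (only used for lists of the same length). -/
def listLt {Ω : Type*} [LT Ω] {ar : Ω → ℕ} {X : Type*} [LT X] :
    List (Letter ar X) → List (Letter ar X) → Prop
  | [], _ => False
  | a :: l, m => ∃ b m', m = b :: m' ∧ (Letter.lt a b ∨ (a = b ∧ listLt l m'))
end

/-- The lex-order on words in primes with respect to the order of primes: `u <_lex v`. Here a
proper prefix of a word is **larger** than the word; in particular the empty word is the
largest. -/
def lexLt {Ω : Type*} [LT Ω] {ar : Ω → ℕ} {X : Type*} [LT X] :
    List (Letter ar X) → List (Letter ar X) → Prop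
  | [], _ => False
  | _ :: _, [] => True
  | a :: l, b :: m => Letter.lt a b ∨ (a = b ∧ lexLt l m)

/-- `u ≤_lex v`. -/
def lexLe {Ω : Type*} [LT Ω] {ar : Ω → ℕ} {X : Type*} [LT X] (u v : List (Letter ar X)) : Prop :=
  u = v ∨ lexLt u v

/-! ### Lyndon–Shirshov `Ω`-words -/

/-- A word in primes is Lyndon–Shirshov: `pq >_lex qp` for each decomposition into nonempty
parts. -/
def IsLyndon {Ω : Type*} [LT Ω] {ar : Ω → ℕ} {X : Type*} [LT X] (u : List (Letter ar X)) : Prop :=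
  u ≠ [] ∧ ∀ p q : List (Letter ar X), p ≠ [] → q ≠ [] → u = p ++ q → lexLt (q ++ p) (p ++ q)

mutual
/-- The primes in `X ∪ Ω(ALSW(Ω; X))`. -/
def Letter.IsALSW {Ω : Type*} [LT Ω] {ar : Ω → ℕ} {X : Type*} [LT X] : Letter ar X → Prop
  | .var _ => True
  | .op _ u => ∀ i, Word.IsALSW (u i)
/-- Associative Lyndon–Shirshov `Ω`-words: Lyndon–Shirshov words in the letters
`X ∪ Ω(ALSW(Ω; X))`. -/
def Word.IsALSW {Ω : Type*} [LT Ω] {ar : Ω → ℕ} {X : Type*} [LT X] :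
    FreeSemigroup (Letter ar X) → Prop
  | ⟨a, l⟩ => IsLyndon (a :: l) ∧ Letter.IsALSW a ∧ listIsALSW l
/-- All the primes in the list belong to `X ∪ Ω(ALSW(Ω; X))`. -/
def listIsALSW {Ω : Type*} [LT Ω] {ar : Ω → ℕ} {X : Type*} [LT X] : List (Letter ar X) → Prop
  | [] => True
  | a :: l => Letter.IsALSW a ∧ listIsALSW l
end

/-- Non-associative `Ω`-words `(Ω; X)`. -/
inductive NWord {Ω : Type*} (ar : Ω → ℕ) (X : Type*) where
  | var : X → NWord ar X
  | op : (ω : Ω) → (Fin (ar ω) → NWord ar X) → NWord ar X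
  | mul : NWord ar X → NWord ar X → NWord ar X

/-- The associative word `u` underlying a non-associative word `(u)`. -/
def NWord.word {Ω : Type*} {ar : Ω → ℕ} {X : Type*} : NWord ar X → Word ar X
  | .var x => FreeSemigroup.of (.var x)
  | .op ω t => FreeSemigroup.of (.op ω fun i => (t i).word)
  | .mul s t => s.word * t.word

/-- Non-associative Lyndon–Shirshov `Ω`-words. For `u ∈ ALSW(Ω; X)`, `[u]` is the unique `t`
with `t.IsNLSW` and `t.word = u`. -/
def NWord.IsNLSW {Ω : Type*} [LT Ω] {ar : Ω → ℕ} {X : Type*} [LT X] : NWord ar X → Prop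
  | .var _ => True
  | .op _ t => ∀ i, (t i).IsNLSW
  | .mul v w => Word.IsALSW (NWord.mul v w).word ∧ v.IsNLSW ∧ w.IsNLSW ∧
      ∀ v₁ v₂, v = .mul v₁ v₂ → lexLe (letters v₂.word) (letters w.word)

/-! ### `⋆`-words -/

/-- Associative `Ω`-words with exactly one occurrence of `⋆`: either `a ⋆ b`, or
`a ω(u₁, …, π, …, uₘ) b` with a `⋆`-word `π` in place `i`; here `a` and `b` are possibly empty
sequences of primes. -/
inductive StarWord {Ω : Type*} (ar : Ω → ℕ) (X : Type*) where
  | top : List (Letter ar X) → List (Letter ar X) → StarWord ar X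
  | inner : List (Letter ar X) → (ω : Ω) → (i : Fin (ar ω)) →
      ({j : Fin (ar ω) // j ≠ i} → Word ar X) → StarWord ar X → List (Letter ar X) → StarWord ar X

/-- Multiply a word on the left by a possibly empty sequence of primes. -/
def consList {α : Type*} : List α → FreeSemigroup α → FreeSemigroup α
  | [], u => u
  | a :: l, u => FreeSemigroup.of a * consList l u

/-- Multiply a word on the right by a possibly empty sequence of primes. -/
def appendList {α : Type*} (u : FreeSemigroup α) (l : List α) : FreeSemigroup α :=
  ⟨u.head, u.tail ++ l⟩

/-- `π|_v`: replace `⋆` by the word `v`. -/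
def StarWord.subst {Ω : Type*} {ar : Ω → ℕ} {X : Type*} (v : Word ar X) :
    StarWord ar X → Word ar X
  | .top a b => consList a (appendList v b)
  | .inner a ω i u π b => consList a (appendList
      (FreeSemigroup.of (.op ω fun j => if h : j = i then π.subst v else u ⟨j, h⟩)) b)

/-- `π|_{⋆ c}`: replace `⋆` by `⋆ c`, where `c` is a possibly empty sequence of primes. -/
def StarWord.starMul {Ω : Type*} {ar : Ω → ℕ} {X : Type*} (c : List (Letter ar X)) :
    StarWord ar X → StarWord ar X
  | .top a b => .top a (c ++ b)
  | .inner a ω i u π b => .inner a ω i u (π.starMul c) b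

/-- The product `l π`. -/
def StarWord.mulLeft {Ω : Type*} {ar : Ω → ℕ} {X : Type*} (l : List (Letter ar X)) :
    StarWord ar X → StarWord ar X
  | .top a b => .top (l ++ a) b
  | .inner a ω i u π b => .inner (l ++ a) ω i u π b

/-- The product `π l`. -/
def StarWord.mulRight {Ω : Type*} {ar : Ω → ℕ} {X : Type*} (l : List (Letter ar X)) :
    StarWord ar X → StarWord ar X
  | .top a b => .top a (b ++ l)
  | .inner a ω i u π b => .inner a ω i u π (b ++ l)

/-- Non-associative `Ω`-words with exactly one occurrence of `⋆`. -/
inductive NStarWord {Ω : Type*} (ar : Ω → ℕ) (X : Type*) where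
  | star : NStarWord ar X
  | op : (ω : Ω) → (i : Fin (ar ω)) → ({j : Fin (ar ω) // j ≠ i} → NWord ar X) →
      NStarWord ar X → NStarWord ar X
  | mulL : NStarWord ar X → NWord ar X → NStarWord ar X
  | mulR : NWord ar X → NStarWord ar X → NStarWord ar X

/-- Replace `⋆` by a non-associative word. -/
def NStarWord.subst {Ω : Type*} {ar : Ω → ℕ} {X : Type*} (t : NWord ar X) :
    NStarWord ar X → NWord ar X
  | .star => t
  | .op ω i s C => .op ω fun j => if h : j = i then C.subst t else s ⟨j, h⟩
  | .mulL C s => .mul (C.subst t) s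
  | .mulR s C => .mul s (C.subst t)

/-- The associative `⋆`-word obtained by forgetting the brackets. -/
def NStarWord.word {Ω : Type*} {ar : Ω → ℕ} {X : Type*} : NStarWord ar X → StarWord ar X
  | .star => .top [] []
  | .op ω i s C => .inner [] ω i (fun j => (s j).word) C.word []
  | .mulL C s => C.word.mulRight (letters s.word)
  | .mulR s C => C.word.mulLeft (letters s.word)

/-! ### The free associative `Ω`-algebra and the Lie `Ω`-algebra `Lie(Ω; X)` -/

/-- `k⟨Ω; X⟩`: the linear space on `⟨Ω; X⟩`, with multiplication extending that of words. -/
abbrev Poly (k : Type*) [Field k] {Ω : Type*} (ar : Ω → ℕ) (X : Type*) :=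
  MonoidAlgebra k (Word ar X)

noncomputable section

/-- The generator `x`, as a polynomial. -/
def gen (k : Type*) [Field k] {Ω : Type*} (ar : Ω → ℕ) {X : Type*} (x : X) : Poly k ar X :=
  MonoidAlgebra.single (FreeSemigroup.of (.var x)) 1

/-- The multilinear operation `ω` on `k⟨Ω; X⟩` extending `(u₁, …, uₘ) ↦ ω(u₁, …, uₘ)`. -/
def opPoly {k : Type*} [Field k] {Ω : Type*} {ar : Ω → ℕ} {X : Type*} (ω : Ω)
    (f : Fin (ar ω) → Poly k ar X) : Poly k ar X :=
  ∑ u ∈ Fintype.piFinset fun i => (f i).coeff.support,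
    MonoidAlgebra.single (FreeSemigroup.of (.op ω u)) (∏ i, (f i).coeff (u i))

/-- The commutator `(f g) = f g - g f`. -/
def comm {k : Type*} [Field k] {Ω : Type*} {ar : Ω → ℕ} {X : Type*} (f g : Poly k ar X) :
    Poly k ar X := f * g - g * f

/-- `M` is closed under the commutator and under all the operations in `Ω`. -/
def IsLieOmegaSubalgebra {k : Type*} [Field k] {Ω : Type*} {ar : Ω → ℕ} {X : Type*}
    (M : Submodule k (Poly k ar X)) : Prop :=
  (∀ f ∈ M, ∀ g ∈ M, comm f g ∈ M) ∧
    ∀ (ω : Ω) (f : Fin (ar ω) → Poly k ar X), (∀ i, f i ∈ M) → opPoly ω f ∈ M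

/-- `Lie(Ω; X)`: the Lie `Ω`-subalgebra of `k⟨Ω; X⟩` generated by `X`. -/
def LieOmega (k : Type*) [Field k] {Ω : Type*} (ar : Ω → ℕ) (X : Type*) :
    Submodule k (Poly k ar X) :=
  sInf {M | IsLieOmegaSubalgebra M ∧ ∀ x : X, gen k ar x ∈ M}

theorem lieOmega_isLieOmegaSubalgebra (k : Type*) [Field k] {Ω : Type*} (ar : Ω → ℕ)
    (X : Type*) : IsLieOmegaSubalgebra (LieOmega k ar X) := by
  constructor
  · intro f hf g hg
    simp only [LieOmega, Submodule.mem_sInf] at hf hg ⊢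
    exact fun M hM => hM.1.1 f (hf M hM) g (hg M hM)
  · intro ω f hf
    simp only [LieOmega, Submodule.mem_sInf] at hf ⊢
    exact fun M hM => hM.1.2 ω f fun i => hf i M hM

/-- The Lie bracket of `Lie(Ω; X)`. -/
def lieBr {k : Type*} [Field k] {Ω : Type*} {ar : Ω → ℕ} {X : Type*}
    (f g : LieOmega k ar X) : LieOmega k ar X :=
  ⟨comm f g, (lieOmega_isLieOmegaSubalgebra k ar X).1 f f.2 g g.2⟩

/-- The operation `ω` of `Lie(Ω; X)`. -/
def lieOp {k : Type*} [Field k] {Ω : Type*} {ar : Ω → ℕ} {X : Type*} (ω : Ω)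
    (f : Fin (ar ω) → LieOmega k ar X) : LieOmega k ar X :=
  ⟨opPoly ω fun i => f i, (lieOmega_isLieOmegaSubalgebra k ar X).2 ω _ fun i => (f i).2⟩

/-- Ideals of the Lie `Ω`-algebra `Lie(Ω; X)`: Lie ideals which absorb every operation in each
argument. -/
def IsLieOmegaIdeal {k : Type*} [Field k] {Ω : Type*} {ar : Ω → ℕ} {X : Type*}
    (I : Submodule k (LieOmega k ar X)) : Prop :=
  (∀ f g, g ∈ I → lieBr f g ∈ I) ∧
    ∀ (ω : Ω) (f : Fin (ar ω) → LieOmega k ar X) (i : Fin (ar ω)), f i ∈ I → lieOp ω f ∈ I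

/-- `Id_Lie(S)`: the ideal of the Lie `Ω`-algebra `Lie(Ω; X)` generated by `S`. -/
def lieIdeal {k : Type*} [Field k] {Ω : Type*} {ar : Ω → ℕ} {X : Type*}
    (S : Set (LieOmega k ar X)) : Submodule k (LieOmega k ar X) :=
  sInf {I | IsLieOmegaIdeal I ∧ S ⊆ I}

/-- The value in `k⟨Ω; X⟩` of a non-associative word, the product being the commutator. -/
def NWord.eval (k : Type*) [Field k] {Ω : Type*} {ar : Ω → ℕ} {X : Type*} :
    NWord ar X → Poly k ar X
  | .var x => gen k ar x
  | .op ω t => opPoly ω fun i => (t i).eval k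
  | .mul s t => comm (s.eval k) (t.eval k)

/-- The value in `k⟨Ω; X⟩` of a non-associative `⋆`-word when `⋆` is replaced by `f`. -/
def NStarWord.eval {k : Type*} [Field k] {Ω : Type*} {ar : Ω → ℕ} {X : Type*}
    (f : Poly k ar X) : NStarWord ar X → Poly k ar X
  | .star => f
  | .op ω i s C => opPoly ω fun j => if h : j = i then C.eval f else (s ⟨j, h⟩).eval k
  | .mulL C s => comm (C.eval f) (s.eval k)
  | .mulR s C => comm (s.eval k) (C.eval f)

/-! ### Leading words, compositions, Gröbner–Shirshov bases -/

/-- `v` is the leading word of `f` with respect to the Deg-lex order. -/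
def IsLeading {k : Type*} [Field k] {Ω : Type*} [LT Ω] {ar : Ω → ℕ} {X : Type*} [LT X]
    (f : Poly k ar X) (v : Word ar X) : Prop :=
  f.coeff v ≠ 0 ∧ ∀ u, f.coeff u ≠ 0 → u ≠ v → Word.lt u v

/-- `f` is nonzero and the coefficient of its leading word is `1`. -/
def IsMonic {k : Type*} [Field k] {Ω : Type*} [LT Ω] {ar : Ω → ℕ} {X : Type*} [LT X]
    (f : Poly k ar X) : Prop :=
  ∃ v, IsLeading f v ∧ f.coeff v = 1

/-- `h` is the special normal `f`-word `[π|_f]_{f̄}`. With `v = f̄` and `π|_v` in `ALSW(Ω; X)`,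
write `[π|_v] = π₁|_{[v c]}`, where `π₁` is a non-associative `⋆`-word and the bracketed subword
`[v c]` starts at the given occurrence of `v`; decompose `c = c₁ ⋯ cₘ` with `cᵢ` in `ALSW(Ω; X)`
and `c₁ ≤_lex ⋯ ≤_lex cₘ` (`m = 0` if `c` is empty), and replace `[v c]` by
`[⋯[[f [c₁]] [c₂]] ⋯ [cₘ]]`. In the code, `C` is `π₁`, `t` is `[v c]` and `cs` is the list of the
`[cᵢ]`. -/
def IsSpecialNormal {k : Type*} [Field k] {Ω : Type*} [LT Ω] {ar : Ω → ℕ} {X : Type*} [LT X]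
    (f : Poly k ar X) (π : StarWord ar X) (h : Poly k ar X) : Prop :=
  ∃ (v : Word ar X) (C : NStarWord ar X) (t : NWord ar X) (cs : List (NWord ar X)),
    IsLeading f v ∧ Word.IsALSW (π.subst v) ∧
    (C.subst t).IsNLSW ∧
    t.word = appendList v (cs.flatMap fun c => letters c.word) ∧
    C.word.starMul (cs.flatMap fun c => letters c.word) = π ∧
    (∀ c ∈ cs, c.IsNLSW) ∧
    cs.Pairwise (fun c d => lexLe (letters c.word) (letters d.word)) ∧
    h = C.eval (cs.foldl (fun g c => comm g (c.eval k)) f)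

/-- `h` is a composition `⟨f, g⟩_w`: of intersection, with `w = f̄ a = b ḡ` and
`bre w < bre f̄ + bre ḡ`, or of inclusion, with `w = f̄ = π|_ḡ`. -/
def IsComposition {k : Type*} [Field k] {Ω : Type*} [LT Ω] {ar : Ω → ℕ} {X : Type*} [LT X]
    (f g : Poly k ar X) (w : Word ar X) (h : Poly k ar X) : Prop :=
  ∃ u v, IsLeading f u ∧ IsLeading g v ∧
    ((∃ a b p q, w = u * a ∧ w = b * v ∧ bre w < bre u + bre v ∧
        IsSpecialNormal f (.top [] (letters a)) p ∧
        IsSpecialNormal g (.top (letters b) []) q ∧ h = p - q) ∨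
      ∃ (π : StarWord ar X) (q : Poly k ar X), w = u ∧ w = π.subst v ∧
        IsSpecialNormal g π q ∧ h = f - q)

/-- `h ≡ 0 mod (S, w)`: `h` is a linear combination of special normal `s`-words `[π|_s]_{s̄}`
with `s ∈ S` and `π|_{s̄} < w`. -/
def IsTrivialMod {k : Type*} [Field k] {Ω : Type*} [LT Ω] {ar : Ω → ℕ} {X : Type*} [LT X]
    (S : Set (LieOmega k ar X)) (w : Word ar X) (h : Poly k ar X) : Prop :=
  h ∈ Submodule.span k {p : Poly k ar X | ∃ s ∈ S, ∃ (π : StarWord ar X) (v : Word ar X),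
    IsSpecialNormal (s : Poly k ar X) π p ∧ IsLeading (s : Poly k ar X) v ∧
      Word.lt (π.subst v) w}

/-- `S` is a Gröbner–Shirshov basis in `Lie(Ω; X)`: all the compositions of elements of `S` are
trivial. -/
def IsGSBasis {k : Type*} [Field k] {Ω : Type*} [LT Ω] {ar : Ω → ℕ} {X : Type*} [LT X]
    (S : Set (LieOmega k ar X)) : Prop :=
  ∀ f ∈ S, ∀ g ∈ S, ∀ w h, IsComposition (f : Poly k ar X) (g : Poly k ar X) w h →
    IsTrivialMod S w h

/-- `Irr(S)`: the elements `[w]` of `Lie(Ω; X)` with `w ∈ ALSW(Ω; X)` not of the form `π|_{s̄}`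
for `s ∈ S`. -/
def Irr {k : Type*} [Field k] {Ω : Type*} [LT Ω] {ar : Ω → ℕ} {X : Type*} [LT X]
    (S : Set (LieOmega k ar X)) : Set (LieOmega k ar X) :=
  {h | ∃ t : NWord ar X, t.IsNLSW ∧ (h : Poly k ar X) = t.eval k ∧
    ∀ s ∈ S, ∀ v, IsLeading (s : Poly k ar X) v → ∀ π : StarWord ar X, t.word ≠ π.subst v}

end

end OmegaLie

open OmegaLie

/-!
Why the theorem holds. The Lie compositions are compared with the compositions in the free
associative `Ω`-algebra `k⟨Ω; X⟩`, where the Composition-Diamond lemma is elementary.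

*Lyndon–Shirshov words.* A Lyndon–Shirshov word is larger than each proper suffix, with a
difference in some place (`IsLyndon.lexDiff`), and in a bracketing `((v)(w))` the factor `w` is the
largest proper suffix (`NWord.IsNLSW.lexLe_right`). Hence bracketings exist and are unique, and a
Lyndon–Shirshov subword `v` of a bracketed word starts some subtree with word `v c`
(`exists_subtree`). This gives special normal words (`exists_isSpecialNormal`), and
`[π|_s]_{s̄}` equals `π|_s` up to a combination of `π'|_s` with `π'|_{s̄} < π|_{s̄}`
(`IsSpecialNormal.sub_mem`).

*Leading words of Lie elements.* The elements `[u]` span `Lie(Ω; X)`: brackets are rewritten by the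
Jacobi identity (`comm_eval_mem_bracketSpan`). As `[u]` has leading word `u`, the leading word of a
nonzero element of `Lie(Ω; X)` is in `ALSW(Ω; X)` (`exists_isLeading_of_mem_lieOmega`).

*(i) implies (ii).* A composition in the associative sense of elements of `S` lives on a word
`w ∈ ALSW(Ω; X)`, so it agrees with a Lie composition modulo smaller words; thus a
Gröbner–Shirshov basis in `Lie(Ω; X)` is one in `k⟨Ω; X⟩` (`IsGSBasis.isAssocGSBasis`). For such a
basis, `π|_f` and `π'|_g` agree modulo smaller words whenever `π|_f̄ = π'|_ḡ`: the two occurrences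
are disjoint, nested or overlapping (`IsAssocGSBasis.sub_mem`). In a combination of the `π|_s` the
terms with the largest leading word can therefore be merged into one, and by well-foundedness of the
Deg-lex order the leading word of the combination is some `π|_{s̄}`
(`exists_isLeading_of_mem_span`).

*(ii) implies (iii) implies (i).* Subtracting multiples of `[t]` with `t` irreducible and of special
normal words writes every element of `Lie(Ω; X)` as a combination of `Irr(S)` and of special normal
words with leading words at most its own (`mem_irrSpan_sup_normalSpan`). So `Irr(S)` always spans
the quotient; it is independent if the leading words of the ideal are reducible, and if it is
independent then the irreducible part of a reduced composition vanishes.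
-/

namespace OmegaLie

/-! ### Words as lists of primes -/

section Words

variable {Ω X : Type*} {ar : Ω → ℕ}

@[simp] theorem letters_mul {α : Type*} (u v : FreeSemigroup α) :
    letters (u * v) = letters u ++ letters v := rfl

@[simp] theorem letters_of {α : Type*} (a : α) : letters (FreeSemigroup.of a) = [a] := rfl

theorem letters_injective {α : Type*} {u v : FreeSemigroup α} (h : letters u = letters v) :
    u = v := by
  cases u; cases v; simp_all [letters]

theorem letters_ne_nil {α : Type*} (u : FreeSemigroup α) : letters u ≠ [] := by simp [letters]

theorem length_letters_pos {α : Type*} (u : FreeSemigroup α) : 0 < (letters u).length := by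
  simp [letters]

theorem exists_letters_eq {α : Type*} {l : List α} (h : l ≠ []) :
    ∃ u : FreeSemigroup α, letters u = l := by
  cases l with
  | nil => exact absurd rfl h
  | cons a l => exact ⟨⟨a, l⟩, rfl⟩

@[simp] theorem letters_consList {α : Type*} (l : List α) (u : FreeSemigroup α) :
    letters (consList l u) = l ++ letters u := by
  induction l with
  | nil => rfl
  | cons a l ih => simp [consList, ih]

@[simp] theorem letters_appendList {α : Type*} (l : List α) (u : FreeSemigroup α) :
    letters (appendList u l) = letters u ++ l := rfl

theorem bre_eq (u : Word ar X) : bre u = (letters u).length := rfl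

theorem Word.deg_eq (u : Word ar X) : Word.deg u = listDeg (letters u) := by
  cases u; simp [Word.deg, listDeg, letters]

theorem listDeg_append (l m : List (Letter ar X)) :
    listDeg (l ++ m) = listDeg l + listDeg m := by
  induction l with
  | nil => simp [listDeg]
  | cons a l ih => simp [listDeg, ih, add_assoc]

theorem Letter.deg_pos (a : Letter ar X) : 0 < a.deg := by
  cases a <;> simp [Letter.deg]

theorem Word.deg_pos (u : Word ar X) : 0 < Word.deg u := by
  cases u with
  | mk a l => have := a.deg_pos; simp only [Word.deg]; omega

theorem Letter.deg_op (ω : Ω) (u : Fin (ar ω) → Word ar X) :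
    (Letter.op ω u).deg = 1 + ∑ i, Word.deg (u i) := by simp [Letter.deg]

theorem Word.deg_lt_deg_op (ω : Ω) (u : Fin (ar ω) → Word ar X) (i : Fin (ar ω)) :
    Word.deg (u i) < (Letter.op ω u).deg := by
  rw [Letter.deg_op]
  have := Finset.single_le_sum (f := fun i => Word.deg (u i)) (fun _ _ => Nat.zero_le _)
    (Finset.mem_univ i)
  omega

theorem Letter.deg_le_listDeg {a : Letter ar X} {l : List (Letter ar X)} (h : a ∈ l) :
    a.deg ≤ listDeg l := by
  induction l with
  | nil => simp at h
  | cons b l ih =>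
    rcases List.mem_cons.1 h with rfl | h
    · simp [listDeg]
    · have := ih h; simp only [listDeg]; omega

end Words

/-! ### The Deg-lex order is a monomial well-order -/

section DegLex

variable {Ω X : Type*} [LinearOrder Ω] [LinearOrder X] {ar : Ω → ℕ}

/-- The Deg-lex comparison of possibly empty sequences of primes. -/
def seqLt (l m : List (Letter ar X)) : Prop :=
  listDeg l < listDeg m ∨ (listDeg l = listDeg m ∧
    (l.length < m.length ∨ (l.length = m.length ∧ listLt l m)))

theorem Word.lt_iff (u v : Word ar X) : Word.lt u v ↔ seqLt (letters u) (letters v) := by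
  cases u; cases v
  simp [Word.lt, seqLt, letters, Word.deg, listDeg, listLt]

theorem listLt_cons {a b : Letter ar X} {l m : List (Letter ar X)} :
    listLt (a :: l) (b :: m) ↔ Letter.lt a b ∨ (a = b ∧ listLt l m) := by
  simp [listLt]

theorem not_listLt_nil (l : List (Letter ar X)) : ¬ listLt l [] := by
  cases l <;> simp [listLt]

theorem Letter.lt_of_deg_lt {a b : Letter ar X} (h : a.deg < b.deg) : Letter.lt a b := by
  cases a <;> simp [Letter.lt, h]

theorem Letter.deg_le_of_lt {a b : Letter ar X} (h : Letter.lt a b) : a.deg ≤ b.deg := by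
  cases a with
  | var x =>
    rcases h with h | ⟨y, rfl, -⟩
    · exact h.le
    · simp [Letter.deg]
  | op ω u =>
    rcases h with h | h
    · exact h.le
    · exact h.1.le

theorem Letter.op_lt_op_iff {ω : Ω} {u v : Fin (ar ω) → Word ar X} :
    Letter.lt (.op ω u) (.op ω v) ↔ (Letter.op ω u).deg < (Letter.op ω v).deg ∨
      ((Letter.op ω u).deg = (Letter.op ω v).deg ∧
        ∃ i, (∀ j, j < i → u j = v j) ∧ Word.lt (u i) (v i)) := by
  rw [Letter.lt]
  refine or_congr_right (and_congr_right fun _ => ⟨?_, ?_⟩)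
  · rintro (⟨θ, w, h, hlt⟩ | ⟨w, h, i, hi⟩)
    · cases h; exact absurd hlt (lt_irrefl _)
    · cases h; exact ⟨i, hi⟩
  · rintro ⟨i, hi⟩
    exact Or.inr ⟨v, rfl, i, hi⟩

theorem listLt_irrefl_of {l : List (Letter ar X)} (h : ∀ a ∈ l, ¬ Letter.lt a a) :
    ¬ listLt l l := by
  induction l with
  | nil => simp [listLt]
  | cons a l ih =>
    rw [listLt_cons]
    rintro (h' | ⟨-, h'⟩)
    · exact h a (by simp) h'
    · exact ih (fun b hb => h b (by simp [hb])) h'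

theorem Letter.lt_irrefl (a : Letter ar X) : ¬ Letter.lt a a := by
  induction hn : a.deg using Nat.strong_induction_on generalizing a with
  | _ n ih =>
  subst hn
  cases a with
  | var x => simp [Letter.lt]
  | op ω u =>
    rw [Letter.op_lt_op_iff]
    rintro (h | ⟨-, i, -, h⟩)
    · exact absurd h (_root_.lt_irrefl _)
    · rw [Word.lt_iff] at h
      rcases h with h | ⟨-, h | ⟨-, h⟩⟩
      · exact absurd h (_root_.lt_irrefl _)
      · exact absurd h (_root_.lt_irrefl _)
      · refine listLt_irrefl_of (fun a ha => ih _ ?_ a rfl) h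
        have h1 := Letter.deg_le_listDeg ha
        have h2 := Word.deg_lt_deg_op ω u i
        rw [Word.deg_eq] at h2
        omega

theorem Word.lt_irrefl (u : Word ar X) : ¬ Word.lt u u := by
  rw [Word.lt_iff]
  rintro (h | ⟨-, h | ⟨-, h⟩⟩)
  · exact absurd h (_root_.lt_irrefl _)
  · exact absurd h (_root_.lt_irrefl _)
  · exact listLt_irrefl_of (fun a _ => Letter.lt_irrefl a) h

theorem listLt_trans_of {l m r : List (Letter ar X)}
    (h : ∀ a ∈ l, ∀ b c, Letter.lt a b → Letter.lt b c → Letter.lt a c)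
    (h1 : listLt l m) (h2 : listLt m r) : listLt l r := by
  induction l generalizing m r with
  | nil => simp [listLt] at h1
  | cons a l ih =>
    cases m with
    | nil => exact absurd h1 (not_listLt_nil _)
    | cons b m =>
      cases r with
      | nil => exact absurd h2 (not_listLt_nil _)
      | cons c r =>
        rw [listLt_cons] at *
        rcases h1 with h1 | ⟨rfl, h1⟩ <;> rcases h2 with h2 | ⟨rfl, h2⟩
        · exact Or.inl (h a (by simp) b c h1 h2)
        · exact Or.inl h1
        · exact Or.inl h2
        · exact Or.inr ⟨rfl, ih (fun a ha => h a (by simp [ha])) h1 h2⟩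

theorem seqLt_trans_of {l m r : List (Letter ar X)}
    (h : ∀ a ∈ l, ∀ b c, Letter.lt a b → Letter.lt b c → Letter.lt a c)
    (h1 : seqLt l m) (h2 : seqLt m r) : seqLt l r := by
  rcases h1 with h1 | ⟨e1, h1 | ⟨f1, h1⟩⟩ <;> rcases h2 with h2 | ⟨e2, h2 | ⟨f2, h2⟩⟩
  · exact Or.inl (h1.trans h2)
  · exact Or.inl (by omega)
  · exact Or.inl (by omega)
  · exact Or.inl (by omega)
  · exact Or.inr ⟨by omega, Or.inl (by omega)⟩
  · exact Or.inr ⟨by omega, Or.inl (by omega)⟩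
  · exact Or.inl (by omega)
  · exact Or.inr ⟨by omega, Or.inl (by omega)⟩
  · exact Or.inr ⟨by omega, Or.inr ⟨by omega, listLt_trans_of h h1 h2⟩⟩

theorem Letter.lt_trans {a b c : Letter ar X} (h1 : Letter.lt a b) (h2 : Letter.lt b c) :
    Letter.lt a c := by
  induction hn : a.deg using Nat.strong_induction_on generalizing a b c with
  | _ n ih =>
  subst hn
  have d1 := Letter.deg_le_of_lt h1
  have d2 := Letter.deg_le_of_lt h2
  by_cases hd : a.deg < c.deg
  · exact Letter.lt_of_deg_lt hd
  have e1 : a.deg = b.deg := by omega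
  have e2 : b.deg = c.deg := by omega
  cases a with
  | var x =>
    rcases h1 with h1 | ⟨y, rfl, hxy⟩
    · omega
    rcases h2 with h2 | ⟨z, rfl, hyz⟩
    · omega
    exact Or.inr ⟨z, rfl, hxy.trans hyz⟩
  | op ω u =>
    rcases h1 with h1 | ⟨-, ⟨θ, v, rfl, hθ⟩ | ⟨v, rfl, i, hi, huv⟩⟩
    · omega
    · rcases h2 with h2 | ⟨-, ⟨η, w, rfl, hη⟩ | ⟨w, rfl, j, hj, hvw⟩⟩
      · omega
      · exact Or.inr ⟨e1.trans e2, Or.inl ⟨η, w, rfl, hθ.trans hη⟩⟩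
      · exact Or.inr ⟨e1.trans e2, Or.inl ⟨θ, w, rfl, hθ⟩⟩
    · rcases h2 with h2 | ⟨-, ⟨η, w, rfl, hη⟩ | ⟨w, rfl, j, hj, hvw⟩⟩
      · omega
      · exact Or.inr ⟨e1.trans e2, Or.inl ⟨η, w, rfl, hη⟩⟩
      · refine Or.inr ⟨e1.trans e2, Or.inr ⟨w, rfl, min i j, fun l hl => ?_, ?_⟩⟩
        · exact (hi l (lt_min_iff.1 hl).1).trans (hj l (lt_min_iff.1 hl).2)
        · rcases _root_.lt_trichotomy i j with hij | rfl | hij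
          · rw [min_eq_left hij.le, ← hj i hij]; exact huv
          · rw [min_self, Word.lt_iff]
            rw [Word.lt_iff] at huv hvw
            refine seqLt_trans_of (fun a ha b c hab hbc => ih a.deg ?_ hab hbc rfl) huv hvw
            have h1 := Letter.deg_le_listDeg ha
            have h2 := Word.deg_lt_deg_op ω u i
            rw [Word.deg_eq] at h2
            omega
          · rw [min_eq_right hij.le, hi j hij]; exact hvw

theorem Word.lt_trans {u v w : Word ar X} (h1 : Word.lt u v) (h2 : Word.lt v w) :
    Word.lt u w := by
  rw [Word.lt_iff] at *
  exact seqLt_trans_of (fun _ _ _ _ => Letter.lt_trans) h1 h2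

theorem Word.lt_asymm {u v : Word ar X} (h1 : Word.lt u v) (h2 : Word.lt v u) : False :=
  Word.lt_irrefl _ (Word.lt_trans h1 h2)

theorem listLt_trichotomy_of {l m : List (Letter ar X)} (hlm : l.length = m.length)
    (h : ∀ a ∈ l, ∀ b, Letter.lt a b ∨ a = b ∨ Letter.lt b a) :
    listLt l m ∨ l = m ∨ listLt m l := by
  induction l generalizing m with
  | nil =>
    cases m with
    | nil => simp
    | cons b m => simp at hlm
  | cons a l ih =>
    cases m with
    | nil => simp at hlm
    | cons b m =>
      simp only [listLt_cons]
      rcases h a (by simp) b with h' | rfl | h'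
      · simp [h']
      · rcases ih (by simpa using hlm) (fun a ha => h a (by simp [ha])) with h' | h' | h' <;>
          simp [h']
      · simp [h']

theorem seqLt_trichotomy_of {l m : List (Letter ar X)}
    (h : ∀ a ∈ l, ∀ b, Letter.lt a b ∨ a = b ∨ Letter.lt b a) :
    seqLt l m ∨ l = m ∨ seqLt m l := by
  unfold seqLt
  rcases _root_.lt_trichotomy (listDeg l) (listDeg m) with h1 | h1 | h1
  · simp [h1]
  · rcases _root_.lt_trichotomy l.length m.length with h2 | h2 | h2
    · simp [h1, h2]
    · rcases listLt_trichotomy_of h2 h with h' | h' | h' <;> simp [h1, h2, h']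
    · simp [h1, h2]
  · simp [h1]

theorem Letter.lt_trichotomy (har : ∀ ω, 1 ≤ ar ω) (a b : Letter ar X) :
    Letter.lt a b ∨ a = b ∨ Letter.lt b a := by
  induction hn : a.deg using Nat.strong_induction_on generalizing a b with
  | _ n ih =>
  subst hn
  rcases _root_.lt_trichotomy a.deg b.deg with hd | hd | hd
  · exact Or.inl (Letter.lt_of_deg_lt hd)
  · -- A prime `ω(u₁, …)` has degree at least two because `ω` has at least one argument.
    have key : ∀ (ω : Ω) (u : Fin (ar ω) → Word ar X), 2 ≤ (Letter.op ω u).deg := by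
      intro ω u
      have h1 := Word.deg_lt_deg_op ω u ⟨0, har ω⟩
      have h2 := Word.deg_pos (u ⟨0, har ω⟩)
      omega
    cases a with
    | var x =>
      cases b with
      | var y =>
        rcases _root_.lt_trichotomy x y with h | h | h <;> simp [Letter.lt, h]
      | op θ v => have := key θ v; simp only [Letter.deg] at this hd; omega
    | op ω u =>
      cases b with
      | var y => have := key ω u; simp only [Letter.deg] at this hd; omega
      | op θ v =>
        rcases _root_.lt_trichotomy ω θ with h | rfl | h
        · exact Or.inl (Or.inr ⟨hd, Or.inl ⟨θ, v, rfl, h⟩⟩)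
        · by_cases huv : u = v
          · exact Or.inr (Or.inl (by rw [huv]))
          · obtain ⟨i, hi, hmin⟩ := WellFounded.has_min (wellFounded_lt (α := Fin (ar ω)))
              {i | u i ≠ v i} (by simpa [Set.Nonempty] using Function.ne_iff.1 huv)
            have hmin' : ∀ j, j < i → u j = v j := fun j hj => by
              by_contra hne; exact hmin j hne hj
            rcases seqLt_trichotomy_of (l := letters (u i)) (m := letters (v i))
              (fun a ha b => ih a.deg (by
                have h1 := Letter.deg_le_listDeg ha
                have h2 := Word.deg_lt_deg_op ω u i
                rw [Word.deg_eq] at h2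
                omega) a b rfl) with h | h | h
            · exact Or.inl (Letter.op_lt_op_iff.2 (Or.inr ⟨hd, i, hmin', (Word.lt_iff _ _).2 h⟩))
            · exact absurd (letters_injective h) hi
            · exact Or.inr (Or.inr (Letter.op_lt_op_iff.2 (Or.inr ⟨hd.symm, i,
                fun j hj => (hmin' j hj).symm, (Word.lt_iff _ _).2 h⟩)))
        · exact Or.inr (Or.inr (Or.inr ⟨hd.symm, Or.inl ⟨ω, u, rfl, h⟩⟩))
  · exact Or.inr (Or.inr (Letter.lt_of_deg_lt hd))

theorem Word.lt_trichotomy (har : ∀ ω, 1 ≤ ar ω) (u v : Word ar X) :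
    Word.lt u v ∨ u = v ∨ Word.lt v u := by
  rw [Word.lt_iff, Word.lt_iff]
  rcases seqLt_trichotomy_of (l := letters u) (m := letters v)
    (fun a _ b => Letter.lt_trichotomy har a b) with h | h | h
  · exact Or.inl h
  · exact Or.inr (Or.inl (letters_injective h))
  · exact Or.inr (Or.inr h)

/-- Restricting a relation to its accessible part makes it well-founded. -/
theorem wellFounded_and_acc {α : Type*} (r : α → α → Prop) :
    WellFounded fun a b => r a b ∧ Acc r b := by
  refine ⟨fun b => ⟨b, fun a hab => ?_⟩⟩
  have ha : Acc r a := hab.2.inv hab.1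
  clear hab
  induction ha with
  | intro a _ ih => exact ⟨a, fun c hc => ih c hc.1⟩

theorem lex_of_listLt {l m : List (Letter ar X)} (hlm : l.length = m.length)
    (hm : ∀ a ∈ m, Acc Letter.lt a) (h : listLt l m) :
    List.Lex (fun a b => Letter.lt a b ∧ Acc Letter.lt b) l m := by
  induction l generalizing m with
  | nil => simp [listLt] at h
  | cons a l ih =>
    cases m with
    | nil => simp at hlm
    | cons b m =>
      rcases listLt_cons.1 h with h' | ⟨rfl, h'⟩
      · exact List.Lex.rel ⟨h', hm b (by simp)⟩
      · exact List.Lex.cons (ih (by simpa using hlm) (fun a ha => hm a (by simp [ha])) h')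

theorem acc_letter [WellFoundedLT Ω] [WellFoundedLT X] (d : ℕ)
    (ih : ∀ u : Word ar X, Word.deg u < d → Acc Word.lt u)
    (ih' : ∀ a : Letter ar X, a.deg < d → Acc Letter.lt a) (a : Letter ar X) (ha : a.deg = d) :
    Acc Letter.lt a := by
  cases a with
  | var x =>
    induction x using WellFoundedLT.induction with
    | _ x ihx =>
    refine ⟨_, fun b hb => ?_⟩
    cases b with
    | var y =>
      rcases hb with hb | ⟨z, hz, hyz⟩
      · simp [Letter.deg] at hb
      · cases hz; exact ihx y hyz (by simpa [Letter.deg] using ha)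
    | op θ v =>
      rcases hb with hb | ⟨-, ⟨η, w, h, -⟩ | ⟨w, h, -⟩⟩
      · exact ih' _ (by omega)
      · cases h
      · cases h
  | op ω u =>
    induction ω using WellFoundedLT.induction with
    | _ ω ihω =>
    have wf : WellFounded (Pi.Lex (ι := Fin (ar ω)) (β := fun _ => Word ar X) (· < ·)
        (fun {_} u v => Word.lt u v ∧ Acc Word.lt v)) :=
      Pi.Lex.wellFounded _ fun _ => wellFounded_and_acc _
    induction u using wf.induction with
    | _ u ihu =>
    refine ⟨_, fun b hb => ?_⟩
    rcases (Letter.deg_le_of_lt hb).lt_or_eq with hd | hd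
    · exact ih' _ (by omega)
    cases b with
    | var y =>
      rcases hb with hb | ⟨z, hz, -⟩
      · omega
      · cases hz
    | op θ v =>
      rcases hb with hb | ⟨-, ⟨η, w, h, hlt⟩ | ⟨w, h, i, hi, hlt⟩⟩
      · omega
      · cases h; exact ihω θ hlt v (by omega)
      · cases h
        refine ihu v ⟨i, hi, hlt, ih _ ?_⟩ (by omega)
        have := Word.deg_lt_deg_op ω u i
        omega

theorem acc_word (d : ℕ) (ih : ∀ u : Word ar X, Word.deg u < d → Acc Word.lt u)
    (ih' : ∀ a : Letter ar X, a.deg ≤ d → Acc Letter.lt a) (u : Word ar X)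
    (hu : Word.deg u = d) : Acc Word.lt u := by
  have wf : WellFounded (List.Shortlex fun a b : Letter ar X => Letter.lt a b ∧ Acc Letter.lt b) :=
    List.Shortlex.wf (wellFounded_and_acc _)
  have wf' := InvImage.wf (letters (α := Letter ar X)) wf
  induction u using wf'.induction with
  | _ u ihu =>
  refine ⟨_, fun v hv => ?_⟩
  have hv' := (Word.lt_iff _ _).1 hv
  rcases hv' with h | ⟨e, h⟩
  · exact ih v (by rw [Word.deg_eq] at *; omega)
  · refine ihu v ?_ (by rw [Word.deg_eq] at *; omega)
    rcases h with h | ⟨h1, h2⟩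
    · exact List.Shortlex.of_length_lt h
    · refine List.Shortlex.of_lex h1 (lex_of_listLt h1 (fun a ha => ih' a ?_) h2)
      rw [← hu, Word.deg_eq]; exact Letter.deg_le_listDeg ha

/-- The Deg-lex order is well-founded: words of degree less than `d` are accessible by induction,
then primes of degree `d`, then words of degree `d`. -/
theorem Word.lt_wf [WellFoundedLT Ω] [WellFoundedLT X] :
    WellFounded (Word.lt : Word ar X → Word ar X → Prop) := by
  have key : ∀ d, (∀ u : Word ar X, Word.deg u < d → Acc Word.lt u) ∧
      ∀ a : Letter ar X, a.deg < d → Acc Letter.lt a := by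
    intro d
    induction d with
    | zero => exact ⟨fun u hu => by omega, fun a ha => by omega⟩
    | succ d ih =>
      have hl : ∀ a : Letter ar X, a.deg < d + 1 → Acc Letter.lt a := fun a ha => by
        rcases (Nat.lt_succ_iff.1 ha).lt_or_eq with h | h
        · exact ih.2 a h
        · exact acc_letter d ih.1 ih.2 a h
      refine ⟨fun u hu => ?_, hl⟩
      rcases (Nat.lt_succ_iff.1 hu).lt_or_eq with h | h
      · exact ih.1 u h
      · exact acc_word d ih.1 (fun a ha => hl a (by omega)) u h
  exact ⟨fun u => (key (Word.deg u + 1)).1 u (by omega)⟩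

theorem listLt_append_left {l m : List (Letter ar X)} (p : List (Letter ar X))
    (h : listLt l m) : listLt (p ++ l) (p ++ m) := by
  induction p with
  | nil => exact h
  | cons a p ih => exact listLt_cons.2 (Or.inr ⟨rfl, ih⟩)

theorem listLt_append_right {l m : List (Letter ar X)} (p q : List (Letter ar X))
    (h : listLt l m) : listLt (l ++ p) (m ++ q) := by
  induction l generalizing m with
  | nil => simp [listLt] at h
  | cons a l ih =>
    cases m with
    | nil => exact absurd h (not_listLt_nil _)
    | cons b m =>
      rcases listLt_cons.1 h with h' | ⟨rfl, h'⟩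
      · exact listLt_cons.2 (Or.inl h')
      · exact listLt_cons.2 (Or.inr ⟨rfl, ih h'⟩)

theorem seqLt_append {l m : List (Letter ar X)} (p q : List (Letter ar X)) (h : seqLt l m) :
    seqLt (p ++ l ++ q) (p ++ m ++ q) := by
  simp only [seqLt, listDeg_append, List.length_append] at *
  rcases h with h | ⟨e, h | ⟨f, h⟩⟩
  · exact Or.inl (by omega)
  · exact Or.inr ⟨by omega, Or.inl (by omega)⟩
  · exact Or.inr ⟨by omega, Or.inr ⟨by omega,
      listLt_append_right q q (listLt_append_left p h)⟩⟩

theorem Word.mul_lt_mul_left {u v : Word ar X} (w : Word ar X) (h : Word.lt u v) :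
    Word.lt (w * u) (w * v) := by
  rw [Word.lt_iff] at *
  simpa using seqLt_append (letters w) [] h

theorem Word.mul_lt_mul_right {u v : Word ar X} (w : Word ar X) (h : Word.lt u v) :
    Word.lt (u * w) (v * w) := by
  rw [Word.lt_iff] at *
  simpa using seqLt_append [] (letters w) h

/-- If `uᵢ ≤ vᵢ` for all `i`, with one strict inequality, then `ω(u₁, …) < ω(v₁, …)`. -/
theorem Letter.op_lt_op {ω : Ω} {u v : Fin (ar ω) → Word ar X}
    (h : ∀ i, u i = v i ∨ Word.lt (u i) (v i)) (hne : u ≠ v) :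
    Letter.lt (.op ω u) (.op ω v) := by
  have hdeg : (Letter.op ω u).deg ≤ (Letter.op ω v).deg := by
    rw [Letter.deg_op, Letter.deg_op]
    refine Nat.add_le_add_left (Finset.sum_le_sum fun i _ => ?_) 1
    rcases h i with h | h
    · rw [h]
    · rw [Word.lt_iff] at h
      rw [Word.deg_eq, Word.deg_eq]
      rcases h with h | h
      · exact h.le
      · exact h.1.le
  rw [Letter.op_lt_op_iff]
  rcases hdeg.lt_or_eq with hd | hd
  · exact Or.inl hd
  · obtain ⟨i, hi, hmin⟩ := WellFounded.has_min (wellFounded_lt (α := Fin (ar ω)))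
      {i | u i ≠ v i} (by simpa [Set.Nonempty] using Function.ne_iff.1 hne)
    refine Or.inr ⟨hd, i, fun j hj => ?_, (h i).resolve_left hi⟩
    by_contra hne
    exact hmin j hne hj

theorem seqLt_singleton {a b : Letter ar X} (h : Letter.lt a b) : seqLt [a] [b] := by
  have := Letter.deg_le_of_lt h
  rcases this.lt_or_eq with hd | hd
  · exact Or.inl (by simpa [listDeg] using hd)
  · exact Or.inr ⟨by simpa [listDeg] using hd, Or.inr ⟨rfl, by simp [listLt_cons, h]⟩⟩

theorem Word.of_lt_of {a b : Letter ar X} (h : Letter.lt a b) :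
    Word.lt (FreeSemigroup.of a) (FreeSemigroup.of b) :=
  (Word.lt_iff _ _).2 (seqLt_singleton h)

/-- The Deg-lex order is monomial: it is compatible with substitution into a `⋆`-word. -/
theorem StarWord.subst_lt_subst (π : StarWord ar X) {u v : Word ar X} (h : Word.lt u v) :
    Word.lt (π.subst u) (π.subst v) := by
  induction π with
  | top a b =>
    rw [Word.lt_iff] at *
    simpa [StarWord.subst] using seqLt_append a b h
  | inner a ω i w π b ih =>
    have hne : π.subst u ≠ π.subst v := fun e => Word.lt_irrefl _ (e ▸ ih)
    rw [Word.lt_iff]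
    simp only [StarWord.subst, letters_consList, letters_appendList, letters_of]
    rw [← List.append_assoc, ← List.append_assoc]
    refine seqLt_append a b (seqLt_singleton (Letter.op_lt_op (fun j => ?_) fun e => hne ?_))
    · by_cases hj : j = i
      · simp [hj, ih]
      · simp [hj]
    · simpa using congrFun e i

end DegLex

/-! ### The lexicographic order on sequences of primes -/

section Lex

variable {Ω X : Type*} [LinearOrder Ω] [LinearOrder X] {ar : Ω → ℕ}

/-- `u <_lex v` because of a difference in some place, not because `v` is a proper prefix
of `u`. -/
def lexDiff : List (Letter ar X) → List (Letter ar X) → Prop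
  | a :: l, b :: m => Letter.lt a b ∨ (a = b ∧ lexDiff l m)
  | _, _ => False

theorem lexDiff.append {u v : List (Letter ar X)} (h : lexDiff u v) (x y : List (Letter ar X)) :
    lexDiff (u ++ x) (v ++ y) := by
  induction u generalizing v with
  | nil => simp [lexDiff] at h
  | cons a l ih =>
    cases v with
    | nil => simp [lexDiff] at h
    | cons b m =>
      rcases h with h | ⟨rfl, h⟩
      · exact Or.inl h
      · exact Or.inr ⟨rfl, ih h⟩

theorem lexLt_iff {u v : List (Letter ar X)} :
    lexLt u v ↔ lexDiff u v ∨ ∃ z, z ≠ [] ∧ u = v ++ z := by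
  induction u generalizing v with
  | nil => simp +contextual [lexLt, lexDiff, eq_comm]
  | cons a l ih =>
    cases v with
    | nil => simp [lexLt, lexDiff]
    | cons b m =>
      simp only [lexLt, lexDiff, ih, List.cons_append, List.cons.injEq]
      constructor
      · rintro (h | ⟨rfl, h | ⟨z, hz, rfl⟩⟩)
        · exact Or.inl (Or.inl h)
        · exact Or.inl (Or.inr ⟨rfl, h⟩)
        · exact Or.inr ⟨z, hz, rfl, rfl⟩
      · rintro ((h | h) | ⟨z, hz, rfl, rfl⟩)
        · exact Or.inl h
        · exact Or.inr ⟨h.1, Or.inl h.2⟩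
        · exact Or.inr ⟨rfl, Or.inr ⟨z, hz, rfl⟩⟩

theorem lexDiff.lexLt {u v : List (Letter ar X)} (h : lexDiff u v) : lexLt u v :=
  lexLt_iff.2 (Or.inl h)

theorem lexLt_append_self (v : List (Letter ar X)) {z : List (Letter ar X)} (hz : z ≠ []) :
    lexLt (v ++ z) v := lexLt_iff.2 (Or.inr ⟨z, hz, rfl⟩)

theorem lexLe_append_self (v z : List (Letter ar X)) : lexLe (v ++ z) v := by
  rcases eq_or_ne z [] with rfl | hz
  · exact Or.inl (by simp)
  · exact Or.inr (lexLt_append_self v hz)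

theorem lexLt_append_left {u v : List (Letter ar X)} (p : List (Letter ar X)) :
    lexLt (p ++ u) (p ++ v) ↔ lexLt u v := by
  induction p with
  | nil => rfl
  | cons a p ih => simp [lexLt, ih, Letter.lt_irrefl]

theorem lexLt_irrefl (u : List (Letter ar X)) : ¬ lexLt u u := by
  induction u with
  | nil => simp [lexLt]
  | cons a l ih => simp [lexLt, ih, Letter.lt_irrefl]

theorem lexLt_trans {u v w : List (Letter ar X)} (h1 : lexLt u v) (h2 : lexLt v w) :
    lexLt u w := by
  induction u generalizing v w with
  | nil => simp [lexLt] at h1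
  | cons a l ih =>
    cases v with
    | nil => simp [lexLt] at h2
    | cons b m =>
      cases w with
      | nil => simp [lexLt]
      | cons c r =>
        rcases h1 with h1 | ⟨rfl, h1⟩ <;> rcases h2 with h2 | ⟨rfl, h2⟩
        · exact Or.inl (Letter.lt_trans h1 h2)
        · exact Or.inl h1
        · exact Or.inl h2
        · exact Or.inr ⟨rfl, ih h1 h2⟩

theorem lexLt_asymm {u v : List (Letter ar X)} (h1 : lexLt u v) (h2 : lexLt v u) : False :=
  lexLt_irrefl _ (lexLt_trans h1 h2)

theorem lexLe_trans {u v w : List (Letter ar X)} (h1 : lexLe u v) (h2 : lexLe v w) :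
    lexLe u w := by
  rcases h1 with rfl | h1
  · exact h2
  · rcases h2 with rfl | h2
    · exact Or.inr h1
    · exact Or.inr (lexLt_trans h1 h2)

theorem lexLt_of_le_of_lt {u v w : List (Letter ar X)} (h1 : lexLe u v) (h2 : lexLt v w) :
    lexLt u w := by
  rcases h1 with rfl | h1
  · exact h2
  · exact lexLt_trans h1 h2

theorem lexLt_of_lt_of_le {u v w : List (Letter ar X)} (h1 : lexLt u v) (h2 : lexLe v w) :
    lexLt u w := by
  rcases h2 with rfl | h2
  · exact h1
  · exact lexLt_trans h1 h2

theorem not_lexLt_of_le {u v : List (Letter ar X)} (h : lexLe u v) : ¬ lexLt v u := by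
  rintro h'
  exact lexLt_irrefl _ (lexLt_of_le_of_lt h h')

theorem lexLe_antisymm {u v : List (Letter ar X)} (h1 : lexLe u v) (h2 : lexLe v u) : u = v := by
  rcases h1 with h | h
  · exact h
  · exact absurd h (not_lexLt_of_le h2)

theorem lexLt_trichotomy (har : ∀ ω, 1 ≤ ar ω) (u v : List (Letter ar X)) :
    lexLt u v ∨ u = v ∨ lexLt v u := by
  induction u generalizing v with
  | nil => cases v <;> simp [lexLt]
  | cons a l ih =>
    cases v with
    | nil => simp [lexLt]
    | cons b m =>
      rcases Letter.lt_trichotomy har a b with h | rfl | h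
      · exact Or.inl (Or.inl h)
      · rcases ih m with h | rfl | h
        · exact Or.inl (Or.inr ⟨rfl, h⟩)
        · exact Or.inr (Or.inl rfl)
        · exact Or.inr (Or.inr (Or.inr ⟨rfl, h⟩))
      · exact Or.inr (Or.inr (Or.inl h))

theorem lexLe_or_lexLt (har : ∀ ω, 1 ≤ ar ω) (u v : List (Letter ar X)) :
    lexLe u v ∨ lexLt v u := by
  rcases lexLt_trichotomy har u v with h | h | h
  · exact Or.inl (Or.inr h)
  · exact Or.inl (Or.inl h)
  · exact Or.inr h

/-- `u <_lex v` for a word `u` that is not longer than `v` means a difference in some place. -/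
theorem lexDiff_of_lexLt {u v : List (Letter ar X)} (h : lexLt u v) (hl : u.length ≤ v.length) :
    lexDiff u v := by
  rcases lexLt_iff.1 h with h | ⟨z, hz, rfl⟩
  · exact h
  · have := List.length_pos_iff.2 hz
    simp only [List.length_append] at hl; omega

theorem listLt_of_lexLt {u v : List (Letter ar X)} (h : lexLt u v) (hl : u.length = v.length) :
    listLt u v := by
  induction u generalizing v with
  | nil => simp [lexLt] at h
  | cons a l ih =>
    cases v with
    | nil => simp at hl
    | cons b m =>
      rcases h with h | ⟨rfl, h⟩
      · exact listLt_cons.2 (Or.inl h)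
      · exact listLt_cons.2 (Or.inr ⟨rfl, ih h (by simpa using hl)⟩)

/-- On `pq` and `qp` the Deg-lex order and the lex-order agree. -/
theorem Word.mul_lt_mul_of_lexLt {u v : Word ar X}
    (h : lexLt (letters u ++ letters v) (letters v ++ letters u)) : Word.lt (u * v) (v * u) := by
  rw [Word.lt_iff, letters_mul, letters_mul]
  refine Or.inr ⟨?_, Or.inr ⟨?_, listLt_of_lexLt h ?_⟩⟩
  · rw [listDeg_append, listDeg_append, add_comm]
  · simp [add_comm]
  · simp [add_comm]

end Lex

/-! ### Lyndon–Shirshov words -/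

section Lyndon

variable {Ω X : Type*} [LinearOrder Ω] [LinearOrder X] {ar : Ω → ℕ}

/-- A Lyndon–Shirshov word is larger than its proper suffixes and has no borders. -/
theorem IsLyndon.lexDiff (har : ∀ ω, 1 ≤ ar ω) {p q : List (Letter ar X)}
    (h : IsLyndon (p ++ q)) (hp : p ≠ []) (hq : q ≠ []) : lexDiff q (p ++ q) := by
  have hp' := List.length_pos_iff.2 hp
  rcases lexLt_trichotomy har q (p ++ q) with h1 | h1 | h1
  · exact lexDiff_of_lexLt h1 (by simp)
  · have := congrArg List.length h1
    simp only [List.length_append] at this; omega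
  · have h2 := h.2 p q hp hq rfl
    rcases lexLt_iff.1 h1 with h1 | ⟨z, hz, h1⟩
    · exact (lexLt_asymm h2 (by simpa using (h1.append [] p).lexLt)).elim
    · -- If `pq = qz`, then rotating `qz` gives both `p < z` and `z < p`.
      rw [h1, lexLt_append_left] at h2
      have hlen : p.length = z.length := by
        have := congrArg List.length h1
        simp at this; omega
      have h3 := (lexDiff_of_lexLt h2 hlen.le).append q q
      rw [h1] at h3
      exact (lexLt_asymm h3.lexLt (h.2 q z hq hz h1)).elim

theorem IsLyndon.lexLt (har : ∀ ω, 1 ≤ ar ω) {p q : List (Letter ar X)}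
    (h : IsLyndon (p ++ q)) (hp : p ≠ []) (hq : q ≠ []) : lexLt q (p ++ q) :=
  (h.lexDiff har hp hq).lexLt

theorem isLyndon_of_lexLt {u : List (Letter ar X)} (hu : u ≠ [])
    (h : ∀ p q, p ≠ [] → q ≠ [] → u = p ++ q → OmegaLie.lexLt q u) : IsLyndon u := by
  refine ⟨hu, fun p q hp hq e => ?_⟩
  have := (lexDiff_of_lexLt (h p q hp hq e) (by simp [e])).append p []
  rw [List.append_nil, e] at this
  exact this.lexLt

theorem isLyndon_singleton (a : Letter ar X) : IsLyndon [a] := by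
  refine isLyndon_of_lexLt (by simp) fun p q hp hq e => ?_
  have h1 := List.length_pos_iff.2 hp
  have h2 := List.length_pos_iff.2 hq
  have := congrArg List.length e
  simp at this; omega

theorem IsLyndon.append (har : ∀ ω, 1 ≤ ar ω) {p q : List (Letter ar X)} (hp : IsLyndon p)
    (hq : IsLyndon q) (h : OmegaLie.lexLt q p) : IsLyndon (p ++ q) := by
  have key : OmegaLie.lexLt q (p ++ q) := by
    rcases lexLt_iff.1 h with h | ⟨z, hz, rfl⟩
    · simpa using (h.append [] q).lexLt
    · exact (lexLt_append_left p).2 (hq.lexLt har hp.1 hz)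
  refine isLyndon_of_lexLt (by simp [hp.1]) fun x y hx hy e => ?_
  rcases List.append_eq_append_iff.1 e with ⟨z, rfl, rfl⟩ | ⟨z, rfl, rfl⟩
  · rcases eq_or_ne z [] with rfl | hz
    · exact key
    · exact lexLt_trans (hq.lexLt har hz hy) key
  · rcases eq_or_ne z [] with rfl | hz
    · simpa using key
    · exact ((hp.lexDiff har hx hz).append q q).lexLt

theorem IsLyndon.overlap (har : ∀ ω, 1 ≤ ar ω) {x y z : List (Letter ar X)}
    (hx : x ≠ []) (hy : y ≠ []) (hxy : IsLyndon (x ++ y)) (hyz : IsLyndon (y ++ z)) :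
    IsLyndon (x ++ y ++ z) := by
  have key : OmegaLie.lexLt (y ++ z) (x ++ y ++ z) :=
    ((hxy.lexDiff har hx hy).append z z).lexLt
  refine isLyndon_of_lexLt (by simp [hx]) fun p q hp hq e => ?_
  rw [List.append_assoc] at e
  rcases List.append_eq_append_iff.1 e with ⟨c, rfl, hc⟩ | ⟨c, rfl, rfl⟩
  · rcases eq_or_ne c [] with rfl | hc0
    · rw [List.nil_append] at hc
      rw [← hc]; exact key
    · rw [hc] at hyz
      rw [hc] at key
      exact lexLt_trans (hyz.lexLt har hc0 hq) key
  · rcases eq_or_ne c [] with rfl | hc0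
    · simpa using key
    · rw [List.append_assoc] at hxy
      simpa using ((hxy.lexDiff har hp (by simp [hc0])).append z z).lexLt

theorem listIsALSW_iff {l : List (Letter ar X)} :
    listIsALSW l ↔ ∀ a ∈ l, Letter.IsALSW a := by
  induction l with
  | nil => simp [listIsALSW]
  | cons a l ih => simp [listIsALSW, ih]

theorem Word.isALSW_iff {u : Word ar X} :
    Word.IsALSW u ↔ IsLyndon (letters u) ∧ ∀ a ∈ letters u, Letter.IsALSW a := by
  cases u
  simp [Word.IsALSW, letters, listIsALSW_iff]

theorem Letter.isALSW_op {ω : Ω} {u : Fin (ar ω) → Word ar X} :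
    Letter.IsALSW (.op ω u) ↔ ∀ i, Word.IsALSW (u i) := by
  simp [Letter.IsALSW]

end Lyndon

/-! ### Bracketings of Lyndon–Shirshov words -/

section Bracketing

variable {Ω X : Type*} {ar : Ω → ℕ}

theorem word_mul_ne_of {s t : NWord ar X} {a : Letter ar X} :
    (NWord.mul s t).word ≠ FreeSemigroup.of a := by
  intro h
  have := congrArg (fun u => (letters u).length) h
  simp only [NWord.word, letters_mul, letters_of, List.length_append, List.length_singleton] at this
  have h1 := length_letters_pos s.word
  have h2 := length_letters_pos t.word
  omega

variable [LinearOrder Ω] [LinearOrder X]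

theorem NWord.IsNLSW.isALSW {t : NWord ar X} (h : t.IsNLSW) : Word.IsALSW t.word := by
  induction t with
  | var x => exact Word.isALSW_iff.2 ⟨isLyndon_singleton _, by simp [NWord.word, Letter.IsALSW]⟩
  | op ω t ih =>
    refine Word.isALSW_iff.2 ⟨isLyndon_singleton _, ?_⟩
    simp only [NWord.word, letters_of, List.mem_singleton, forall_eq, Letter.isALSW_op]
    exact fun i => ih i (h i)
  | mul s t => exact h.1

theorem NWord.IsNLSW.isLyndon {t : NWord ar X} (h : t.IsNLSW) : IsLyndon (letters t.word) :=
  (Word.isALSW_iff.1 h.isALSW).1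

theorem NWord.IsNLSW.lexLt_mul (har : ∀ ω, 1 ≤ ar ω) {s t : NWord ar X}
    (h : (NWord.mul s t).IsNLSW) :
    OmegaLie.lexLt (letters t.word) (letters s.word ++ letters t.word) := by
  have := h.isLyndon
  rw [NWord.word, letters_mul] at this
  exact this.lexLt har (letters_ne_nil _) (letters_ne_nil _)

/-- In a bracketing `((v)(w))` of a Lyndon–Shirshov word, `w` is the largest proper suffix. -/
theorem NWord.IsNLSW.lexLe_right (har : ∀ ω, 1 ≤ ar ω) {v w : NWord ar X}
    (h : (NWord.mul v w).IsNLSW) {p q : List (Letter ar X)} (hp : p ≠ []) (hq : q ≠ [])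
    (e : letters v.word ++ letters w.word = p ++ q) : lexLe q (letters w.word) := by
  obtain ⟨hvw, hv, hw, hle⟩ := h
  rcases List.append_eq_append_iff.1 e with ⟨z, rfl, hz⟩ | ⟨z, hz, rfl⟩
  · rcases eq_or_ne z [] with rfl | hz0
    · rw [List.nil_append] at hz; exact Or.inl hz.symm
    · have hl := hw.isLyndon
      rw [hz] at hl ⊢
      exact Or.inr (hl.lexLt har hz0 hq)
  · rcases eq_or_ne z [] with rfl | hz0
    · exact Or.inl rfl
    have hlt := lexLt_append_self z (letters_ne_nil w.word)
    cases v with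
    | var x =>
      have := congrArg List.length hz
      have h1 := List.length_pos_iff.2 hp
      have h2 := List.length_pos_iff.2 hz0
      simp [NWord.word] at this; omega
    | op ω t =>
      have := congrArg List.length hz
      have h1 := List.length_pos_iff.2 hp
      have h2 := List.length_pos_iff.2 hz0
      simp [NWord.word] at this; omega
    | mul v₁ v₂ =>
      -- The suffix `z` of `v` is at most `v₂ ≤ w`, and `zw < z`.
      exact Or.inr (lexLt_of_lt_of_le hlt
        (lexLe_trans (lexLe_right har hv hp hz0 hz) (hle v₁ v₂ rfl)))
termination_by sizeOf v

/-- A Lyndon–Shirshov word has at most one bracketing. -/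
theorem NWord.IsNLSW.eq_of_word_eq (har : ∀ ω, 1 ≤ ar ω) {s t : NWord ar X} (hs : s.IsNLSW)
    (ht : t.IsNLSW) (h : s.word = t.word) : s = t := by
  have of_inj : ∀ {a b : Letter ar X}, FreeSemigroup.of a = FreeSemigroup.of b → a = b :=
    fun h => by simpa using congrArg FreeSemigroup.head h
  induction s generalizing t with
  | var x =>
    cases t with
    | var y => have := of_inj h; simp_all
    | op θ t => have := of_inj h; simp_all
    | mul t₁ t₂ => exact absurd h.symm word_mul_ne_of
  | op ω s ih =>
    cases t with
    | var y => have := of_inj h; simp_all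
    | op θ t =>
      have := of_inj h
      simp only [Letter.op.injEq] at this
      obtain ⟨rfl, this⟩ := this
      congr 1
      funext i
      exact ih i (hs i) (ht i) (congrFun (eq_of_heq this) i)
    | mul t₁ t₂ => exact absurd h.symm word_mul_ne_of
  | mul s₁ s₂ ih₁ ih₂ =>
    cases t with
    | var y => exact absurd h word_mul_ne_of
    | op θ t => exact absurd h word_mul_ne_of
    | mul t₁ t₂ =>
      have e := congrArg letters h
      simp only [NWord.word, letters_mul] at e
      have e2 := lexLe_antisymm
        (ht.lexLe_right har (letters_ne_nil _) (letters_ne_nil _) e.symm)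
        (hs.lexLe_right har (letters_ne_nil _) (letters_ne_nil _) e)
      rw [e2] at e
      have e1 := List.append_cancel_right e
      rw [ih₁ hs.2.1 ht.2.1 (letters_injective e1), ih₂ hs.2.2.1 ht.2.2.1 (letters_injective e2)]

theorem exists_max_suffix (har : ∀ ω, 1 ≤ ar ω) {l : List (Letter ar X)} (hl : l ≠ []) :
    ∃ p q, l = p ++ q ∧ q ≠ [] ∧ ∀ x y, l = x ++ y → y ≠ [] → lexLe y q := by
  induction l with
  | nil => exact absurd rfl hl
  | cons a l ih =>
    rcases eq_or_ne l [] with rfl | hl'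
    · refine ⟨[], [a], rfl, by simp, fun x y e hy => ?_⟩
      cases x with
      | nil => exact Or.inl e.symm
      | cons b x => simp_all
    · obtain ⟨p, q, rfl, hq, hmax⟩ := ih hl'
      rcases lexLe_or_lexLt har (a :: (p ++ q)) q with h | h
      · refine ⟨a :: p, q, rfl, hq, fun x y e hy => ?_⟩
        cases x with
        | nil => rw [List.nil_append] at e; rwa [← e]
        | cons b x => exact hmax x y (List.cons.inj e).2 hy
      · refine ⟨[], a :: (p ++ q), rfl, by simp, fun x y e hy => ?_⟩
        cases x with
        | nil => exact Or.inl e.symm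
        | cons b x => exact Or.inr (lexLt_of_le_of_lt (hmax x y (List.cons.inj e).2 hy) h)

/-- A Lyndon–Shirshov word has a bracketing, obtained by splitting off the largest proper
suffix. -/
theorem exists_isNLSW (har : ∀ ω, 1 ≤ ar ω) (u : Word ar X) (hu : Word.IsALSW u) :
    ∃ t : NWord ar X, t.IsNLSW ∧ t.word = u := by
  induction hn : Word.deg u using Nat.strong_induction_on generalizing u with
  | _ n ih =>
  subst hn
  obtain ⟨a, l⟩ := u
  obtain ⟨hly, hal⟩ := Word.isALSW_iff.1 hu
  rcases eq_or_ne l [] with rfl | hl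
  · cases a with
    | var x => exact ⟨.var x, trivial, rfl⟩
    | op ω u =>
      have h1 := Letter.isALSW_op.1 (hal (.op ω u) (by simp [letters]))
      choose t ht htu using fun i => ih (Word.deg (u i))
        (by have := Word.deg_lt_deg_op ω u i; simpa [Word.deg, listDeg] using this) (u i) (h1 i) rfl
      exact ⟨.op ω t, ht, by simp only [NWord.word, htu]; rfl⟩
  · obtain ⟨p, q, rfl, hq, hmax'⟩ := exists_max_suffix har hl
    have hmax : ∀ x y, x ≠ [] → y ≠ [] → a :: (p ++ q) = x ++ y → lexLe y q := by
      intro x y hx hy e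
      cases x with
      | nil => exact absurd rfl hx
      | cons b x => exact hmax' x y (List.cons.inj e).2 hy
    simp only [letters] at hly hal
    have hqly : IsLyndon q := by
      refine isLyndon_of_lexLt hq fun x y hx hy e => ?_
      rcases hmax (a :: p ++ x) y (by simp) hy (by simp [e]) with h | h
      · rw [h] at e
        have := congrArg List.length e
        have h2 := List.length_pos_iff.2 hx
        simp only [List.length_append] at this; omega
      · exact h
    have hply : IsLyndon (a :: p) := by
      refine isLyndon_of_lexLt (by simp) fun x y hx hy e => ?_
      have e' : a :: (p ++ q) = x ++ (y ++ q) := by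
        rw [← List.append_assoc, ← e]; rfl
      rw [e'] at hly
      have h1 := hly.lexLt har hx (by simp [hy])
      rw [← e', ← List.cons_append] at h1
      rcases lexLt_trichotomy har y (a :: p) with h | h | h
      · exact h
      · have := congrArg List.length (h ▸ e)
        have h2 := List.length_pos_iff.2 hx
        simp only [List.length_append] at this; omega
      · rcases lexLt_iff.1 h with h | ⟨z, hz, hz'⟩
        · exact (lexLt_asymm h1 (h.append q q).lexLt).elim
        · -- If `ap = yz`, then `yq < apq = yzq` gives `q < zq`, contrary to maximality of `q`.
          rw [hz', List.append_assoc, lexLt_append_left] at h1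
          exact (not_lexLt_of_le (hmax y (z ++ q) hy (by simp [hq])
            (by rw [← List.cons_append, hz', List.append_assoc])) h1).elim
    obtain ⟨v, hv⟩ := exists_letters_eq (α := Letter ar X) (l := q) hq
    have hdeg : Word.deg (⟨a, p ++ q⟩ : Word ar X) =
        Word.deg (⟨a, p⟩ : Word ar X) + Word.deg v := by
      rw [Word.deg_eq v, hv]
      simp only [Word.deg, listDeg_append]; omega
    have hd1 := Word.deg_pos v
    have hd2 := Word.deg_pos (⟨a, p⟩ : Word ar X)
    obtain ⟨s, hs, hsp⟩ := ih _ (by omega) ⟨a, p⟩ (Word.isALSW_iff.2 ⟨hply, fun b hb => hal b (by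
      simp only [letters, List.mem_cons, List.mem_append] at hb ⊢; tauto)⟩) rfl
    obtain ⟨t, ht, htq⟩ := ih _ (by omega) v (Word.isALSW_iff.2 ⟨hv ▸ hqly, fun b hb => hal b (by
      rw [hv] at hb
      simp only [List.mem_cons, List.mem_append]; tauto)⟩) rfl
    have hword : (NWord.mul s t).word = ⟨a, p ++ q⟩ := by
      apply letters_injective
      rw [NWord.word, hsp, htq, letters_mul, hv]; rfl
    refine ⟨.mul s t, ⟨hword ▸ hu, hs, ht, ?_⟩, hword⟩
    rintro v₁ v₂ rfl
    rw [htq, hv]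
    have e : a :: p = letters v₁.word ++ letters v₂.word := by
      have := congrArg letters hsp
      simpa [NWord.word, letters] using this.symm
    rcases lexLe_or_lexLt har (letters v₂.word) q with h | h
    · exact h
    · -- If `q < v₂`, then `q < v₂q`, contrary to maximality of `q`.
      refine (not_lexLt_of_le (hmax (letters v₁.word) (letters v₂.word ++ q) (letters_ne_nil _)
        (by simp [hq]) (by rw [← List.cons_append, e, List.append_assoc])) ?_).elim
      rcases lexLt_iff.1 h with h | ⟨z, hz, rfl⟩
      · simpa using (h.append [] q).lexLt
      · exact (lexLt_append_left _).2 (hqly.lexLt har (letters_ne_nil _) hz)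

/-- The sequence of primes of a list of bracketed words. -/
abbrev flatLetters (cs : List (NWord ar X)) : List (Letter ar X) :=
  cs.flatMap fun c => letters c.word

theorem exists_factorization_cons (har : ∀ ω, 1 ≤ ar ω) (cs : List (NWord ar X))
    (hcs : ∀ c ∈ cs, c.IsNLSW)
    (hs : cs.Pairwise fun c d => lexLe (letters c.word) (letters d.word))
    (t : NWord ar X) (ht : t.IsNLSW) :
    ∃ ds : List (NWord ar X), (∀ c ∈ ds, c.IsNLSW) ∧
      (ds.Pairwise fun c d => lexLe (letters c.word) (letters d.word)) ∧
      flatLetters ds = letters t.word ++ flatLetters cs := by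
  induction cs generalizing t with
  | nil => exact ⟨[t], by simpa using ht, by simp, by simp⟩
  | cons c cs ih =>
    rw [List.pairwise_cons] at hs
    rcases lexLe_or_lexLt har (letters t.word) (letters c.word) with h | h
    · refine ⟨t :: c :: cs, ?_, ?_, by simp⟩
      · intro d hd
        rcases List.mem_cons.1 hd with rfl | hd
        · exact ht
        · exact hcs d hd
      · rw [List.pairwise_cons, List.pairwise_cons]
        refine ⟨fun d hd => ?_, hs⟩
        rcases List.mem_cons.1 hd with rfl | hd
        · exact h
        · exact lexLe_trans h (hs.1 d hd)
    · have hc := hcs c (by simp)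
      have hL : Word.IsALSW (t.word * c.word) := by
        refine Word.isALSW_iff.2 ⟨ht.isLyndon.append har hc.isLyndon h, fun a ha => ?_⟩
        rcases List.mem_append.1 (by simpa using ha) with ha | ha
        · exact (Word.isALSW_iff.1 ht.isALSW).2 a ha
        · exact (Word.isALSW_iff.1 hc.isALSW).2 a ha
      obtain ⟨t', ht', hw⟩ := exists_isNLSW har _ hL
      obtain ⟨ds, h1, h2, h3⟩ := ih (fun d hd => hcs d (by simp [hd])) hs.2 t' ht'
      exact ⟨ds, h1, h2, by simp [h3, hw]⟩

/-- The factorization `c = c₁ ⋯ cₘ` into Lyndon–Shirshov words with `c₁ ≤ ⋯ ≤ cₘ`. -/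
theorem exists_factorization (har : ∀ ω, 1 ≤ ar ω) (l : List (Letter ar X))
    (hl : ∀ a ∈ l, Letter.IsALSW a) :
    ∃ ds : List (NWord ar X), (∀ c ∈ ds, c.IsNLSW) ∧
      (ds.Pairwise fun c d => lexLe (letters c.word) (letters d.word)) ∧
      flatLetters ds = l := by
  induction l with
  | nil => exact ⟨[], by simp, by simp, by simp⟩
  | cons a l ih =>
    obtain ⟨cs, h1, h2, h3⟩ := ih fun b hb => hl b (by simp [hb])
    obtain ⟨t, ht, hw⟩ := exists_isNLSW har (FreeSemigroup.of a)
      (Word.isALSW_iff.2 ⟨isLyndon_singleton a, by simpa using hl a (by simp)⟩)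
    obtain ⟨ds, h4, h5, h6⟩ := exists_factorization_cons har cs h1 h2 t ht
    exact ⟨ds, h4, h5, by rw [h6, hw, h3]; rfl⟩

end Bracketing

/-! ### Subwords of bracketed Lyndon–Shirshov words -/

section Subword

variable {Ω X : Type*} {ar : Ω → ℕ}

theorem append_eq_append_append {α : Type*} {p q a m b : List α} (h : p ++ q = a ++ (m ++ b)) :
    (∃ b', p = a ++ (m ++ b') ∧ b = b' ++ q) ∨ (∃ a', a = p ++ a' ∧ q = a' ++ (m ++ b)) ∨
      ∃ x y, x ≠ [] ∧ y ≠ [] ∧ m = x ++ y ∧ p = a ++ x ∧ q = y ++ b := by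
  rcases List.append_eq_append_iff.1 h with ⟨a', ha, hq⟩ | ⟨c, hp, hc⟩
  · exact Or.inr (Or.inl ⟨a', ha, hq⟩)
  · rcases List.append_eq_append_iff.1 hc with ⟨b', hb, hq⟩ | ⟨y, hm, hq⟩
    · exact Or.inl ⟨b', by rw [hp, hb], hq⟩
    · rcases eq_or_ne c [] with rfl | hc0
      · exact Or.inr (Or.inl ⟨[], by simpa using hp.symm, by simpa using hc.symm⟩)
      · rcases eq_or_ne y [] with rfl | hy0
        · exact Or.inl ⟨[], by simp_all, by simp_all⟩
        · exact Or.inr (Or.inr ⟨c, y, hc0, hy0, hm, hp, hq⟩)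

theorem StarWord.starMul_mulRight (π : StarWord ar X) (c l : List (Letter ar X)) :
    (π.mulRight l).starMul c = (π.starMul c).mulRight l := by
  cases π <;> simp [StarWord.mulRight, StarWord.starMul]

theorem StarWord.starMul_mulLeft (π : StarWord ar X) (c l : List (Letter ar X)) :
    (π.mulLeft l).starMul c = (π.starMul c).mulLeft l := by
  cases π <;> simp [StarWord.mulLeft, StarWord.starMul]

@[simp] theorem StarWord.letters_subst_mulRight (π : StarWord ar X) (l : List (Letter ar X))
    (v : Word ar X) : letters ((π.mulRight l).subst v) = letters (π.subst v) ++ l := by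
  cases π <;> simp [StarWord.mulRight, StarWord.subst]

@[simp] theorem StarWord.letters_subst_mulLeft (π : StarWord ar X) (l : List (Letter ar X))
    (v : Word ar X) : letters ((π.mulLeft l).subst v) = l ++ letters (π.subst v) := by
  cases π <;> simp [StarWord.mulLeft, StarWord.subst]

theorem StarWord.subst_mulRight (π : StarWord ar X) (u v : Word ar X) :
    (π.mulRight (letters u)).subst v = π.subst v * u := letters_injective (by simp)

theorem StarWord.subst_mulLeft (π : StarWord ar X) (u v : Word ar X) :
    (π.mulLeft (letters u)).subst v = u * π.subst v := letters_injective (by simp)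

theorem StarWord.subst_starMul (π : StarWord ar X) (c : List (Letter ar X)) (v : Word ar X) :
    (π.starMul c).subst v = π.subst (appendList v c) := by
  induction π with
  | top a b => exact letters_injective (by simp [StarWord.starMul, StarWord.subst])
  | inner a ω i u π b ih => simp [StarWord.starMul, StarWord.subst, ih]

theorem NStarWord.word_subst (C : NStarWord ar X) (t : NWord ar X) :
    (C.subst t).word = C.word.subst t.word := by
  induction C with
  | star => exact letters_injective (by simp [NStarWord.subst, NStarWord.word, StarWord.subst])
  | op ω i s C ih =>
    apply letters_injective
    simp only [NStarWord.subst, NStarWord.word, StarWord.subst, NWord.word, letters_of,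
      letters_consList, letters_appendList, List.nil_append, List.append_nil, List.cons.injEq,
      Letter.op.injEq, heq_eq_eq, true_and, and_true]
    funext j
    by_cases h : j = i <;> simp [h, ih]
  | mulL C s ih => simp [NStarWord.subst, NStarWord.word, NWord.word, ih, StarWord.subst_mulRight]
  | mulR s C ih => simp [NStarWord.subst, NStarWord.word, NWord.word, ih, StarWord.subst_mulLeft]

variable [LinearOrder Ω] [LinearOrder X]

theorem NStarWord.isNLSW_of_subst (C : NStarWord ar X) {t : NWord ar X}
    (h : (C.subst t).IsNLSW) : t.IsNLSW := by
  induction C with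
  | star => exact h
  | op ω i s C ih => exact ih (by simpa using h i)
  | mulL C s ih => exact ih h.2.1
  | mulR s C ih => exact ih h.2.2.1

/-- In a bracketing of a Lyndon–Shirshov word `p q` with factors `p` and `q`, a Lyndon–Shirshov
subword `x y` with `x` at the end of `p` and `y` at the beginning of `q` starts at the beginning
of `p`: otherwise the largest proper suffix `q` is smaller than the suffix `x q`. -/
theorem NWord.IsNLSW.eq_nil_of_crossing (har : ∀ ω, 1 ≤ ar ω) {s t : NWord ar X}
    (h : (NWord.mul s t).IsNLSW) {a x y b : List (Letter ar X)} (hx : x ≠ []) (hy : y ≠ [])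
    (hxy : IsLyndon (x ++ y)) (hs : letters s.word = a ++ x) (ht : letters t.word = y ++ b) :
    a = [] := by
  by_contra ha
  have h1 := h.lexLe_right har ha (q := x ++ letters t.word) (by simp [hx])
    (by rw [hs, List.append_assoc])
  rw [ht, ← List.append_assoc] at h1
  exact not_lexLt_of_le h1 ((hxy.lexDiff har hx hy).append b b).lexLt

/-- In a bracketing of `a v b` with `v` Lyndon–Shirshov, some subtree is a bracketing of a word
`v c` starting at the given occurrence of `v`. -/
theorem exists_subtree_top (har : ∀ ω, 1 ≤ ar ω) (v : Word ar X) (hv : IsLyndon (letters v))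
    (T : NWord ar X) (hT : T.IsNLSW) (a b : List (Letter ar X))
    (hw : letters T.word = a ++ (letters v ++ b)) :
    ∃ (C : NStarWord ar X) (t : NWord ar X) (c : List (Letter ar X)), C.subst t = T ∧
      t.word = appendList v c ∧ C.word.starMul c = .top a b := by
  have key : ∀ (T : NWord ar X) (b : List (Letter ar X)), letters T.word = letters v ++ b →
      ∃ (C : NStarWord ar X) (t : NWord ar X) (c : List (Letter ar X)), C.subst t = T ∧
      t.word = appendList v c ∧ C.word.starMul c = .top [] b := fun T b hw =>
    ⟨.star, T, b, rfl, letters_injective (by simpa using hw), by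
      simp [NStarWord.word, StarWord.starMul]⟩
  have single : ∀ (l : Letter ar X) (a b : List (Letter ar X)),
      [l] = a ++ (letters v ++ b) → a = [] := by
    intro l a b hl
    have := congrArg List.length hl
    have h1 := length_letters_pos v
    simp only [List.length_append, List.length_singleton] at this
    exact List.length_eq_zero_iff.1 (by omega)
  induction T generalizing a b with
  | var x =>
    obtain rfl := single _ _ _ hw
    exact key _ _ hw
  | op ω t =>
    obtain rfl := single _ _ _ hw
    exact key _ _ hw
  | mul p q ihp ihq =>
    have hw' := hw
    rw [NWord.word, letters_mul] at hw'
    rcases append_eq_append_append hw' with ⟨b', hp, rfl⟩ | ⟨a', rfl, hq⟩ |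
      ⟨x, y, hx, hy, hm, hp, hq⟩
    · obtain ⟨C, t, c, h1, h2, h3⟩ := ihp hT.2.1 a b' hp
      exact ⟨.mulL C q, t, c, by rw [NStarWord.subst, h1], h2, by
        rw [NStarWord.word, StarWord.starMul_mulRight, h3]; rfl⟩
    · obtain ⟨C, t, c, h1, h2, h3⟩ := ihq hT.2.2.1 a' b hq
      exact ⟨.mulR p C, t, c, by rw [NStarWord.subst, h1], h2, by
        rw [NStarWord.word, StarWord.starMul_mulLeft, h3]; rfl⟩
    · obtain rfl := hT.eq_nil_of_crossing har hx hy (hm ▸ hv) hp hq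
      exact key _ _ hw

/-- In a bracketing of `π|_v` with `v` Lyndon–Shirshov, some subtree is a bracketing of a word
`v c` starting at the given occurrence of `v`. -/
theorem exists_subtree (har : ∀ ω, 1 ≤ ar ω) (v : Word ar X) (hv : IsLyndon (letters v))
    (π : StarWord ar X) (T : NWord ar X) (hT : T.IsNLSW) (hw : T.word = π.subst v) :
    ∃ (C : NStarWord ar X) (t : NWord ar X) (c : List (Letter ar X)), C.subst t = T ∧
      t.word = appendList v c ∧ C.word.starMul c = π := by
  induction π generalizing T with
  | top a b =>
    exact exists_subtree_top har v hv T hT a b (by simpa [StarWord.subst] using congrArg letters hw)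
  | inner a ω i u π b ih =>
    have hw' : letters T.word = a ++ ([Letter.op ω fun j => if h : j = i then π.subst v
        else u ⟨j, h⟩] ++ b) := by simpa [StarWord.subst] using congrArg letters hw
    clear hw
    have single : ∀ (l l' : Letter ar X) (a b : List (Letter ar X)),
        [l] = a ++ ([l'] ++ b) → a = [] ∧ b = [] ∧ l = l' := by
      intro l l' a b hl
      have := congrArg List.length hl
      simp only [List.length_append, List.length_singleton] at this
      obtain rfl := List.length_eq_zero_iff.1 (show a.length = 0 by omega)
      obtain rfl := List.length_eq_zero_iff.1 (show b.length = 0 by omega)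
      exact ⟨rfl, rfl, by simpa using hl⟩
    induction T generalizing a b with
    | var x => exact absurd (single (.var x) _ _ _ hw').2.2 (by simp)
    | op θ s =>
      obtain ⟨rfl, rfl, h⟩ := single (.op θ fun i => (s i).word) _ _ _ hw'
      simp only [Letter.op.injEq] at h
      obtain ⟨rfl, h⟩ := h
      have h := congrFun (eq_of_heq h)
      obtain ⟨C, t, c, h1, h2, h3⟩ := ih (s i) (hT i) (by simpa using h i)
      refine ⟨.op θ i (fun j => s j) C, t, c, ?_, h2, ?_⟩
      · simp only [NStarWord.subst, NWord.op.injEq, heq_eq_eq, true_and]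
        funext j
        by_cases hj : j = i
        · subst hj; simp [h1]
        · simp [hj]
      · simp only [NStarWord.word, StarWord.starMul, h3, StarWord.inner.injEq, heq_eq_eq, true_and,
          and_true]
        funext j
        simpa [j.2] using h j
    | mul p q ihp ihq =>
      rw [NWord.word, letters_mul] at hw'
      rcases append_eq_append_append hw' with ⟨b', hp, rfl⟩ | ⟨a', rfl, hq⟩ |
        ⟨x, y, hx, hy, hm, -⟩
      · obtain ⟨C, t, c, h1, h2, h3⟩ := ihp a b' hT.2.1 hp
        exact ⟨.mulL C q, t, c, by rw [NStarWord.subst, h1], h2, by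
          rw [NStarWord.word, StarWord.starMul_mulRight, h3]; rfl⟩
      · obtain ⟨C, t, c, h1, h2, h3⟩ := ihq a' b hT.2.2.1 hq
        exact ⟨.mulR p C, t, c, by rw [NStarWord.subst, h1], h2, by
          rw [NStarWord.word, StarWord.starMul_mulLeft, h3]; rfl⟩
      · have := congrArg List.length hm
        have h1 := List.length_pos_iff.2 hx
        have h2 := List.length_pos_iff.2 hy
        simp only [List.length_append, List.length_singleton] at this
        omega

end Subword

/-! ### Polynomials and substitution into `⋆`-words -/

section Polynomials

variable {k : Type*} [Field k] {Ω X : Type*} {ar : Ω → ℕ}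

/-- A word, as a polynomial. -/
noncomputable abbrev mono (k : Type*) [Field k] {Ω X : Type*} {ar : Ω → ℕ} (u : Word ar X) :
    Poly k ar X := MonoidAlgebra.single u 1

theorem eq_sum_mono (f : Poly k ar X) : f = ∑ u ∈ f.coeff.support, f.coeff u • mono k u := by
  conv_lhs => rw [← MonoidAlgebra.sum_coeff_single f]
  rw [Finsupp.sum]
  exact Finset.sum_congr rfl fun u _ => by simp [mono]

theorem mono_mul_mono (u v : Word ar X) : mono k u * mono k v = mono k (u * v) := by
  simp [mono]

theorem linearMap_ext_mono {M : Type*} [AddCommGroup M] [Module k M]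
    {φ ψ : Poly k ar X →ₗ[k] M} (h : ∀ u, φ (mono k u) = ψ (mono k u)) : φ = ψ := by
  refine LinearMap.ext fun f => ?_
  rw [eq_sum_mono f, map_sum, map_sum]
  exact Finset.sum_congr rfl fun u _ => by rw [map_smul, map_smul, h]

/-- The polynomials all of whose words belong to `T`. -/
noncomputable def supportedIn (k : Type*) [Field k] {Ω X : Type*} {ar : Ω → ℕ}
    (T : Set (Word ar X)) :
    Submodule k (Poly k ar X) := Submodule.span k (mono k '' T)

theorem mem_supportedIn {T : Set (Word ar X)} {f : Poly k ar X} :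
    f ∈ supportedIn k T ↔ ∀ u, f.coeff u ≠ 0 → u ∈ T := by
  constructor
  · intro hf
    induction hf using Submodule.span_induction with
    | mem x hx =>
      obtain ⟨v, hv, rfl⟩ := hx
      intro u hu
      have : v = u := by
        by_contra hne
        exact hu (by simp [mono, hne])
      exact this ▸ hv
    | zero => simp
    | add x y _ _ hx hy =>
      intro u hu
      by_cases h : x.coeff u = 0
      · exact hy u fun h' => hu (by simp [h, h'])
      · exact hx u h
    | smul a x _ hx =>
      intro u hu
      exact hx u fun h => hu (by simp [h])
  · intro h
    rw [eq_sum_mono f]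
    exact Submodule.sum_mem _ fun u hu => Submodule.smul_mem _ _
      (Submodule.subset_span ⟨u, h u (Finsupp.mem_support_iff.1 hu), rfl⟩)

theorem mono_mem_supportedIn {T : Set (Word ar X)} {u : Word ar X} (h : u ∈ T) :
    mono k u ∈ supportedIn k T := Submodule.subset_span ⟨u, h, rfl⟩

theorem supportedIn_mono {T U : Set (Word ar X)} (h : T ⊆ U) :
    supportedIn k T ≤ supportedIn k U := Submodule.span_mono (Set.image_mono h)

theorem mul_mem_supportedIn {T U V : Set (Word ar X)} (h : ∀ t ∈ T, ∀ u ∈ U, t * u ∈ V)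
    {f g : Poly k ar X} (hf : f ∈ supportedIn k T) (hg : g ∈ supportedIn k U) :
    f * g ∈ supportedIn k V := by
  induction hf using Submodule.span_induction with
  | zero => simp
  | add x y _ _ hx hy => rw [add_mul]; exact Submodule.add_mem _ hx hy
  | smul a x _ hx => rw [smul_mul_assoc]; exact Submodule.smul_mem _ _ hx
  | mem x hx =>
    obtain ⟨t, ht, rfl⟩ := hx
    induction hg using Submodule.span_induction with
    | zero => simp
    | add x y _ _ hx hy => rw [mul_add]; exact Submodule.add_mem _ hx hy
    | smul a x _ hx => rw [mul_smul_comm]; exact Submodule.smul_mem _ _ hx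
    | mem y hy =>
      obtain ⟨u, hu, rfl⟩ := hy
      rw [mono_mul_mono]
      exact mono_mem_supportedIn (h t ht u hu)

/-- `π|_f` for a polynomial `f`. -/
noncomputable def substPoly (π : StarWord ar X) : Poly k ar X →ₗ[k] Poly k ar X :=
  MonoidAlgebra.mapDomainLinearMap k k fun v => π.subst v

@[simp] theorem substPoly_mono (π : StarWord ar X) (u : Word ar X) :
    substPoly π (mono k u) = mono k (π.subst u) := by
  simp [substPoly, mono]

theorem substPoly_mulRight (π : StarWord ar X) (u : Word ar X) (f : Poly k ar X) :
    substPoly (π.mulRight (letters u)) f = substPoly π f * mono k u := by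
  have : substPoly (k := k) (π.mulRight (letters u)) =
      LinearMap.mulRight k (mono k u) ∘ₗ substPoly π :=
    linearMap_ext_mono fun v => by simp [StarWord.subst_mulRight]
  rw [this]; rfl

theorem substPoly_mulLeft (π : StarWord ar X) (u : Word ar X) (f : Poly k ar X) :
    substPoly (π.mulLeft (letters u)) f = mono k u * substPoly π f := by
  have : substPoly (k := k) (π.mulLeft (letters u)) =
      LinearMap.mulLeft k (mono k u) ∘ₗ substPoly π :=
    linearMap_ext_mono fun v => by simp [StarWord.subst_mulLeft]
  rw [this]; rfl

theorem substPoly_star (f : Poly k ar X) : substPoly (.top [] []) f = f := by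
  have : substPoly (k := k) (ar := ar) (X := X) (.top [] []) = LinearMap.id :=
    linearMap_ext_mono fun v => by
      rw [substPoly_mono]
      exact congrArg (mono k) (letters_injective (by simp [StarWord.subst]))
  rw [this]; rfl

theorem substPoly_mem_supportedIn (π : StarWord ar X) {T V : Set (Word ar X)}
    (h : ∀ t ∈ T, π.subst t ∈ V) {f : Poly k ar X} (hf : f ∈ supportedIn k T) :
    substPoly π f ∈ supportedIn k V := by
  induction hf using Submodule.span_induction with
  | zero => simp
  | add x y _ _ hx hy => rw [map_add]; exact Submodule.add_mem _ hx hy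
  | smul a x _ hx => rw [map_smul]; exact Submodule.smul_mem _ _ hx
  | mem x hx =>
    obtain ⟨u, hu, rfl⟩ := hx
    rw [substPoly_mono]
    exact mono_mem_supportedIn (h u hu)

/-- Composition of `⋆`-words: replace the `⋆` of the first by the second. -/
def StarWord.comp : StarWord ar X → StarWord ar X → StarWord ar X
  | .top a b, ρ => (ρ.mulRight b).mulLeft a
  | .inner a ω i u π b, ρ => .inner a ω i u (π.comp ρ) b

theorem StarWord.subst_comp (π ρ : StarWord ar X) (v : Word ar X) :
    (π.comp ρ).subst v = π.subst (ρ.subst v) := by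
  induction π with
  | top a b => exact letters_injective (by simp [StarWord.comp, StarWord.subst])
  | inner a ω i u π b ih => simp [StarWord.comp, StarWord.subst, ih]

theorem substPoly_comp (π ρ : StarWord ar X) (f : Poly k ar X) :
    substPoly (π.comp ρ) f = substPoly π (substPoly ρ f) := by
  have : substPoly (k := k) (π.comp ρ) = substPoly π ∘ₗ substPoly ρ :=
    linearMap_ext_mono fun v => by simp [StarWord.subst_comp]
  rw [this]; rfl

theorem substPoly_eq_sum (π : StarWord ar X) (f : Poly k ar X) :
    substPoly π f = ∑ x ∈ f.coeff.support, f.coeff x • mono k (π.subst x) := by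
  conv_lhs => rw [eq_sum_mono f]
  simp only [map_sum, map_smul, substPoly_mono]

theorem StarWord.top_eq (a b : List (Letter ar X)) :
    StarWord.top a b = ((StarWord.top [] []).mulRight b).mulLeft a := by
  simp [StarWord.mulRight, StarWord.mulLeft]

theorem StarWord.inner_eq (a : List (Letter ar X)) (ω : Ω) (i : Fin (ar ω))
    (w : {j : Fin (ar ω) // j ≠ i} → Word ar X) (π : StarWord ar X) (b : List (Letter ar X)) :
    StarWord.inner a ω i w π b = ((StarWord.inner [] ω i w π []).mulRight b).mulLeft a := by
  simp [StarWord.mulRight, StarWord.mulLeft]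

/-- The `⋆`-word `ω(u₁, …, ⋆, …, uₘ)` with `⋆` in place `i`. -/
def opStar (ω : Ω) (i : Fin (ar ω)) (u : {j : Fin (ar ω) // j ≠ i} → Word ar X) :
    StarWord ar X := .inner [] ω i u (.top [] []) []

theorem opStar_comp (ω : Ω) (i : Fin (ar ω)) (u : {j : Fin (ar ω) // j ≠ i} → Word ar X)
    (π : StarWord ar X) : (opStar ω i u).comp π = .inner [] ω i u π [] := by
  cases π <;> simp [opStar, StarWord.comp, StarWord.mulLeft, StarWord.mulRight]

theorem opStar_subst (ω : Ω) (i : Fin (ar ω)) (u : {j : Fin (ar ω) // j ≠ i} → Word ar X)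
    (v : Word ar X) : (opStar ω i u).subst v =
      FreeSemigroup.of (.op ω fun j => if h : j = i then v else u ⟨j, h⟩) := by
  have : consList [] (appendList v []) = v := letters_injective (by simp)
  exact letters_injective (by simp [opStar, StarWord.subst, this])

/-- The operation `ω` as a linear map of its `i`-th argument. -/
noncomputable def opSlot (ω : Ω) (i : Fin (ar ω)) (p : {j : Fin (ar ω) // j ≠ i} → Poly k ar X) :
    Poly k ar X →ₗ[k] Poly k ar X :=
  ∑ u ∈ Fintype.piFinset fun j => (p j).coeff.support,
    (∏ j, (p j).coeff (u j)) • substPoly (opStar ω i u)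

theorem opPoly_eq_opSlot (ω : Ω) (i : Fin (ar ω)) (p : {j : Fin (ar ω) // j ≠ i} → Poly k ar X)
    (h : Poly k ar X) :
    opPoly ω (fun j => if hj : j = i then h else p ⟨j, hj⟩) = opSlot ω i p h := by
  classical
  conv_rhs => rw [eq_sum_mono h]
  simp only [opSlot, LinearMap.coe_sum, Finset.sum_apply, LinearMap.smul_apply, map_sum, map_smul,
    substPoly_mono, opStar_subst, Finset.smul_sum, smul_smul]
  rw [← Finset.sum_product', opPoly]
  refine Finset.sum_bij' (fun x _ => (x i, fun j => x j.1))
    (fun y _ j => if hj : j = i then y.1 else y.2 ⟨j, hj⟩) ?_ ?_ ?_ ?_ ?_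
  · intro x hx
    rw [Fintype.mem_piFinset] at hx
    refine Finset.mem_product.2 ⟨by simpa using hx i, Fintype.mem_piFinset.2 fun j => ?_⟩
    simpa [j.2] using hx j
  · intro y hy
    rw [Finset.mem_product, Fintype.mem_piFinset] at hy
    refine Fintype.mem_piFinset.2 fun j => ?_
    by_cases hj : j = i
    · simpa [hj] using hy.1
    · simpa [hj] using hy.2 ⟨j, hj⟩
  · intro x hx
    funext j
    by_cases hj : j = i <;> simp [hj]
  · intro y hy
    refine Prod.ext (by simp) (funext fun j => by simp [j.2])
  · intro x hx
    have e : (fun j => if hj : j = i then x i else x j) = x := by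
      funext j; by_cases hj : j = i <;> simp [hj]
    have e2 : ∏ j, (if hj : j = i then h else p ⟨j, hj⟩).coeff (x j) =
        h.coeff (x i) * ∏ j : {j // j ≠ i}, (p j).coeff (x j) := by
      rw [Fintype.prod_eq_mul_prod_compl i, dif_pos rfl]
      congr 1
      rw [← Finset.prod_coe_sort]
      refine Fintype.prod_equiv (Equiv.subtypeEquivRight (by simp)) _ _ fun j => ?_
      have hj : j.1 ≠ i := fun h => by have := j.2; simp [h] at this
      rw [dif_neg hj]
      rfl
    simp only [dite_eq_ite] at e ⊢
    simp only [mono, MonoidAlgebra.smul_single, smul_eq_mul, mul_one, e, e2]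

theorem opPoly_update (ω : Ω) (i : Fin (ar ω)) (f : Fin (ar ω) → Poly k ar X)
    (h : Poly k ar X) :
    opPoly ω (Function.update f i h) = opSlot ω i (fun j => f j) h := by
  rw [← opPoly_eq_opSlot]
  congr 1
  funext j
  by_cases hj : j = i
  · subst hj; simp
  · simp [hj]

theorem coeff_opPoly_of (ω : Ω) (f : Fin (ar ω) → Poly k ar X) (u : Fin (ar ω) → Word ar X) :
    (opPoly ω f).coeff (FreeSemigroup.of (.op ω u)) = ∏ i, (f i).coeff (u i) := by
  classical
  have inj : ∀ x : Fin (ar ω) → Word ar X,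
      (FreeSemigroup.of (Letter.op ω x) : Word ar X) = FreeSemigroup.of (.op ω u) → x = u := by
    intro x h
    simpa using congrArg FreeSemigroup.head h
  rw [opPoly, MonoidAlgebra.coeff_sum, Finset.sum_apply']
  by_cases hu : u ∈ Fintype.piFinset fun i => (f i).coeff.support
  · rw [Finset.sum_eq_single u]
    · simp
    · intro x _ hx
      simp only [MonoidAlgebra.coeff_single]
      exact Finsupp.single_eq_of_ne fun h => hx (inj x h.symm)
    · exact fun h => absurd hu h
  · rw [Finset.sum_eq_zero]
    · simp only [Fintype.mem_piFinset, not_forall, Finsupp.mem_support_iff, not_not] at hu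
      obtain ⟨i, hi⟩ := hu
      exact (Finset.prod_eq_zero (Finset.mem_univ i) hi).symm
    · intro x hx
      simp only [MonoidAlgebra.coeff_single]
      exact Finsupp.single_eq_of_ne fun h => hu (inj x h.symm ▸ hx)

theorem exists_of_coeff_opPoly_ne_zero {ω : Ω} {f : Fin (ar ω) → Poly k ar X} {w : Word ar X}
    (h : (opPoly ω f).coeff w ≠ 0) :
    ∃ u, w = FreeSemigroup.of (.op ω u) ∧ ∀ i, (f i).coeff (u i) ≠ 0 := by
  classical
  rw [opPoly, MonoidAlgebra.coeff_sum, Finset.sum_apply'] at h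
  obtain ⟨u, hu, h⟩ := Finset.exists_ne_zero_of_sum_ne_zero h
  refine ⟨u, ?_, fun i => by simpa using Fintype.mem_piFinset.1 hu i⟩
  by_contra hne
  exact h (by simp only [MonoidAlgebra.coeff_single]; exact Finsupp.single_eq_of_ne hne)

end Polynomials

/-! ### Leading words -/

section Leading

variable {k : Type*} [Field k] {Ω X : Type*} [LinearOrder Ω] [LinearOrder X] {ar : Ω → ℕ}

/-- `c` is the leading word of `p`, with coefficient `1`. -/
def MonicLead (p : Poly k ar X) (c : Word ar X) : Prop :=
  p.coeff c = 1 ∧ ∀ u, p.coeff u ≠ 0 → u = c ∨ Word.lt u c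

/-- The words smaller than `w`. -/
abbrev below (w : Word ar X) : Set (Word ar X) := {x | Word.lt x w}

/-- The words smaller than or equal to `w`. -/
abbrev upTo (w : Word ar X) : Set (Word ar X) := {x | x = w ∨ Word.lt x w}

theorem below_subset_upTo (w : Word ar X) : below w ⊆ upTo w := fun _ h => Or.inr h

theorem upTo_subset_below {v w : Word ar X} (h : Word.lt v w) : upTo v ⊆ below w := by
  rintro x (rfl | hx)
  · exact h
  · exact Word.lt_trans hx h

theorem monicLead_iff {p : Poly k ar X} {c : Word ar X} :
    MonicLead p c ↔ p - mono k c ∈ supportedIn k (below c) := by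
  rw [mem_supportedIn]
  constructor
  · rintro ⟨h1, h2⟩ u hu
    by_cases hne : u = c
    · subst hne; simp [mono, h1] at hu
    · refine (h2 u fun h => hu ?_).resolve_left hne
      simp [mono, h, Ne.symm hne]
  · intro h
    constructor
    · by_contra hne
      refine Word.lt_irrefl c (h c ?_)
      simpa [mono, sub_eq_zero] using hne
    · intro u hu
      by_cases hne : u = c
      · exact Or.inl hne
      · refine Or.inr (h u ?_)
        simpa [mono, Finsupp.single_apply, Ne.symm hne] using hu

theorem MonicLead.mem {p : Poly k ar X} {c : Word ar X} (h : MonicLead p c) :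
    p ∈ supportedIn k (upTo c) := mem_supportedIn.2 h.2

theorem MonicLead.isLeading {p : Poly k ar X} {c : Word ar X} (h : MonicLead p c) :
    IsLeading p c :=
  ⟨by rw [h.1]; exact one_ne_zero, fun u hu hne => (h.2 u hu).resolve_left hne⟩

theorem IsLeading.unique {p : Poly k ar X} {c d : Word ar X} (hc : IsLeading p c)
    (hd : IsLeading p d) : c = d := by
  by_contra hne
  exact Word.lt_asymm (hd.2 c hc.1 hne) (hc.2 d hd.1 (Ne.symm hne))

theorem IsMonic.monicLead {p : Poly k ar X} {c : Word ar X} (hp : IsMonic p)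
    (hc : IsLeading p c) : MonicLead p c := by
  obtain ⟨d, hd, h1⟩ := hp
  rw [hd.unique hc] at h1
  refine ⟨h1, fun u hu => ?_⟩
  by_cases h : u = c
  · exact Or.inl h
  · exact Or.inr (hc.2 u hu h)

theorem MonicLead.add {p q : Poly k ar X} {c : Word ar X} (hp : MonicLead p c)
    (hq : q ∈ supportedIn k (below c)) : MonicLead (p + q) c := by
  rw [monicLead_iff] at *
  rw [add_sub_right_comm]
  exact Submodule.add_mem _ hp hq

theorem MonicLead.of_sub_mem {p q : Poly k ar X} {c : Word ar X} (hp : MonicLead p c)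
    (hq : q - p ∈ supportedIn k (below c)) : MonicLead q c := by
  simpa using hp.add hq

theorem monicLead_mono (c : Word ar X) : MonicLead (mono k c) c := by
  rw [monicLead_iff, sub_self]; exact Submodule.zero_mem _

theorem mul_lt_of_le_of_lt {a b c d : Word ar X} (h1 : a ∈ upTo c) (h2 : Word.lt b d) :
    Word.lt (a * b) (c * d) := by
  rcases h1 with rfl | h1
  · exact Word.mul_lt_mul_left _ h2
  · exact Word.lt_trans (Word.mul_lt_mul_right _ h1) (Word.mul_lt_mul_left _ h2)

theorem mul_lt_of_lt_of_le {a b c d : Word ar X} (h1 : Word.lt a c) (h2 : b ∈ upTo d) :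
    Word.lt (a * b) (c * d) := by
  rcases h2 with rfl | h2
  · exact Word.mul_lt_mul_right _ h1
  · exact Word.lt_trans (Word.mul_lt_mul_right _ h1) (Word.mul_lt_mul_left _ h2)

theorem mul_mem_upTo {a b c d : Word ar X} (h1 : a ∈ upTo c) (h2 : b ∈ upTo d) :
    a * b ∈ upTo (c * d) := by
  rcases h1 with rfl | h1
  · rcases h2 with rfl | h2
    · exact Or.inl rfl
    · exact Or.inr (Word.mul_lt_mul_left _ h2)
  · exact Or.inr (mul_lt_of_lt_of_le h1 h2)

theorem MonicLead.mul {p q : Poly k ar X} {c d : Word ar X} (hp : MonicLead p c)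
    (hq : MonicLead q d) : MonicLead (p * q) (c * d) := by
  have h1 := monicLead_iff.1 hp
  have h2 := monicLead_iff.1 hq
  rw [monicLead_iff]
  have e : p * q - mono k (c * d) = (p - mono k c) * q + mono k c * (q - mono k d) := by
    rw [← mono_mul_mono]; noncomm_ring
  rw [e]
  exact Submodule.add_mem _
    (mul_mem_supportedIn (fun _ ht _ hu => mul_lt_of_lt_of_le ht hu) h1 hq.mem)
    (mul_mem_supportedIn (fun _ ht _ hu => mul_lt_of_le_of_lt ht hu) (monicLead_mono c).mem h2)

theorem MonicLead.comm {p q : Poly k ar X} {c d : Word ar X} (hp : MonicLead p c)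
    (hq : MonicLead q d) (h : Word.lt (d * c) (c * d)) : MonicLead (comm p q) (c * d) := by
  rw [OmegaLie.comm, sub_eq_add_neg]
  exact (hp.mul hq).add (Submodule.neg_mem _
    (supportedIn_mono (upTo_subset_below h) (hq.mul hp).mem))

theorem MonicLead.opPoly {ω : Ω} {p : Fin (ar ω) → Poly k ar X} {c : Fin (ar ω) → Word ar X}
    (h : ∀ i, MonicLead (p i) (c i)) :
    MonicLead (opPoly ω p) (FreeSemigroup.of (.op ω c)) := by
  constructor
  · rw [coeff_opPoly_of]
    exact Finset.prod_eq_one fun i _ => (h i).1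
  · intro w hw
    obtain ⟨u, rfl, hu⟩ := exists_of_coeff_opPoly_ne_zero hw
    by_cases huc : u = c
    · exact Or.inl (by rw [huc])
    · exact Or.inr (Word.of_lt_of (Letter.op_lt_op (fun i => (h i).2 _ (hu i)) huc))

theorem MonicLead.subst {p : Poly k ar X} {c : Word ar X} (h : MonicLead p c)
    (π : StarWord ar X) : MonicLead (substPoly π p) (π.subst c) := by
  have h1 := substPoly_mem_supportedIn (V := below (π.subst c)) π
    (fun _ ht => π.subst_lt_subst ht) (monicLead_iff.1 h)
  rw [map_sub, substPoly_mono] at h1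
  exact monicLead_iff.2 h1

theorem NWord.IsNLSW.mul_lt_mul {s t : NWord ar X} (h : (NWord.mul s t).IsNLSW) :
    Word.lt (t.word * s.word) (s.word * t.word) :=
  Word.mul_lt_mul_of_lexLt (h.isLyndon.2 _ _ (letters_ne_nil _) (letters_ne_nil _) rfl)

/-- The leading word of `[u]` is `u`. -/
theorem NWord.IsNLSW.monicLead_eval {t : NWord ar X} (h : t.IsNLSW) :
    MonicLead (t.eval k) t.word := by
  induction t with
  | var x => exact monicLead_mono _
  | op ω t ih => exact MonicLead.opPoly fun i => ih i (h i)
  | mul s t ihs iht => exact (ihs h.2.1).comm (iht h.2.2.1) h.mul_lt_mul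

end Leading

/-! ### Special normal words modulo smaller words -/

section SpanSubst

variable {k : Type*} [Field k] {Ω X : Type*} [LinearOrder Ω] [LinearOrder X] {ar : Ω → ℕ}

/-- The linear span of the polynomials `π|_s` with `s ∈ G` and `π|_{s̄} ∈ T`. -/
noncomputable def spanSubst (G : Set (Poly k ar X)) (T : Set (Word ar X)) :
    Submodule k (Poly k ar X) :=
  Submodule.span k {p | ∃ s ∈ G, ∃ (π : StarWord ar X) (v : Word ar X),
    IsLeading s v ∧ π.subst v ∈ T ∧ p = substPoly π s}

variable {G : Set (Poly k ar X)} {T U V : Set (Word ar X)}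

theorem substPoly_mem_spanSubst {s : Poly k ar X} (hs : s ∈ G) {v : Word ar X}
    (hv : IsLeading s v) (π : StarWord ar X) (h : π.subst v ∈ T) :
    substPoly π s ∈ spanSubst G T := Submodule.subset_span ⟨s, hs, π, v, hv, h, rfl⟩

theorem spanSubst_mono (h : T ⊆ U) : spanSubst G T ≤ spanSubst G U :=
  Submodule.span_mono fun _ ⟨s, hs, π, v, hv, hT, e⟩ => ⟨s, hs, π, v, hv, h hT, e⟩

theorem substPoly_mem_spanSubst_of_mem (P : StarWord ar X) (hP : ∀ t ∈ T, P.subst t ∈ V)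
    {h : Poly k ar X} (hh : h ∈ spanSubst G T) : substPoly P h ∈ spanSubst G V := by
  induction hh using Submodule.span_induction with
  | zero => simp
  | add x y _ _ hx hy => rw [map_add]; exact Submodule.add_mem _ hx hy
  | smul a x _ hx => rw [map_smul]; exact Submodule.smul_mem _ _ hx
  | mem x hx =>
    obtain ⟨s, hs, π, v, hv, hT, rfl⟩ := hx
    rw [← substPoly_comp]
    exact substPoly_mem_spanSubst hs hv _ (by rw [StarWord.subst_comp]; exact hP _ hT)

theorem substPoly_mem_spanSubst_below (P : StarWord ar X) {w : Word ar X} {h : Poly k ar X}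
    (hh : h ∈ spanSubst G (below w)) : substPoly P h ∈ spanSubst G (below (P.subst w)) := by
  refine substPoly_mem_spanSubst_of_mem P (fun t ht => ?_) hh
  exact StarWord.subst_lt_subst P ht

theorem mul_mem_spanSubst (hV : ∀ t ∈ T, ∀ u ∈ U, t * u ∈ V) {h p : Poly k ar X}
    (hh : h ∈ spanSubst G T) (hp : p ∈ supportedIn k U) : h * p ∈ spanSubst G V := by
  induction hp using Submodule.span_induction with
  | zero => simp
  | add x y _ _ hx hy => rw [mul_add]; exact Submodule.add_mem _ hx hy
  | smul a x _ hx => rw [mul_smul_comm]; exact Submodule.smul_mem _ _ hx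
  | mem x hx =>
    obtain ⟨u, hu, rfl⟩ := hx
    have := substPoly_mem_spanSubst_of_mem (V := V)
      ((StarWord.top [] [] : StarWord ar X).mulRight (letters u))
      (fun t ht => by
        rw [StarWord.subst_mulRight, show (StarWord.top [] []).subst t = t from
          letters_injective (by simp [StarWord.subst])]
        exact hV t ht u hu) hh
    rwa [substPoly_mulRight, substPoly_star] at this

theorem mul_mem_spanSubst' (hV : ∀ t ∈ T, ∀ u ∈ U, u * t ∈ V) {h p : Poly k ar X}
    (hh : h ∈ spanSubst G T) (hp : p ∈ supportedIn k U) : p * h ∈ spanSubst G V := by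
  induction hp using Submodule.span_induction with
  | zero => simp
  | add x y _ _ hx hy => rw [add_mul]; exact Submodule.add_mem _ hx hy
  | smul a x _ hx => rw [smul_mul_assoc]; exact Submodule.smul_mem _ _ hx
  | mem x hx =>
    obtain ⟨u, hu, rfl⟩ := hx
    have := substPoly_mem_spanSubst_of_mem (V := V)
      ((StarWord.top [] [] : StarWord ar X).mulLeft (letters u))
      (fun t ht => by
        rw [StarWord.subst_mulLeft, show (StarWord.top [] []).subst t = t from
          letters_injective (by simp [StarWord.subst])]
        exact hV t ht u hu) hh
    rwa [substPoly_mulLeft, substPoly_star] at this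

theorem opSlot_mem_spanSubst (ω : Ω) (i : Fin (ar ω))
    (p : {j : Fin (ar ω) // j ≠ i} → Poly k ar X) {h : Poly k ar X} (hh : h ∈ spanSubst G T) :
    opSlot ω i p h ∈ spanSubst G Set.univ := by
  simp only [opSlot, LinearMap.coe_sum, Finset.sum_apply, LinearMap.smul_apply]
  exact Submodule.sum_mem _ fun u _ => Submodule.smul_mem _ _
    (substPoly_mem_spanSubst_of_mem _ (fun _ _ => Set.mem_univ _) hh)

theorem spanSubst_le_supportedIn (hG : ∀ s ∈ G, IsMonic s)
    (hTU : ∀ t ∈ T, upTo t ⊆ U) : spanSubst G T ≤ supportedIn k U := by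
  refine Submodule.span_le.2 ?_
  rintro _ ⟨s, hs, π, v, hv, hT, rfl⟩
  exact supportedIn_mono (hTU _ hT) (((hG s hs).monicLead hv).subst π).mem

theorem spanSubst_below_le (hG : ∀ s ∈ G, IsMonic s) (w : Word ar X) :
    spanSubst G (below w) ≤ supportedIn k (below w) :=
  spanSubst_le_supportedIn hG fun _ ht => upTo_subset_below ht

variable {s : Poly k ar X} {v : Word ar X} {π : StarWord ar X}

theorem mem_spanSubst_upTo (hs : s ∈ G) (hv : IsLeading s v) {h : Poly k ar X}
    (hh : h - substPoly π s ∈ spanSubst G (below (π.subst v))) :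
    h ∈ spanSubst G (upTo (π.subst v)) := by
  have := Submodule.add_mem _ (spanSubst_mono (below_subset_upTo _) hh)
    (substPoly_mem_spanSubst hs hv π (T := upTo (π.subst v)) (Or.inl rfl))
  rwa [sub_add_cancel] at this

theorem comm_sub_mem_right (hs : s ∈ G) (hv : IsLeading s v) {h p : Poly k ar X}
    (hh : h - substPoly π s ∈ spanSubst G (below (π.subst v))) {c : Word ar X}
    (hp : MonicLead p c) (hlt : Word.lt (c * π.subst v) (π.subst v * c)) :
    comm h p - substPoly (π.mulRight (letters c)) s ∈
      spanSubst G (below ((π.mulRight (letters c)).subst v)) := by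
  rw [substPoly_mulRight, StarWord.subst_mulRight]
  have e : comm h p - substPoly π s * mono k c = (h - substPoly π s) * p +
      substPoly π s * (p - mono k c) - p * h := by
    rw [comm]; noncomm_ring
  rw [e]
  refine Submodule.sub_mem _ (Submodule.add_mem _ ?_ ?_) ?_
  · exact mul_mem_spanSubst (fun t ht u hu => mul_lt_of_lt_of_le ht hu) hh hp.mem
  · exact mul_mem_spanSubst (fun t ht u hu => mul_lt_of_le_of_lt ht hu)
      (substPoly_mem_spanSubst hs hv π (T := upTo (π.subst v)) (Or.inl rfl)) (monicLead_iff.1 hp)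
  · exact mul_mem_spanSubst' (fun t ht u hu => upTo_subset_below hlt (mul_mem_upTo hu ht))
      (mem_spanSubst_upTo hs hv hh) hp.mem

theorem comm_sub_mem_left (hs : s ∈ G) (hv : IsLeading s v) {h p : Poly k ar X}
    (hh : h - substPoly π s ∈ spanSubst G (below (π.subst v))) {c : Word ar X}
    (hp : MonicLead p c) (hlt : Word.lt (π.subst v * c) (c * π.subst v)) :
    comm p h - substPoly (π.mulLeft (letters c)) s ∈
      spanSubst G (below ((π.mulLeft (letters c)).subst v)) := by
  rw [substPoly_mulLeft, StarWord.subst_mulLeft]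
  have e : comm p h - mono k c * substPoly π s = p * (h - substPoly π s) +
      (p - mono k c) * substPoly π s - h * p := by
    rw [comm]; noncomm_ring
  rw [e]
  refine Submodule.sub_mem _ (Submodule.add_mem _ ?_ ?_) ?_
  · exact mul_mem_spanSubst' (fun t ht u hu => mul_lt_of_le_of_lt hu ht) hh hp.mem
  · exact mul_mem_spanSubst' (fun t ht u hu => mul_lt_of_lt_of_le hu ht)
      (substPoly_mem_spanSubst hs hv π (T := upTo (π.subst v)) (Or.inl rfl)) (monicLead_iff.1 hp)
  · exact mul_mem_spanSubst (fun t ht u hu => upTo_subset_below hlt (mul_mem_upTo ht hu))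
      (mem_spanSubst_upTo hs hv hh) hp.mem

theorem opStar_subst_lt {ω : Ω} {i : Fin (ar ω)} {u c : {j : Fin (ar ω) // j ≠ i} → Word ar X}
    {x y : Word ar X} (hu : ∀ j, u j ∈ upTo (c j)) (hx : x ∈ upTo y) (hne : u ≠ c) :
    Word.lt ((opStar ω i u).subst x) ((opStar ω i c).subst y) := by
  rw [opStar_subst, opStar_subst]
  refine Word.of_lt_of (Letter.op_lt_op (fun j => ?_) fun e => hne (funext fun j => ?_))
  · by_cases hj : j = i
    · simpa [hj] using hx
    · simpa [hj] using hu ⟨j, hj⟩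
  · simpa [j.2] using congrFun e j

theorem opSlot_sub_mem (hs : s ∈ G) (hv : IsLeading s v) {h : Poly k ar X}
    (hh : h - substPoly π s ∈ spanSubst G (below (π.subst v))) {ω : Ω} {i : Fin (ar ω)}
    {p : {j : Fin (ar ω) // j ≠ i} → Poly k ar X} {c : {j : Fin (ar ω) // j ≠ i} → Word ar X}
    (hp : ∀ j, MonicLead (p j) (c j)) :
    opSlot ω i p h - substPoly ((opStar ω i c).comp π) s ∈
      spanSubst G (below (((opStar ω i c).comp π).subst v)) := by
  classical
  rw [substPoly_comp, StarWord.subst_comp]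
  simp only [opSlot, LinearMap.coe_sum, Finset.sum_apply, LinearMap.smul_apply]
  have hc : c ∈ Fintype.piFinset fun j => (p j).coeff.support :=
    Fintype.mem_piFinset.2 fun j => by simp [(hp j).1]
  rw [← Finset.add_sum_erase _ _ hc, Finset.prod_eq_one fun j _ => (hp j).1, one_smul,
    add_sub_right_comm, ← map_sub]
  refine Submodule.add_mem _ (substPoly_mem_spanSubst_below (opStar ω i c) hh)
    (Submodule.sum_mem _ fun u hu => Submodule.smul_mem _ _ ?_)
  have hu' := Fintype.mem_piFinset.1 (Finset.mem_of_mem_erase hu)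
  refine substPoly_mem_spanSubst_of_mem (V := below ((opStar ω i c).subst (π.subst v))) _
    (fun t ht => ?_) (mem_spanSubst_upTo hs hv hh)
  exact opStar_subst_lt (fun j => (hp j).2 _ (by simpa using hu' j)) ht
    (Finset.ne_of_mem_erase hu)

/-- In a factorization `c₁ ≤ ⋯ ≤ cₘ` of the end of a Lyndon–Shirshov word, every factor is
smaller than the whole word. -/
theorem lexLt_of_mem_factorization (har : ∀ ω, 1 ≤ ar ω) {x : List (Letter ar X)} (hx : x ≠ [])
    (cs : List (NWord ar X))
    (hs : cs.Pairwise fun c d => lexLe (letters c.word) (letters d.word))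
    (hL : IsLyndon (x ++ flatLetters cs)) {c : NWord ar X} (hc : c ∈ cs) :
    lexLt (letters c.word) (x ++ flatLetters cs) := by
  obtain ⟨ds, e, rfl⟩ : ∃ ds e, cs = ds ++ [e] :=
    ⟨_, _, (List.dropLast_append_getLast (List.ne_nil_of_mem hc)).symm⟩
  have h1 : lexLe (letters c.word) (letters e.word) := by
    rw [List.pairwise_append] at hs
    rcases List.mem_append.1 hc with hc | hc
    · exact hs.2.2 c hc e (by simp)
    · rw [List.mem_singleton.1 hc]; exact Or.inl rfl
  have h2 : x ++ flatLetters (ds ++ [e]) = (x ++ flatLetters ds) ++ letters e.word := by simp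
  rw [h2] at hL ⊢
  exact lexLt_of_le_of_lt h1 (hL.lexLt har (by simp [hx]) (letters_ne_nil _))

theorem foldl_sub_mem (har : ∀ ω, 1 ≤ ar ω) (hs : s ∈ G) (hv : IsLeading s v)
    (cs : List (NWord ar X)) (l : List (Letter ar X)) {g : Poly k ar X}
    (hg : g - substPoly (.top [] l) s ∈ spanSubst G (below ((StarWord.top [] l).subst v)))
    (hl : IsLyndon (letters v ++ l)) (hL : IsLyndon (letters v ++ l ++ flatLetters cs))
    (hcs : ∀ c ∈ cs, c.IsNLSW)
    (hpw : cs.Pairwise fun c d => lexLe (letters c.word) (letters d.word)) :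
    cs.foldl (fun g c => comm g (c.eval k)) g - substPoly (.top [] (l ++ flatLetters cs)) s ∈
      spanSubst G (below ((StarWord.top [] (l ++ flatLetters cs)).subst v)) := by
  induction cs generalizing g l with
  | nil => simpa using hg
  | cons c cs ih =>
    have hc := hcs c (by simp)
    have hlt : lexLt (letters c.word) (letters v ++ l) :=
      lexLt_of_lt_of_le (lexLt_of_mem_factorization har (by simp [letters_ne_nil]) _ hpw hL
        (by simp)) (lexLe_append_self _ _)
    have hlc := hl.append har hc.isLyndon hlt
    have e : l ++ flatLetters (c :: cs) = (l ++ letters c.word) ++ flatLetters cs := by simp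
    rw [e, List.foldl_cons]
    refine ih (l ++ letters c.word) ?_ (by simpa using hlc) (by simpa using hL)
      (fun d hd => hcs d (by simp [hd])) (List.pairwise_cons.1 hpw).2
    refine comm_sub_mem_right hs hv hg hc.monicLead_eval (Word.mul_lt_mul_of_lexLt ?_)
    simpa [StarWord.subst] using
      hlc.2 _ _ (by simp [letters_ne_nil]) (letters_ne_nil _) rfl

theorem NStarWord.eval_sub_mem (hs : s ∈ G) (hv : IsLeading s v) (C : NStarWord ar X)
    {t : NWord ar X} (hC : (C.subst t).IsNLSW) (c : List (Letter ar X))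
    (ht : t.word = appendList v c) {g : Poly k ar X}
    (hg : g - substPoly (.top [] c) s ∈ spanSubst G (below ((StarWord.top [] c).subst v))) :
    C.eval g - substPoly (C.word.starMul c) s ∈
      spanSubst G (below ((C.word.starMul c).subst v)) := by
  have key : ∀ C : NStarWord ar X, (C.word.starMul c).subst v = (C.subst t).word := fun C => by
    rw [StarWord.subst_starMul, ← ht, NStarWord.word_subst]
  induction C with
  | star => simpa [NStarWord.word, StarWord.starMul, NStarWord.eval] using hg
  | op ω i u C ih =>
    have hCi : (C.subst t).IsNLSW := by simpa using hC i
    have := opSlot_sub_mem hs hv (ih hCi) (ω := ω) (i := i) (p := fun j => (u j).eval k)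
      (c := fun j => (u j).word) fun j =>
        NWord.IsNLSW.monicLead_eval (by simpa [j.2] using hC j.1)
    rw [opStar_comp, ← opPoly_eq_opSlot] at this
    exact this
  | mulL C u ih =>
    rw [NStarWord.word, StarWord.starMul_mulRight]
    refine comm_sub_mem_right hs hv (ih hC.2.1) hC.2.2.1.monicLead_eval ?_
    rw [key]
    exact hC.mul_lt_mul
  | mulR u C ih =>
    rw [NStarWord.word, StarWord.starMul_mulLeft]
    refine comm_sub_mem_left hs hv (ih hC.2.2.1) hC.2.1.monicLead_eval ?_
    rw [key]
    exact hC.mul_lt_mul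

/-- A special normal word `[π|_s]_{s̄}` is `π|_s` up to a combination of `π'|_s` with
`π'|_{s̄} < π|_{s̄}`. -/
theorem IsSpecialNormal.sub_mem (har : ∀ ω, 1 ≤ ar ω) (hs : s ∈ G) (hv : IsLeading s v)
    (hL : IsLyndon (letters v)) {h : Poly k ar X} (hh : IsSpecialNormal s π h) :
    h - substPoly π s ∈ spanSubst G (below (π.subst v)) := by
  obtain ⟨v', C, t, cs, hv', -, hC, ht, rfl, hcs, hpw, rfl⟩ := hh
  obtain rfl := hv'.unique hv
  refine NStarWord.eval_sub_mem hs hv C hC _ ht ?_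
  have htL := (C.isNLSW_of_subst hC).isLyndon
  rw [ht, letters_appendList] at htL
  simpa using foldl_sub_mem har hs hv cs [] (g := s)
    (by rw [substPoly_star, sub_self]; exact Submodule.zero_mem _) (by simpa using hL)
    (by simpa using htL) hcs hpw

theorem IsSpecialNormal.monicLead (har : ∀ ω, 1 ≤ ar ω) (hs : MonicLead s v)
    (hL : IsLyndon (letters v)) {h : Poly k ar X} (hh : IsSpecialNormal s π h) :
    MonicLead h (π.subst v) := by
  have hG : ∀ s' ∈ ({s} : Set (Poly k ar X)), IsMonic s' := by
    rintro _ rfl; exact ⟨v, hs.isLeading, hs.1⟩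
  exact (hs.subst π).of_sub_mem (spanSubst_below_le hG _
    (hh.sub_mem har (Set.mem_singleton s) hs.isLeading hL))

/-- Every `π|_{s̄} ∈ ALSW(Ω; X)` has a special normal `s`-word. -/
theorem exists_isSpecialNormal (har : ∀ ω, 1 ≤ ar ω) (hv : IsLeading s v)
    (hL : IsLyndon (letters v)) (hπ : Word.IsALSW (π.subst v)) :
    ∃ h, IsSpecialNormal s π h := by
  obtain ⟨T, hT, hTw⟩ := exists_isNLSW har _ hπ
  obtain ⟨C, t, c, rfl, ht, rfl⟩ := exists_subtree har v hL π T hT hTw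
  have htA := (Word.isALSW_iff.1 (C.isNLSW_of_subst hT).isALSW).2
  obtain ⟨cs, hcs, hpw, rfl⟩ := exists_factorization har c fun a ha => htA a (by
    rw [ht, letters_appendList]; exact List.mem_append_right _ ha)
  exact ⟨_, v, C, t, cs, hv, hπ, hT, ht, rfl, hcs, hpw, rfl⟩

end SpanSubst

/-! ### Leading words of elements of a span -/

section LeadSpan

variable {k : Type*} [Field k] {Ω X : Type*} [LinearOrder Ω] [LinearOrder X] {ar : Ω → ℕ}
  {ι : Type*} {F : ι → Poly k ar X} {ℓ : ι → Word ar X}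

theorem eq_zero_or_mem_span_upTo (har : ∀ ω, 1 ≤ ar ω) (P : Set ι) {f : Poly k ar X}
    (hf : f ∈ Submodule.span k (F '' P)) :
    f = 0 ∨ ∃ m ∈ P, f ∈ Submodule.span k (F '' {i | ℓ i ∈ upTo (ℓ m)}) := by
  have mono : ∀ {m n : ι}, Word.lt (ℓ m) (ℓ n) → Submodule.span k (F '' {i | ℓ i ∈ upTo (ℓ m)}) ≤
      Submodule.span k (F '' {i | ℓ i ∈ upTo (ℓ n)}) := fun h =>
    Submodule.span_mono (Set.image_mono fun _ hi =>
      below_subset_upTo _ (upTo_subset_below h hi))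
  induction hf using Submodule.span_induction with
  | zero => exact Or.inl rfl
  | mem x hx =>
    obtain ⟨m, hm, rfl⟩ := hx
    exact Or.inr ⟨m, hm, Submodule.subset_span ⟨m, Or.inl rfl, rfl⟩⟩
  | smul a x _ hx =>
    rcases hx with rfl | ⟨m, hm, h⟩
    · exact Or.inl (smul_zero _)
    · exact Or.inr ⟨m, hm, Submodule.smul_mem _ _ h⟩
  | add x y _ _ hx hy =>
    rcases hx with rfl | ⟨m, hm, h⟩
    · rwa [zero_add]
    rcases hy with rfl | ⟨n, hn, h'⟩
    · rw [add_zero]; exact Or.inr ⟨m, hm, h⟩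
    rcases Word.lt_trichotomy har (ℓ m) (ℓ n) with hmn | hmn | hmn
    · exact Or.inr ⟨n, hn, Submodule.add_mem _ (mono hmn h) h'⟩
    · rw [hmn] at h; exact Or.inr ⟨n, hn, Submodule.add_mem _ h h'⟩
    · exact Or.inr ⟨m, hm, Submodule.add_mem _ h (mono hmn h')⟩

theorem exists_sub_smul_mem_span_below
    (hkey : ∀ i j, ℓ i = ℓ j → F i - F j ∈ Submodule.span k (F '' {m | ℓ m ∈ below (ℓ i)}))
    (m : ι) {f : Poly k ar X} (hf : f ∈ Submodule.span k (F '' {i | ℓ i ∈ upTo (ℓ m)})) :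
    ∃ c : k, f - c • F m ∈ Submodule.span k (F '' {i | ℓ i ∈ below (ℓ m)}) := by
  induction hf using Submodule.span_induction with
  | zero => exact ⟨0, by simp⟩
  | mem x hx =>
    obtain ⟨i, hi, rfl⟩ := hx
    rcases hi with hi | hi
    · exact ⟨1, by rw [one_smul, ← hi]; exact hkey i m hi⟩
    · exact ⟨0, by rw [zero_smul, sub_zero]; exact Submodule.subset_span ⟨i, hi, rfl⟩⟩
  | smul a x _ hx =>
    obtain ⟨c, hc⟩ := hx
    exact ⟨a * c, by rw [mul_smul, ← smul_sub]; exact Submodule.smul_mem _ _ hc⟩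
  | add x y _ _ hx hy =>
    obtain ⟨c, hc⟩ := hx
    obtain ⟨d, hd⟩ := hy
    exact ⟨c + d, by rw [add_smul, add_sub_add_comm]; exact Submodule.add_mem _ hc hd⟩

/-- Let `F i` be monic polynomials with leading words `ℓ i` such that, whenever `ℓ i = ℓ j`, the
difference `F i - F j` is a combination of the `F m` with `ℓ m < ℓ i`. Then the leading word of a
nonzero combination of the `F i` is one of the `ℓ i`. -/
theorem exists_isLeading_of_mem_span [WellFoundedLT Ω] [WellFoundedLT X]
    (har : ∀ ω, 1 ≤ ar ω) (hF : ∀ i, MonicLead (F i) (ℓ i))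
    (hkey : ∀ i j, ℓ i = ℓ j → F i - F j ∈ Submodule.span k (F '' {m | ℓ m ∈ below (ℓ i)}))
    {f : Poly k ar X} (hf : f ∈ Submodule.span k (Set.range F)) (hne : f ≠ 0) :
    ∃ i, IsLeading f (ℓ i) := by
  rw [← Set.image_univ] at hf
  obtain ⟨m, -, hm⟩ := (eq_zero_or_mem_span_upTo (ℓ := ℓ) har _ hf).resolve_left hne
  clear hf
  have wf := Word.lt_wf (ar := ar) (X := X)
  induction hw : ℓ m using wf.induction generalizing m with
  | _ w ih =>
  subst hw
  obtain ⟨c, hc⟩ := exists_sub_smul_mem_span_below hkey m hm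
  rcases eq_or_ne c 0 with rfl | hc0
  · rw [zero_smul, sub_zero] at hc
    obtain ⟨n, hn, hn'⟩ := (eq_zero_or_mem_span_upTo (ℓ := ℓ) har _ hc).resolve_left hne
    exact ih (ℓ n) hn n hn' rfl
  · refine ⟨m, ?_⟩
    have hle : Submodule.span k (F '' {i | ℓ i ∈ below (ℓ m)}) ≤
        supportedIn k (below (ℓ m)) := by
      refine Submodule.span_le.2 ?_
      rintro _ ⟨i, hi, rfl⟩
      exact supportedIn_mono (upTo_subset_below hi) (hF i).mem
    have h1 := mem_supportedIn.1 (hle hc)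
    constructor
    · have h2 : (f - c • F m).coeff (ℓ m) = 0 := by
        by_contra h; exact Word.lt_irrefl _ (h1 _ h)
      simp only [MonoidAlgebra.coeff_sub, MonoidAlgebra.coeff_smul, Finsupp.sub_apply,
        Finsupp.smul_apply, (hF m).1, smul_eq_mul, mul_one, sub_eq_zero] at h2
      rwa [h2]
    · intro u hu hne'
      by_cases h : (F m).coeff u = 0
      · exact h1 u (by simpa [h] using hu)
      · exact ((hF m).2 u h).resolve_left hne'

end LeadSpan

/-! ### The Lyndon–Shirshov elements span `Lie(Ω; X)` -/

section Spanning

variable {k : Type*} [Field k] {Ω X : Type*} {ar : Ω → ℕ}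

theorem gen_mem_lieOmega (x : X) : gen k ar x ∈ LieOmega k ar X := by
  simp only [LieOmega, Submodule.mem_sInf]
  exact fun M hM => hM.2 x

theorem NWord.eval_mem_lieOmega (t : NWord ar X) : t.eval k ∈ LieOmega k ar X := by
  induction t with
  | var x => exact gen_mem_lieOmega x
  | op ω t ih => exact (lieOmega_isLieOmegaSubalgebra k ar X).2 ω _ ih
  | mul s t ihs iht => exact (lieOmega_isLieOmegaSubalgebra k ar X).1 _ ihs _ iht

theorem comm_self (f : Poly k ar X) : comm f f = 0 := sub_self _

theorem comm_neg_swap (f g : Poly k ar X) : comm f g = -comm g f := by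
  simp [comm]

theorem comm_comm (f g h : Poly k ar X) :
    comm (comm f g) h = comm (comm f h) g + comm f (comm g h) := by
  simp only [comm]; noncomm_ring

/-- The commutator as a bilinear map. -/
noncomputable def commL : Poly k ar X →ₗ[k] Poly k ar X →ₗ[k] Poly k ar X :=
  LinearMap.mul k _ - (LinearMap.mul k _).flip

theorem comm_mem_of_mem_span {A B : Set (Poly k ar X)} {M : Submodule k (Poly k ar X)}
    (h : ∀ a ∈ A, ∀ b ∈ B, comm a b ∈ M) {f g : Poly k ar X} (hf : f ∈ Submodule.span k A)
    (hg : g ∈ Submodule.span k B) : comm f g ∈ M := by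
  have h1 := Submodule.apply_mem_map₂ commL hf hg
  rw [Submodule.map₂_span_span] at h1
  refine Submodule.span_le.2 ?_ h1
  rintro _ ⟨a, ha, b, hb, rfl⟩
  exact h a ha b hb

variable [LinearOrder Ω] [LinearOrder X]

/-- The span of the `[t]` with `t = ((t₁)(t₂))` a rearrangement of `L` and `t₂ ≥ m`. -/
noncomputable def bracketSpan (k : Type*) [Field k] (L m : List (Letter ar X)) :
    Submodule k (Poly k ar X) :=
  Submodule.span k {p | ∃ t₁ t₂ : NWord ar X, (NWord.mul t₁ t₂).IsNLSW ∧
    (letters t₁.word ++ letters t₂.word).Perm L ∧ lexLe m (letters t₂.word) ∧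
    p = (NWord.mul t₁ t₂).eval k}

theorem bracketSpan_mono (L : List (Letter ar X)) {m m' : List (Letter ar X)}
    (h : lexLe m m') : bracketSpan k L m' ≤ bracketSpan k L m :=
  Submodule.span_mono fun _ ⟨t₁, t₂, h1, h2, h3, e⟩ => ⟨t₁, t₂, h1, h2, lexLe_trans h h3, e⟩

theorem finite_subperm {α : Type*} (L : List α) : {l : List α | l.Subperm L}.Finite := by
  refine (List.finite_toSet (L.sublists.flatMap List.permutations)).subset ?_
  rintro l ⟨l', hp, hs⟩
  exact List.mem_flatMap.2 ⟨l', List.mem_sublists.2 hs, List.mem_permutations.2 hp.symm⟩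

theorem isNLSW_mul (har : ∀ ω, 1 ≤ ar ω) {s t : NWord ar X} (hs : s.IsNLSW) (ht : t.IsNLSW)
    (hlt : lexLt (letters t.word) (letters s.word))
    (h : ∀ s₁ s₂, s = .mul s₁ s₂ → lexLe (letters s₂.word) (letters t.word)) :
    (NWord.mul s t).IsNLSW := by
  refine ⟨Word.isALSW_iff.2 ⟨hs.isLyndon.append har ht.isLyndon hlt, fun a ha => ?_⟩, hs, ht, h⟩
  rcases List.mem_append.1 (by simpa [NWord.word] using ha) with ha | ha
  · exact (Word.isALSW_iff.1 hs.isALSW).2 a ha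
  · exact (Word.isALSW_iff.1 ht.isALSW).2 a ha

/-- The bracket of two Lyndon–Shirshov elements `[s]`, `[t]` with `s > t` is a combination of
Lyndon–Shirshov elements whose words are rearrangements of `s t` and whose right factors are at
least `t`. If `s = s₁s₂` with `s₂ > t`, apply the Jacobi identity
`[[s₁,s₂],t] = [[s₁,t],s₂] + [s₁,[s₂,t]]`; the inner brackets have smaller length, and after
expanding them the outer brackets are of words larger than `t`, of which there are only
finitely many. -/
theorem comm_eval_mem_bracketSpan (har : ∀ ω, 1 ≤ ar ω) (s t : NWord ar X) (hs : s.IsNLSW)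
    (ht : t.IsNLSW) (hlt : lexLt (letters t.word) (letters s.word)) (L : List (Letter ar X))
    (hL : (letters s.word ++ letters t.word).Perm L) :
    comm (s.eval k) (t.eval k) ∈ bracketSpan k L (letters t.word) := by
  induction hn : L.length using Nat.strong_induction_on generalizing s t L with
  | _ n ihn =>
  subst hn
  induction hN : {l : List (Letter ar X) | l.Subperm L ∧ lexLt (letters t.word) l}.ncard
    using Nat.strong_induction_on generalizing s t with
  | _ N ihN =>
  subst hN
  have base : (∀ s₁ s₂, s = .mul s₁ s₂ → lexLe (letters s₂.word) (letters t.word)) →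
      comm (s.eval k) (t.eval k) ∈ bracketSpan k L (letters t.word) := fun h =>
    Submodule.subset_span ⟨s, t, isNLSW_mul har hs ht hlt h, hL, Or.inl rfl, rfl⟩
  have fin : {l : List (Letter ar X) | l.Subperm L ∧ lexLt (letters t.word) l}.Finite :=
    (finite_subperm L).subset fun _ h => h.1
  -- Brackets of words larger than `t` are covered by the induction on their number.
  have step : ∀ a b : NWord ar X, a.IsNLSW → b.IsNLSW →
      lexLt (letters t.word) (letters a.word) → lexLt (letters t.word) (letters b.word) →
      (letters a.word ++ letters b.word).Perm L →
      comm (a.eval k) (b.eval k) ∈ bracketSpan k L (letters t.word) := by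
    have half : ∀ a b : NWord ar X, a.IsNLSW → b.IsNLSW →
        lexLt (letters b.word) (letters a.word) → lexLt (letters t.word) (letters b.word) →
        (letters a.word ++ letters b.word).Perm L →
        comm (a.eval k) (b.eval k) ∈ bracketSpan k L (letters t.word) := by
      intro a b ha hb hab htb hp
      refine bracketSpan_mono L (Or.inr htb) (ihN _ ?_ a b ha hb hab hp rfl)
      refine Set.ncard_lt_ncard ⟨fun l hl => ⟨hl.1, lexLt_trans htb hl.2⟩, fun hsub => ?_⟩ fin
      have hbL : (letters b.word).Subperm L :=
        (List.sublist_append_right _ _).subperm.trans hp.subperm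
      exact lexLt_irrefl _ (hsub ⟨hbL, htb⟩).2
    intro a b ha hb hta htb hp
    rcases lexLt_trichotomy har (letters a.word) (letters b.word) with h | h | h
    · rw [comm_neg_swap]
      exact Submodule.neg_mem _ (half b a hb ha h hta (List.perm_append_comm.trans hp))
    · rw [ha.eq_of_word_eq har hb (letters_injective h), comm_self]
      exact Submodule.zero_mem _
    · exact half a b ha hb h htb hp
  cases s with
  | var x => exact base (by simp)
  | op ω u => exact base (by simp)
  | mul s₁ s₂ =>
    rcases lexLe_or_lexLt har (letters s₂.word) (letters t.word) with h | h
    · refine base ?_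
      rintro _ _ ⟨⟩
      exact h
    have hs1 := hs.2.1
    have hs2 := hs.2.2.1
    rw [NWord.word, letters_mul] at hlt hL
    have hlen := hL.length_eq
    simp only [List.length_append] at hlen
    have hpos1 := length_letters_pos s₁.word
    have hpos2 := length_letters_pos s₂.word
    have hts1 : lexLt (letters t.word) (letters s₁.word) :=
      lexLt_of_lt_of_le hlt (lexLe_append_self _ _)
    have h1 := ihn _ (by simp; omega) s₁ t hs1 ht hts1 _ (List.Perm.refl _) rfl
    have h2 := ihn _ (by simp; omega) s₂ t hs2 ht h _ (List.Perm.refl _) rfl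
    have hgt : ∀ t₁ t₂ : NWord ar X, (NWord.mul t₁ t₂).IsNLSW →
        lexLe (letters t.word) (letters t₂.word) →
        lexLt (letters t.word) (letters (NWord.mul t₁ t₂).word) := fun t₁ t₂ h3 h4 =>
      lexLt_of_le_of_lt h4 (h3.lexLt_mul har)
    rw [NWord.eval, comm_comm]
    refine Submodule.add_mem _ ?_ ?_
    · refine comm_mem_of_mem_span ?_ h1 (Submodule.mem_span_singleton_self (s₂.eval k))
      rintro _ ⟨t₁, t₂, h3, h4, h5, rfl⟩ _ rfl
      refine step _ _ h3 hs2 (hgt _ _ h3 h5) h (List.Perm.trans ?_ hL)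
      rw [NWord.word, letters_mul]
      refine (h4.append_right _).trans ?_
      rw [List.append_assoc, List.append_assoc]
      exact List.perm_append_comm.append_left _
    · refine comm_mem_of_mem_span ?_ (Submodule.mem_span_singleton_self (s₁.eval k)) h2
      rintro _ rfl _ ⟨t₁, t₂, h3, h4, h5, rfl⟩
      refine step _ _ hs1 h3 hts1 (hgt _ _ h3 h5) (List.Perm.trans ?_ hL)
      rw [NWord.word, letters_mul, List.append_assoc]
      exact h4.append_left _

/-- The span of the Lyndon–Shirshov elements `[u]`. -/
noncomputable def lyndonSpan (k : Type*) [Field k] {Ω : Type*} [LinearOrder Ω] (ar : Ω → ℕ)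
    (X : Type*) [LinearOrder X] : Submodule k (Poly k ar X) :=
  Submodule.span k (Set.range fun t : {t : NWord ar X // t.IsNLSW} => t.1.eval k)

theorem opPoly_mem_lyndonSpan (ω : Ω) (f : Fin (ar ω) → Poly k ar X)
    (hf : ∀ i, f i ∈ lyndonSpan k ar X) : opPoly ω f ∈ lyndonSpan k ar X := by
  classical
  -- Expand the arguments in a finite set `s` one at a time.
  have key : ∀ (s : Finset (Fin (ar ω))) (f : Fin (ar ω) → Poly k ar X),
      (∀ i ∈ s, f i ∈ lyndonSpan k ar X) →
      (∀ i ∉ s, ∃ t : NWord ar X, t.IsNLSW ∧ f i = t.eval k) →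
      opPoly ω f ∈ lyndonSpan k ar X := by
    intro s
    induction s using Finset.induction_on with
    | empty =>
      intro f _ h
      choose t ht hft using fun i => h i (Finset.notMem_empty i)
      obtain rfl : f = fun i => (t i).eval k := funext hft
      exact Submodule.subset_span ⟨⟨.op ω t, ht⟩, rfl⟩
    | insert i s hi ih =>
      intro f h1 h2
      have e : opPoly ω f = opSlot ω i (fun j => f j) (f i) := by
        rw [← opPoly_update, Function.update_eq_self]
      rw [e]
      have hfi : f i ∈ lyndonSpan k ar X := h1 i (Finset.mem_insert_self i s)
      have hmap := Submodule.mem_map_of_mem (f := opSlot ω i fun j => f j) hfi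
      rw [lyndonSpan, Submodule.map_span] at hmap
      refine Submodule.span_le.2 ?_ hmap
      rintro _ ⟨_, ⟨t, rfl⟩, rfl⟩
      rw [← opPoly_update]
      refine ih _ (fun j hj => ?_) fun j hj => ?_
      · have hji : j ≠ i := fun h => hi (h ▸ hj)
        rw [Function.update_of_ne hji]
        exact h1 j (Finset.mem_insert_of_mem hj)
      · by_cases hji : j = i
        · subst hji; exact ⟨t, t.2, by simp⟩
        · rw [Function.update_of_ne hji]
          exact h2 j (by simp [hji, hj])
  exact key Finset.univ f (fun i _ => hf i) fun i hi => absurd (Finset.mem_univ i) hi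

theorem comm_mem_lyndonSpan (har : ∀ ω, 1 ≤ ar ω) {f g : Poly k ar X}
    (hf : f ∈ lyndonSpan k ar X) (hg : g ∈ lyndonSpan k ar X) :
    comm f g ∈ lyndonSpan k ar X := by
  have hle : ∀ L m, bracketSpan k L m ≤ lyndonSpan k ar X := fun L m =>
    Submodule.span_mono fun _ ⟨t₁, t₂, h, _, _, e⟩ => ⟨⟨_, h⟩, e.symm⟩
  refine comm_mem_of_mem_span ?_ hf hg
  rintro _ ⟨s, rfl⟩ _ ⟨t, rfl⟩
  rcases lexLt_trichotomy har (letters s.1.word) (letters t.1.word) with h | h | h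
  · rw [comm_neg_swap]
    exact Submodule.neg_mem _ (hle _ _
      (comm_eval_mem_bracketSpan har t.1 s.1 t.2 s.2 h _ (List.Perm.refl _)))
  · obtain rfl : s = t := Subtype.ext (s.2.eq_of_word_eq har t.2 (letters_injective h))
    rw [comm_self]
    exact Submodule.zero_mem _
  · exact hle _ _ (comm_eval_mem_bracketSpan har s.1 t.1 s.2 t.2 h _ (List.Perm.refl _))

theorem lieOmega_le_lyndonSpan (har : ∀ ω, 1 ≤ ar ω) : LieOmega k ar X ≤ lyndonSpan k ar X :=
  sInf_le ⟨⟨fun _ hf _ hg => comm_mem_lyndonSpan har hf hg, opPoly_mem_lyndonSpan⟩,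
    fun x => Submodule.subset_span ⟨⟨.var x, trivial⟩, rfl⟩⟩

/-- The leading word of a nonzero element of `Lie(Ω; X)` is Lyndon–Shirshov. -/
theorem exists_isLeading_of_mem_lieOmega [WellFoundedLT Ω] [WellFoundedLT X]
    (har : ∀ ω, 1 ≤ ar ω) {f : Poly k ar X} (hf : f ∈ LieOmega k ar X) (hne : f ≠ 0) :
    ∃ t : NWord ar X, t.IsNLSW ∧ IsLeading f t.word := by
  obtain ⟨t, ht⟩ := exists_isLeading_of_mem_span
    (F := fun t : {t : NWord ar X // t.IsNLSW} => t.1.eval k) (ℓ := fun t => t.1.word) har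
    (fun t => t.2.monicLead_eval) (fun s t h => by
      rw [s.2.eq_of_word_eq har t.2 h, sub_self]; exact Submodule.zero_mem _)
    (lieOmega_le_lyndonSpan har hf) hne
  exact ⟨t.1, t.2, ht⟩

theorem isALSW_of_isLeading [WellFoundedLT Ω] [WellFoundedLT X] (har : ∀ ω, 1 ≤ ar ω)
    {f : Poly k ar X} (hf : f ∈ LieOmega k ar X) {v : Word ar X} (hv : IsLeading f v) :
    Word.IsALSW v := by
  obtain ⟨t, ht, htf⟩ := exists_isLeading_of_mem_lieOmega har hf
    (by rintro rfl; exact hv.1 (by simp))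
  rw [hv.unique htf]
  exact ht.isALSW

end Spanning

/-! ### Compositions in the free associative `Ω`-algebra -/

section Associative

variable {k : Type*} [Field k] {Ω X : Type*} [LinearOrder Ω] [LinearOrder X] {ar : Ω → ℕ}

/-- The monic set `G` is a Gröbner–Shirshov basis of the associative `Ω`-algebra `k⟨Ω; X⟩`: the
associative inclusion compositions `f - ρ|_g` and intersection compositions `f z - x g` are
combinations of smaller words in elements of `G`. -/
structure IsAssocGSBasis (G : Set (Poly k ar X)) : Prop where
  monic : ∀ s ∈ G, IsMonic s
  inclusion : ∀ f ∈ G, ∀ g ∈ G, ∀ v (ρ : StarWord ar X), IsLeading f (ρ.subst v) →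
    IsLeading g v → f - substPoly ρ g ∈ spanSubst G (below (ρ.subst v))
  intersection : ∀ f ∈ G, ∀ g ∈ G, ∀ u v (x y z : List (Letter ar X)), IsLeading f u →
    IsLeading g v → x ≠ [] → y ≠ [] → z ≠ [] → letters u = x ++ y → letters v = y ++ z →
    substPoly (.top [] z) f - substPoly (.top x []) g ∈
      spanSubst G (below ((StarWord.top [] z).subst u))

variable {G : Set (Poly k ar X)} {f g : Poly k ar X} {u v : Word ar X}

/-- Disjoint occurrences: if `A y` and `B x` are the two `⋆`-words obtained from a word `F x y`
with two holes, then `F(f, v) - F(u, g) ≡ 0`, since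
`F(f, g) ≡ F(f, v)` and `F(f, g) ≡ F(u, g)`. -/
theorem sub_mem_of_disjoint (hG : ∀ s ∈ G, IsMonic s) (hf : f ∈ G) (hg : g ∈ G)
    (hu : IsLeading f u) (hv : IsLeading g v) (A B : Word ar X → StarWord ar X)
    (hAB : ∀ x y, (A y).subst x = (B x).subst y) :
    substPoly (A v) f - substPoly (B u) g ∈ spanSubst G (below ((A v).subst u)) := by
  classical
  have hfu := (hG f hf).monicLead hu
  have hgv := (hG g hg).monicLead hv
  have e : ∑ y ∈ g.coeff.support, g.coeff y • substPoly (A y) f =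
      ∑ x ∈ f.coeff.support, f.coeff x • substPoly (B x) g := by
    simp only [substPoly_eq_sum, Finset.smul_sum, smul_smul]
    rw [Finset.sum_comm]
    refine Finset.sum_congr rfl fun x _ => Finset.sum_congr rfl fun y _ => ?_
    rw [hAB, mul_comm]
  rw [← Finset.add_sum_erase _ _ (show v ∈ g.coeff.support by simp [hgv.1]),
    ← Finset.add_sum_erase _ _ (show u ∈ f.coeff.support by simp [hfu.1]), hgv.1, hfu.1,
    one_smul, one_smul] at e
  have e' : substPoly (A v) f - substPoly (B u) g =
      ∑ x ∈ f.coeff.support.erase u, f.coeff x • substPoly (B x) g -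
        ∑ y ∈ g.coeff.support.erase v, g.coeff y • substPoly (A y) f := by
    rw [sub_eq_sub_iff_add_eq_add, e, add_comm]
  rw [e']
  refine Submodule.sub_mem _ (Submodule.sum_mem _ fun x hx => Submodule.smul_mem _ _ ?_)
    (Submodule.sum_mem _ fun y hy => Submodule.smul_mem _ _ ?_)
  · rw [Finset.mem_erase, Finsupp.mem_support_iff] at hx
    refine substPoly_mem_spanSubst hg hv _ ?_
    rw [← hAB]
    exact StarWord.subst_lt_subst (A v) (hu.2 x hx.2 hx.1)
  · rw [Finset.mem_erase, Finsupp.mem_support_iff] at hy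
    refine substPoly_mem_spanSubst hf hu _ ?_
    rw [hAB, hAB]
    exact StarWord.subst_lt_subst (B u) (hv.2 y hy.2 hy.1)

/-- Occurrences in disjoint segments of a word. -/
theorem sub_mem_of_disjoint_segments (hG : ∀ s ∈ G, IsMonic s) (hf : f ∈ G) (hg : g ∈ G)
    (hu : IsLeading f u) (hv : IsLeading g v) (c d : StarWord ar X)
    (a m b : List (Letter ar X)) :
    substPoly ((c.mulRight (m ++ (letters (d.subst v) ++ b))).mulLeft a) f -
      substPoly ((d.mulRight b).mulLeft (a ++ letters (c.subst u) ++ m)) g ∈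
      spanSubst G (below (((c.mulRight (m ++ (letters (d.subst v) ++ b))).mulLeft a).subst u)) :=
  sub_mem_of_disjoint hG hf hg hu hv
    (fun y => (c.mulRight (m ++ (letters (d.subst y) ++ b))).mulLeft a)
    (fun x => (d.mulRight b).mulLeft (a ++ letters (c.subst x) ++ m))
    fun x y => letters_injective (by simp)

/-- Occurrences at the same place of two differently indexed arguments of one operation. -/
theorem sub_mem_of_args_ne (hG : ∀ s ∈ G, IsMonic s) (hf : f ∈ G) (hg : g ∈ G)
    (hu : IsLeading f u) (hv : IsLeading g v) (a b : List (Letter ar X)) (ω : Ω)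
    {i i' : Fin (ar ω)} (hi : i ≠ i') (w : {j : Fin (ar ω) // j ≠ i} → Word ar X)
    (w' : {j : Fin (ar ω) // j ≠ i'} → Word ar X) (π π' : StarWord ar X)
    (h : (fun j => if h : j = i then π.subst u else w ⟨j, h⟩) =
      fun j => if h : j = i' then π'.subst v else w' ⟨j, h⟩) :
    substPoly (.inner a ω i w π b) f - substPoly (.inner a ω i' w' π' b) g ∈
      spanSubst G (below ((StarWord.inner a ω i w π b).subst u)) := by
  set W : Fin (ar ω) → Word ar X := fun j => if h : j = i then π.subst u else w ⟨j, h⟩ with hW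
  have e1 : w = fun j : {j : Fin (ar ω) // j ≠ i} => Function.update W i' (π'.subst v) j := by
    have : W i' = π'.subst v := by rw [h]; simp
    rw [← this, Function.update_eq_self]
    funext j
    simp [hW, j.2]
  have e2 : w' = fun j : {j : Fin (ar ω) // j ≠ i'} => Function.update W i (π.subst u) j := by
    have : W i = π.subst u := by simp [hW]
    rw [← this, Function.update_eq_self, h]
    funext j
    simp [j.2]
  have := sub_mem_of_disjoint hG hf hg hu hv
    (fun y => .inner a ω i (fun j => Function.update W i' (π'.subst y) j) π b)
    (fun x => .inner a ω i' (fun j => Function.update W i (π.subst x) j) π' b)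
    (fun x y => by
      simp only [StarWord.subst]
      congr 4
      funext j
      by_cases h1 : j = i
      · subst h1; simp [hi]
      · by_cases h2 : j = i'
        · subst h2; simp [h1]
        · simp [h1, h2])
  rwa [← e1, ← e2] at this

/-- One occurrence contains the other. -/
theorem IsAssocGSBasis.sub_mem_of_comp (hG : IsAssocGSBasis G) (hf : f ∈ G) (hg : g ∈ G)
    (P ρ : StarWord ar X) (hu : IsLeading f (ρ.subst v)) (hv : IsLeading g v) :
    substPoly P f - substPoly (P.comp ρ) g ∈ spanSubst G (below (P.subst (ρ.subst v))) := by
  rw [substPoly_comp, ← map_sub]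
  exact substPoly_mem_spanSubst_below P (hG.inclusion f hf g hg v ρ hu hv)

/-- Two overlapping occurrences. -/
theorem IsAssocGSBasis.sub_mem_of_overlap (hG : IsAssocGSBasis G) (hf : f ∈ G) (hg : g ∈ G)
    (hu : IsLeading f u) (hv : IsLeading g v) {x y z : List (Letter ar X)} (hx : x ≠ [])
    (hy : y ≠ []) (hz : z ≠ []) (hxy : letters u = x ++ y) (hyz : letters v = y ++ z)
    (a b : List (Letter ar X)) :
    substPoly (.top a (z ++ b)) f - substPoly (.top (a ++ x) b) g ∈
      spanSubst G (below ((StarWord.top a (z ++ b)).subst u)) := by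
  have e1 : StarWord.top a (z ++ b) = (StarWord.top a b).comp (.top [] z) := by
    simp [StarWord.comp, StarWord.mulLeft, StarWord.mulRight]
  have e2 : StarWord.top (a ++ x) b = (StarWord.top a b).comp (.top x []) := by
    simp [StarWord.comp, StarWord.mulLeft, StarWord.mulRight]
  rw [e1, e2, substPoly_comp, substPoly_comp, StarWord.subst_comp, ← map_sub]
  exact substPoly_mem_spanSubst_below _
    (hG.intersection f hf g hg u v x y z hu hv hx hy hz hxy hyz)

/-- The relative positions of two segments of a list: disjoint, nested or overlapping. -/
theorem segment_cases {α : Type*} {a b a' b' l l' : List α}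
    (h : a ++ (l ++ b) = a' ++ (l' ++ b')) :
    (∃ m, a' = a ++ l ++ m ∧ b = m ++ (l' ++ b')) ∨
    (∃ m, a = a' ++ l' ++ m ∧ b' = m ++ (l ++ b)) ∨
    (∃ x y, l = x ++ (l' ++ y) ∧ a' = a ++ x ∧ b' = y ++ b) ∨
    (∃ x y, l' = x ++ (l ++ y) ∧ a = a' ++ x ∧ b = y ++ b') ∨
    (∃ x y z, x ≠ [] ∧ y ≠ [] ∧ z ≠ [] ∧ l = x ++ y ∧ l' = y ++ z ∧ a' = a ++ x ∧ b = z ++ b') ∨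
    (∃ x y z, x ≠ [] ∧ y ≠ [] ∧ z ≠ [] ∧ l' = x ++ y ∧ l = y ++ z ∧ a = a' ++ x ∧
      b' = z ++ b) := by
  rw [← List.append_assoc] at h
  rcases append_eq_append_append h with ⟨c, h1, rfl⟩ | ⟨m, rfl, rfl⟩ | ⟨x, y, hx, hy, rfl, h1, rfl⟩
  · rcases List.append_eq_append_iff.1 h1 with ⟨z, rfl, rfl⟩ | ⟨z, rfl, h2⟩
    · exact Or.inr (Or.inr (Or.inl ⟨z, c, rfl, rfl, rfl⟩))
    · rcases List.append_eq_append_iff.1 h2 with ⟨e, rfl, rfl⟩ | ⟨e, rfl, rfl⟩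
      · exact Or.inr (Or.inl ⟨e, by simp, by simp⟩)
      · rcases eq_or_ne z [] with rfl | hz
        · exact Or.inr (Or.inr (Or.inl ⟨[], c, by simp⟩))
        rcases eq_or_ne e [] with rfl | he
        · exact Or.inr (Or.inl ⟨[], by simp⟩)
        rcases eq_or_ne c [] with rfl | hc
        · exact Or.inr (Or.inr (Or.inr (Or.inl ⟨z, [], by simp⟩)))
        exact Or.inr (Or.inr (Or.inr (Or.inr (Or.inr
          ⟨z, e, c, hz, he, hc, rfl, rfl, rfl, rfl⟩))))
  · exact Or.inl ⟨m, rfl, rfl⟩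
  · rcases List.append_eq_append_iff.1 h1 with ⟨z, rfl, rfl⟩ | ⟨z, rfl, rfl⟩
    · rcases eq_or_ne z [] with rfl | hz
      · exact Or.inr (Or.inr (Or.inr (Or.inl ⟨[], y, by simp⟩)))
      exact Or.inr (Or.inr (Or.inr (Or.inr (Or.inl
        ⟨z, x, y, hz, hx, hy, rfl, rfl, rfl, rfl⟩))))
    · exact Or.inr (Or.inr (Or.inr (Or.inl ⟨z, y, by simp⟩)))

/-- A nonempty segment of a one-letter list is the whole list. -/
theorem segment_singleton {α : Type*} {c : α} {x l y : List α} (hl : l ≠ [])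
    (h : [c] = x ++ (l ++ y)) : x = [] ∧ y = [] ∧ l = [c] := by
  have h1 := congrArg List.length h
  have h2 := List.length_pos_iff.2 hl
  simp only [List.length_append, List.length_singleton] at h1
  obtain rfl := List.length_eq_zero_iff.1 (show x.length = 0 by omega)
  obtain rfl := List.length_eq_zero_iff.1 (show y.length = 0 by omega)
  exact ⟨rfl, rfl, by simpa using h.symm⟩

theorem sub_mem_symm {π π' : StarWord ar X} (hw : π.subst u = π'.subst v)
    (h : substPoly π' g - substPoly π f ∈ spanSubst G (below (π'.subst v))) :
    substPoly π f - substPoly π' g ∈ spanSubst G (below (π.subst u)) := by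
  rw [hw, ← neg_sub]
  exact Submodule.neg_mem _ h

theorem IsAssocGSBasis.sub_mem_top_top (hG : IsAssocGSBasis G) (hf : f ∈ G) (hg : g ∈ G)
    (hu : IsLeading f u) (hv : IsLeading g v) (a b a' b' : List (Letter ar X))
    (hw : (StarWord.top a b).subst u = (StarWord.top a' b').subst v) :
    substPoly (.top a b) f - substPoly (.top a' b') g ∈
      spanSubst G (below ((StarWord.top a b).subst u)) := by
  have nested : ∀ {f g : Poly k ar X} {u v : Word ar X}, f ∈ G → g ∈ G → IsLeading f u →
      IsLeading g v → ∀ a b x y : List (Letter ar X), letters u = x ++ (letters v ++ y) →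
      substPoly (.top a b) f - substPoly (.top (a ++ x) (y ++ b)) g ∈
        spanSubst G (below ((StarWord.top a b).subst u)) := by
    intro f g u v hf hg hu hv a b x y e
    obtain rfl : u = (StarWord.top x y).subst v :=
      letters_injective (by simp [StarWord.subst, e])
    exact hG.sub_mem_of_comp hf hg (.top a b) (.top x y) hu hv
  have disjoint : ∀ {f g : Poly k ar X} {u v : Word ar X}, f ∈ G → g ∈ G → IsLeading f u →
      IsLeading g v → ∀ a m b : List (Letter ar X),
      substPoly (.top a (m ++ (letters v ++ b))) f - substPoly (.top (a ++ letters u ++ m) b) g ∈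
        spanSubst G (below ((StarWord.top a (m ++ (letters v ++ b))).subst u)) := by
    intro f g u v hf hg hu hv a m b
    have := sub_mem_of_disjoint_segments hG.monic hf hg hu hv (.top [] []) (.top [] []) a m b
    simpa [StarWord.subst, ← StarWord.top_eq] using this
  have e : a ++ (letters u ++ b) = a' ++ (letters v ++ b') := by
    simpa [StarWord.subst] using congrArg letters hw
  rcases segment_cases e with ⟨m, rfl, rfl⟩ | ⟨m, rfl, rfl⟩ | ⟨x, y, hl, rfl, rfl⟩ |
    ⟨x, y, hl, rfl, rfl⟩ | ⟨x, y, z, hx, hy, hz, h1, h2, rfl, rfl⟩ |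
    ⟨x, y, z, hx, hy, hz, h1, h2, rfl, rfl⟩
  · exact disjoint hf hg hu hv a m b'
  · exact sub_mem_symm hw (disjoint hg hf hv hu a' m b)
  · exact nested hf hg hu hv a b x y hl
  · exact sub_mem_symm hw (nested hg hf hv hu a' b' x y hl)
  · exact hG.sub_mem_of_overlap hf hg hu hv hx hy hz h1 h2 a b'
  · exact sub_mem_symm hw (hG.sub_mem_of_overlap hg hf hv hu hx hy hz h1 h2 a' b)

theorem IsAssocGSBasis.sub_mem_top_inner (hG : IsAssocGSBasis G) (hf : f ∈ G) (hg : g ∈ G)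
    (hu : IsLeading f u) (hv : IsLeading g v) (a b a' b' : List (Letter ar X)) (ω : Ω)
    (i : Fin (ar ω)) (w : {j : Fin (ar ω) // j ≠ i} → Word ar X) (π : StarWord ar X)
    (hw : (StarWord.top a b).subst u = (StarWord.inner a' ω i w π b').subst v) :
    substPoly (.top a b) f - substPoly (.inner a' ω i w π b') g ∈
      spanSubst G (below ((StarWord.top a b).subst u)) := by
  set c : StarWord ar X := .inner [] ω i w π [] with hc
  have hstar : ∀ x : Word ar X, (StarWord.top [] []).subst x = x := fun x =>
    letters_injective (by simp [StarWord.subst])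
  have hcl : ∃ l, letters (c.subst v) = [l] := ⟨_, by simp [hc, StarWord.subst]; rfl⟩
  obtain ⟨l, hl⟩ := hcl
  rw [StarWord.inner_eq] at hw ⊢
  rw [← hc] at hw ⊢
  have e : a ++ (letters u ++ b) = a' ++ (letters (c.subst v) ++ b') := by
    simpa [StarWord.subst] using congrArg letters hw
  have nested : ∀ x y : List (Letter ar X), letters u = x ++ (letters (c.subst v) ++ y) →
      a' = a ++ x → b' = y ++ b → substPoly (.top a b) f -
        substPoly ((c.mulRight b').mulLeft a') g ∈
          spanSubst G (below ((StarWord.top a b).subst u)) := by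
    rintro x y hxy rfl rfl
    obtain rfl : u = ((c.mulRight y).mulLeft x).subst v := letters_injective (by simp [hxy])
    have := hG.sub_mem_of_comp hf hg (.top a b) _ hu hv
    simpa [StarWord.comp, hc, StarWord.mulLeft, StarWord.mulRight] using this
  rcases segment_cases e with ⟨m, rfl, rfl⟩ | ⟨m, rfl, rfl⟩ | ⟨x, y, hxy, h1, h2⟩ |
    ⟨x, y, hxy, rfl, rfl⟩ | ⟨x, y, z, hx, hy, hz, h1, h2, -⟩ |
    ⟨x, y, z, hx, hy, hz, h1, h2, -⟩
  · have := sub_mem_of_disjoint_segments hG.monic hf hg hu hv (.top [] []) c a m b'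
    rwa [← StarWord.top_eq, hstar] at this
  · refine sub_mem_symm hw ?_
    have := sub_mem_of_disjoint_segments hG.monic hg hf hv hu c (.top [] []) a' m b
    rwa [← StarWord.top_eq, hstar] at this
  · exact nested x y hxy h1 h2
  · rw [hl] at hxy
    obtain ⟨rfl, rfl, h3⟩ := segment_singleton (letters_ne_nil u) hxy
    exact nested [] [] (by simp [h3, hl]) (by simp) (by simp)
  · rw [hl] at h2
    obtain ⟨-, h3, -⟩ := segment_singleton (x := []) hy h2
    exact absurd h3 hz
  · rw [hl] at h1
    obtain ⟨h3, -⟩ := segment_singleton (y := []) hy (by simpa using h1)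
    exact absurd h3 hx

/-- For an associative Gröbner–Shirshov basis, `π|_f ≡ π'|_g` modulo smaller words whenever
`π|_f̄ = π'|_ḡ`. -/
theorem IsAssocGSBasis.sub_mem (hG : IsAssocGSBasis G) (hf : f ∈ G) (hg : g ∈ G)
    (hu : IsLeading f u) (hv : IsLeading g v) (π π' : StarWord ar X)
    (hw : π.subst u = π'.subst v) :
    substPoly π f - substPoly π' g ∈ spanSubst G (below (π.subst u)) := by
  induction π generalizing π' with
  | top a b =>
    cases π' with
    | top a' b' => exact hG.sub_mem_top_top hf hg hu hv a b a' b' hw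
    | inner a' ω i w π' b' => exact hG.sub_mem_top_inner hf hg hu hv a b a' b' ω i w π' hw
  | inner a ω i w π b ih =>
    cases π' with
    | top a' b' =>
      exact sub_mem_symm hw (hG.sub_mem_top_inner hg hf hv hu a' b' a b ω i w π hw.symm)
    | inner a' ω' i' w' π' b' =>
      have e : a ++ ([Letter.op ω fun j => if h : j = i then π.subst u else w ⟨j, h⟩] ++ b) =
          a' ++ ([Letter.op ω' fun j => if h : j = i' then π'.subst v else w' ⟨j, h⟩] ++ b') := by
        simpa [StarWord.subst] using congrArg letters hw
      have same : a = a' → b = b' →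
          (Letter.op ω fun j => if h : j = i then π.subst u else w ⟨j, h⟩) =
            (Letter.op ω' fun j => if h : j = i' then π'.subst v else w' ⟨j, h⟩) →
          substPoly (.inner a ω i w π b) f - substPoly (.inner a' ω' i' w' π' b') g ∈
            spanSubst G (below ((StarWord.inner a ω i w π b).subst u)) := by
        rintro rfl rfl h
        simp only [Letter.op.injEq] at h
        obtain ⟨rfl, h⟩ := h
        have h := eq_of_heq h
        by_cases hi : i = i'
        · subst hi
          have h1 : π.subst u = π'.subst v := by simpa using congrFun h i
          obtain rfl : w = w' := funext fun j => by simpa [j.2] using congrFun h j.1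
          have hin : ∀ ρ : StarWord ar X, StarWord.inner a ω i w ρ b =
              (StarWord.inner a ω i w (.top [] []) b).comp ρ := fun ρ => by
            cases ρ <;> simp [StarWord.comp, StarWord.mulLeft, StarWord.mulRight]
          rw [hin π, hin π', substPoly_comp, substPoly_comp, StarWord.subst_comp, ← map_sub]
          exact substPoly_mem_spanSubst_below _ (ih π' h1)
        · exact sub_mem_of_args_ne hG.monic hf hg hu hv a b ω hi w w' π π' h
      rcases segment_cases e with ⟨m, rfl, rfl⟩ | ⟨m, rfl, rfl⟩ | ⟨x, y, hl, rfl, rfl⟩ |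
        ⟨x, y, hl, rfl, rfl⟩ | ⟨x, y, z, hx, hy, hz, h1, h2, -⟩ |
        ⟨x, y, z, hx, hy, hz, h1, h2, -⟩
      · have := sub_mem_of_disjoint_segments hG.monic hf hg hu hv (.inner [] ω i w π [])
          (.inner [] ω' i' w' π' []) a m b'
        rw [← StarWord.inner_eq, ← StarWord.inner_eq] at this
        exact this
      · refine sub_mem_symm hw ?_
        have := sub_mem_of_disjoint_segments hG.monic hg hf hv hu (.inner [] ω' i' w' π' [])
          (.inner [] ω i w π []) a' m b
        rw [← StarWord.inner_eq, ← StarWord.inner_eq] at this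
        exact this
      · obtain ⟨rfl, rfl, h3⟩ := segment_singleton (by simp) hl
        exact same (by simp) (by simp) (by simpa using h3.symm)
      · obtain ⟨rfl, rfl, h3⟩ := segment_singleton (by simp) hl
        exact same (by simp) (by simp) (by simpa using h3)
      · obtain ⟨-, h3, -⟩ := segment_singleton (x := []) hy h2
        exact absurd h3 hz
      · obtain ⟨-, h3, -⟩ := segment_singleton (x := []) hy h2
        exact absurd h3 hz

/-- The associative composition-diamond lemma: the leading word of a nonzero element of the ideal
of `k⟨Ω; X⟩` generated by `G` is of the form `π|_{s̄}`. -/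
theorem IsAssocGSBasis.exists_isLeading [WellFoundedLT Ω] [WellFoundedLT X]
    (har : ∀ ω, 1 ≤ ar ω) (hG : IsAssocGSBasis G) {h : Poly k ar X}
    (hh : h ∈ spanSubst G Set.univ) (hne : h ≠ 0) :
    ∃ s ∈ G, ∃ v, IsLeading s v ∧ ∃ π : StarWord ar X, IsLeading h (π.subst v) := by
  let ι := {m : Poly k ar X × StarWord ar X × Word ar X // m.1 ∈ G ∧ IsLeading m.1 m.2.2}
  let F : ι → Poly k ar X := fun m => substPoly m.1.2.1 m.1.1
  let ℓ : ι → Word ar X := fun m => m.1.2.1.subst m.1.2.2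
  have hle : ∀ T, spanSubst G T ≤ Submodule.span k (F '' {m | ℓ m ∈ T}) := fun T => by
    refine Submodule.span_mono ?_
    rintro _ ⟨s, hs, π, v, hv, hT, rfl⟩
    exact ⟨⟨(s, π, v), hs, hv⟩, hT, rfl⟩
  obtain ⟨m, hm⟩ := exists_isLeading_of_mem_span (F := F) (ℓ := ℓ) har
    (fun m => ((hG.monic _ m.2.1).monicLead m.2.2).subst _)
    (fun m n h => hle _ (hG.sub_mem m.2.1 n.2.1 m.2.2 n.2.2 _ _ h))
    (by have := hle _ hh; simpa using this) hne
  exact ⟨m.1.1, m.2.1, m.1.2.2, m.2.2, m.1.2.1, hm⟩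

end Associative

/-! ### The Composition-Diamond lemma for Lie `Ω`-algebras -/

section Diamond

variable {k : Type*} [Field k] {Ω X : Type*} {ar : Ω → ℕ}

theorem lieIdeal_isLieOmegaIdeal (S : Set (LieOmega k ar X)) : IsLieOmegaIdeal (lieIdeal S) := by
  constructor
  · intro f g hg
    simp only [lieIdeal, Submodule.mem_sInf] at hg ⊢
    exact fun I hI => hI.1.1 f g (hg I hI)
  · intro ω f i hf
    simp only [lieIdeal, Submodule.mem_sInf] at hf ⊢
    exact fun I hI => hI.1.2 ω f i (hf I hI)

theorem subset_lieIdeal (S : Set (LieOmega k ar X)) : S ⊆ lieIdeal S := fun s hs => by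
  simp only [lieIdeal, SetLike.mem_coe, Submodule.mem_sInf]
  exact fun I hI => hI.2 hs

/-- `Id_Lie(S)` as a subspace of `k⟨Ω; X⟩`. -/
noncomputable def lieIdealPoly (S : Set (LieOmega k ar X)) : Submodule k (Poly k ar X) :=
  (lieIdeal S).map (LieOmega k ar X).subtype

variable {S : Set (LieOmega k ar X)}

theorem mem_lieIdealPoly {h : LieOmega k ar X} :
    (h : Poly k ar X) ∈ lieIdealPoly S ↔ h ∈ lieIdeal S := by
  simp [lieIdealPoly]

theorem comm_mem_lieIdealPoly {f g : Poly k ar X} (hf : f ∈ LieOmega k ar X)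
    (hg : g ∈ lieIdealPoly S) : comm f g ∈ lieIdealPoly S := by
  obtain ⟨g, hg, rfl⟩ := hg
  exact mem_lieIdealPoly.2 ((lieIdeal_isLieOmegaIdeal S).1 ⟨f, hf⟩ g hg)

theorem comm_mem_lieIdealPoly' {f g : Poly k ar X} (hf : f ∈ LieOmega k ar X)
    (hg : g ∈ lieIdealPoly S) : comm g f ∈ lieIdealPoly S := by
  rw [comm_neg_swap]
  exact Submodule.neg_mem _ (comm_mem_lieIdealPoly hf hg)

theorem NStarWord.eval_mem_lieIdealPoly (C : NStarWord ar X) {g : Poly k ar X}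
    (hg : g ∈ lieIdealPoly S) : C.eval g ∈ lieIdealPoly S := by
  induction C with
  | star => exact hg
  | op ω i s C ih =>
    obtain ⟨c, hc, hce⟩ := ih
    have := mem_lieIdealPoly.2 ((lieIdeal_isLieOmegaIdeal S).2 ω
      (fun j => if h : j = i then c else ⟨(s ⟨j, h⟩).eval k, NWord.eval_mem_lieOmega _⟩) i
      (by simpa using hc))
    convert this using 2
    rw [NStarWord.eval]
    simp only [lieOp]
    congr 1
    funext j
    by_cases h : j = i
    · simp [h, ← hce]
    · simp [h]
  | mulL C s ih => exact comm_mem_lieIdealPoly' (NWord.eval_mem_lieOmega s) ih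
  | mulR s C ih => exact comm_mem_lieIdealPoly (NWord.eval_mem_lieOmega s) ih

variable [LinearOrder Ω] [LinearOrder X]

theorem IsSpecialNormal.mem_lieIdealPoly {s : Poly k ar X} (hs : s ∈ lieIdealPoly S)
    {π : StarWord ar X} {h : Poly k ar X} (hh : IsSpecialNormal s π h) :
    h ∈ lieIdealPoly S := by
  obtain ⟨v, C, t, cs, -, -, -, -, -, -, -, rfl⟩ := hh
  refine C.eval_mem_lieIdealPoly ?_
  clear * - hs
  induction cs generalizing s with
  | nil => exact hs
  | cons c cs ih => exact ih (comm_mem_lieIdealPoly' (NWord.eval_mem_lieOmega c) hs)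

/-- The span of the special normal words `[π|_s]_{s̄}` with `s ∈ S` and `π|_{s̄} ∈ T`. -/
noncomputable def normalSpan (S : Set (LieOmega k ar X)) (T : Set (Word ar X)) :
    Submodule k (Poly k ar X) :=
  Submodule.span k {p : Poly k ar X | ∃ s ∈ S, ∃ (π : StarWord ar X) (v : Word ar X),
    IsSpecialNormal (s : Poly k ar X) π p ∧ IsLeading (s : Poly k ar X) v ∧ π.subst v ∈ T}

theorem normalSpan_mono {T U : Set (Word ar X)} (h : T ⊆ U) : normalSpan S T ≤ normalSpan S U :=
  Submodule.span_mono fun _ ⟨s, hs, π, v, h1, h2, h3⟩ => ⟨s, hs, π, v, h1, h2, h h3⟩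

theorem normalSpan_le_lieIdealPoly (T : Set (Word ar X)) : normalSpan S T ≤ lieIdealPoly S :=
  Submodule.span_le.2 fun _ ⟨_, hs, _, _, h, _⟩ =>
    h.mem_lieIdealPoly (mem_lieIdealPoly.2 (subset_lieIdeal S hs))

theorem span_range_mk_eq (S : Set (LieOmega k ar X)) :
    Submodule.span k (Set.range fun h : Irr S =>
      (Submodule.Quotient.mk h.1 : LieOmega k ar X ⧸ lieIdeal S)) =
      (Submodule.span k (Irr S)).map (lieIdeal S).mkQ := by
  rw [Submodule.map_span]
  congr 1
  ext x
  simp [Set.mem_image]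

theorem coe_mem_spanSubst_of_mem_lieIdeal (hS : ∀ s ∈ S, IsMonic (s : Poly k ar X))
    {f : LieOmega k ar X} (hf : f ∈ lieIdeal S) :
    (f : Poly k ar X) ∈ spanSubst (Subtype.val '' S) Set.univ := by
  have hle : lieIdeal S ≤
      (spanSubst (Subtype.val '' S) Set.univ).comap (LieOmega k ar X).subtype := by
    refine sInf_le ⟨⟨fun f g hg => ?_, fun ω f i hf => ?_⟩, fun s hs => ?_⟩
    · have huniv : (f : Poly k ar X) ∈ supportedIn k Set.univ :=
        mem_supportedIn.2 fun _ _ => Set.mem_univ _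
      exact Submodule.sub_mem _ (mul_mem_spanSubst' (fun _ _ _ _ => Set.mem_univ _) hg huniv)
        (mul_mem_spanSubst (fun _ _ _ _ => Set.mem_univ _) hg huniv)
    · have := opSlot_mem_spanSubst ω i (fun j => (f j : Poly k ar X)) hf
      rw [Submodule.subtype_apply, ← opPoly_update ω i fun j => (f j : Poly k ar X),
        Function.update_eq_self (f := fun j => (f j : Poly k ar X))] at this
      exact this
    · obtain ⟨v, hv, -⟩ := hS s hs
      have := substPoly_mem_spanSubst (T := Set.univ) (Set.mem_image_of_mem Subtype.val hs) hv
        (.top [] []) (Set.mem_univ _)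
      rwa [substPoly_star] at this
  exact hle hf

variable [WellFoundedLT Ω] [WellFoundedLT X]

theorem isLyndon_of_isLeading (har : ∀ ω, 1 ≤ ar ω) (s : LieOmega k ar X) {v : Word ar X}
    (hv : IsLeading (s : Poly k ar X) v) : IsLyndon (letters v) :=
  (Word.isALSW_iff.1 (isALSW_of_isLeading har s.2 hv)).1

theorem normalSpan_le_spanSubst (har : ∀ ω, 1 ≤ ar ω) (w : Word ar X) :
    normalSpan S (below w) ≤ spanSubst (Subtype.val '' S) (below w) := by
  refine Submodule.span_le.2 ?_
  rintro p ⟨s, hs, π, v, hp, hv, hw⟩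
  have hs' := Set.mem_image_of_mem Subtype.val hs
  exact spanSubst_mono (upTo_subset_below hw) (mem_spanSubst_upTo hs' hv
    (hp.sub_mem har hs' hv (isLyndon_of_isLeading har s hv)))

/-- A Gröbner–Shirshov basis in `Lie(Ω; X)` is one in `k⟨Ω; X⟩`: the associative compositions
and the Lie compositions agree modulo smaller words. -/
theorem IsGSBasis.isAssocGSBasis (har : ∀ ω, 1 ≤ ar ω)
    (hS : ∀ s ∈ S, IsMonic (s : Poly k ar X)) (h : IsGSBasis S) :
    IsAssocGSBasis (Subtype.val '' S) where
  monic := by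
    rintro _ ⟨s, hs, rfl⟩
    exact hS s hs
  inclusion := by
    rintro _ ⟨f, hf, rfl⟩ _ ⟨g, hg, rfl⟩ v ρ hu hv
    have hgL := isLyndon_of_isLeading har g hv
    obtain ⟨q, hq⟩ := exists_isSpecialNormal har hv hgL (isALSW_of_isLeading har f.2 hu)
    have h1 := normalSpan_le_spanSubst har _ (h f hf g hg _ _
      ⟨_, v, hu, hv, Or.inr ⟨ρ, q, rfl, rfl, hq, rfl⟩⟩)
    have h2 := hq.sub_mem har (Set.mem_image_of_mem Subtype.val hg) hv hgL
    simpa using Submodule.add_mem _ h1 h2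
  intersection := by
    rintro _ ⟨f, hf, rfl⟩ _ ⟨g, hg, rfl⟩ u v x y z hu hv hx hy hz hxy hyz
    have hfL := isLyndon_of_isLeading har f hu
    have hgL := isLyndon_of_isLeading har g hv
    obtain ⟨a, rfl⟩ := exists_letters_eq hz
    obtain ⟨b, rfl⟩ := exists_letters_eq hx
    have e1 : (StarWord.top [] (letters a)).subst u = u * a :=
      letters_injective (by simp [StarWord.subst])
    have e2 : (StarWord.top (letters b) []).subst v = b * v :=
      letters_injective (by simp [StarWord.subst])
    have e3 : u * a = b * v := letters_injective (by simp [hxy, hyz])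
    have hw : Word.IsALSW (u * a) := by
      refine Word.isALSW_iff.2 ⟨?_, fun c hc => ?_⟩
      · rw [letters_mul, hxy]
        exact IsLyndon.overlap har hx hy (hxy ▸ hfL) (hyz ▸ hgL)
      · rcases List.mem_append.1 (by simpa using hc) with hc | hc
        · exact (Word.isALSW_iff.1 (isALSW_of_isLeading har f.2 hu)).2 c hc
        · exact (Word.isALSW_iff.1 (isALSW_of_isLeading har g.2 hv)).2 c
            (by rw [hyz]; exact List.mem_append_right _ hc)
    obtain ⟨p, hp⟩ := exists_isSpecialNormal har hu hfL (e1 ▸ hw)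
    obtain ⟨q, hq⟩ := exists_isSpecialNormal har hv hgL (e2 ▸ e3 ▸ hw)
    have hlen : bre (u * a) < bre u + bre v := by
      have := List.length_pos_iff.2 hy
      rw [bre_eq, bre_eq, bre_eq, letters_mul, hyz]
      simp only [List.length_append]
      omega
    have h1 := normalSpan_le_spanSubst har _ (h f hf g hg _ _
      ⟨u, v, hu, hv, Or.inl ⟨a, b, p, q, rfl, e3, hlen, hp, hq, rfl⟩⟩)
    have h2 := hp.sub_mem har (Set.mem_image_of_mem Subtype.val hf) hu hfL
    have h3 := hq.sub_mem har (Set.mem_image_of_mem Subtype.val hg) hv hgL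
    rw [e1] at h2 ⊢
    rw [e2, ← e3] at h3
    have := Submodule.add_mem _ (Submodule.sub_mem _ h1 h2) h3
    convert this using 1
    abel

/-- The Lie ideal generated by `S` lies in the associative ideal, to which the associative
Composition-Diamond lemma applies. -/
theorem IsGSBasis.exists_isLeading (har : ∀ ω, 1 ≤ ar ω)
    (hS : ∀ s ∈ S, IsMonic (s : Poly k ar X)) (h : IsGSBasis S) {f : LieOmega k ar X}
    (hf : f ∈ lieIdeal S) (hne : f ≠ 0) :
    ∃ w : Word ar X, IsLeading (f : Poly k ar X) w ∧ Word.IsALSW w ∧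
      ∃ s ∈ S, ∃ v, IsLeading (s : Poly k ar X) v ∧ ∃ π : StarWord ar X, w = π.subst v := by
  obtain ⟨_, ⟨s, hs, rfl⟩, v, hv, π, hπ⟩ := (h.isAssocGSBasis har hS).exists_isLeading har
    (coe_mem_spanSubst_of_mem_lieIdeal hS hf) (by simpa using hne)
  exact ⟨_, hπ, isALSW_of_isLeading har f.2 hπ, s, hs, v, hv, π, rfl⟩

/-- The span of `Irr(S)`, as a subspace of `k⟨Ω; X⟩`. -/
noncomputable def irrSpan (S : Set (LieOmega k ar X)) : Submodule k (Poly k ar X) :=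
  (Submodule.span k (Irr S)).map (LieOmega k ar X).subtype

/-- Reduction: an element of `Lie(Ω; X)` with leading word `w` is a combination of elements of
`Irr(S)` and of special normal words `[π|_s]_{s̄}` with `π|_{s̄} ≤ w`. -/
theorem mem_irrSpan_sup_normalSpan (har : ∀ ω, 1 ≤ ar ω)
    (hS : ∀ s ∈ S, IsMonic (s : Poly k ar X)) {f : Poly k ar X} (hf : f ∈ LieOmega k ar X)
    {w : Word ar X} (hw : IsLeading f w) : f ∈ irrSpan S ⊔ normalSpan S (upTo w) := by
  have wf := Word.lt_wf (ar := ar) (X := X)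
  induction w using wf.induction generalizing f with
  | _ w ih =>
  obtain ⟨t, ht, htw⟩ := exists_isNLSW har w (isALSW_of_isLeading har hf hw)
  obtain ⟨p, hpL, hpw, hp⟩ : ∃ p ∈ LieOmega k ar X, MonicLead p w ∧
      p ∈ irrSpan S ⊔ normalSpan S (upTo w) := by
    by_cases hirr : ∀ s ∈ S, ∀ v, IsLeading (s : Poly k ar X) v →
        ∀ π : StarWord ar X, t.word ≠ π.subst v
    · refine ⟨t.eval k, t.eval_mem_lieOmega, htw ▸ ht.monicLead_eval, Submodule.mem_sup_left ?_⟩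
      exact ⟨⟨t.eval k, t.eval_mem_lieOmega⟩, Submodule.subset_span ⟨t, ht, rfl, hirr⟩, rfl⟩
    · push Not at hirr
      obtain ⟨s, hs, v, hv, π, hπ⟩ := hirr
      rw [htw] at hπ
      have hvL := isLyndon_of_isLeading har s hv
      obtain ⟨p, hp⟩ := exists_isSpecialNormal har hv hvL
        (hπ ▸ isALSW_of_isLeading har hf hw)
      refine ⟨p, ?_, ?_, Submodule.mem_sup_right (Submodule.subset_span
        ⟨s, hs, π, v, hp, hv, Or.inl hπ.symm⟩)⟩
      · obtain ⟨p', -, rfl⟩ := hp.mem_lieIdealPoly (mem_lieIdealPoly.2 (subset_lieIdeal S hs))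
        exact p'.2
      · rw [hπ]
        exact hp.monicLead har ((hS s hs).monicLead hv) hvL
  have hsub : f - f.coeff w • p ∈ supportedIn k (below w) := by
    rw [mem_supportedIn]
    intro u hu
    by_cases huw : u = w
    · subst huw; simp [hpw.1] at hu
    · by_cases hfu : f.coeff u = 0
      · refine (hpw.2 u fun h => hu ?_).resolve_left huw
        simp [hfu, h]
      · exact hw.2 u hfu huw
  have hmem : f - f.coeff w • p ∈ irrSpan S ⊔ normalSpan S (upTo w) := by
    by_cases h0 : f - f.coeff w • p = 0
    · rw [h0]; exact Submodule.zero_mem _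
    have hL := Submodule.sub_mem _ hf (Submodule.smul_mem _ (f.coeff w) hpL)
    obtain ⟨t', -, ht'⟩ := exists_isLeading_of_mem_lieOmega har hL h0
    have hlt := mem_supportedIn.1 hsub _ ht'.1
    have hle : normalSpan S (upTo t'.word) ≤ normalSpan S (upTo w) :=
      normalSpan_mono fun x hx => below_subset_upTo _ (upTo_subset_below hlt hx)
    exact sup_le_sup le_rfl hle (ih _ hlt hL ht')
  have := Submodule.add_mem _ hmem (Submodule.smul_mem _ (f.coeff w) hp)
  rwa [sub_add_cancel] at this

/-- `Irr(S)` spans the quotient, for every monic set `S`. -/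
theorem span_irr_eq_top (har : ∀ ω, 1 ≤ ar ω) (hS : ∀ s ∈ S, IsMonic (s : Poly k ar X)) :
    Submodule.span k (Set.range fun h : Irr S =>
      (Submodule.Quotient.mk h.1 : LieOmega k ar X ⧸ lieIdeal S)) = ⊤ := by
  rw [span_range_mk_eq, eq_top_iff]
  rintro x -
  obtain ⟨f, rfl⟩ := Submodule.Quotient.mk_surjective _ x
  by_cases h0 : f = 0
  · subst h0; exact Submodule.zero_mem _
  obtain ⟨t, -, ht⟩ := exists_isLeading_of_mem_lieOmega har f.2 (by simpa using h0)
  obtain ⟨_, ⟨a, ha, rfl⟩, b, hb, e⟩ := Submodule.mem_sup.1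
    (mem_irrSpan_sup_normalSpan har hS f.2 ht)
  obtain ⟨b, hb', rfl⟩ := normalSpan_le_lieIdealPoly _ hb
  obtain rfl : a + b = f := Subtype.ext e
  refine ⟨a, ha, ?_⟩
  rw [Submodule.mkQ_apply, Submodule.Quotient.eq]
  simpa using hb'

/-- If the leading words of the elements of the ideal are reducible, then `Irr(S)` is independent
in the quotient: the leading word of a combination of elements of `Irr(S)` is irreducible. -/
theorem linearIndependent_irr (har : ∀ ω, 1 ≤ ar ω)
    (h : ∀ f ∈ lieIdeal S, f ≠ 0 → ∃ w : Word ar X, IsLeading (f : Poly k ar X) w ∧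
      Word.IsALSW w ∧ ∃ s ∈ S, ∃ v, IsLeading (s : Poly k ar X) v ∧
        ∃ π : StarWord ar X, w = π.subst v) :
    LinearIndependent k fun h : Irr S =>
      (Submodule.Quotient.mk h.1 : LieOmega k ar X ⧸ lieIdeal S) := by
  choose t ht hte hirr using fun i : Irr S => i.2
  have hlead : ∀ i : Irr S, MonicLead (i.1 : Poly k ar X) (t i).word := fun i => by
    rw [hte i]; exact (ht i).monicLead_eval
  have hinj : ∀ i j : Irr S, (t i).word = (t j).word → i = j := fun i j e => by
    have := (ht i).eq_of_word_eq har (ht j) e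
    exact Subtype.ext (Subtype.ext (by rw [hte i, hte j, this]))
  -- The leading word of a combination of elements of `Irr(S)` belongs to one of them.
  have key : ∀ (P : Set (Irr S)) (f : LieOmega k ar X), f ∈ Submodule.span k (Subtype.val '' P) →
      f ≠ 0 → ∃ i ∈ P, IsLeading (f : Poly k ar X) (t i).word := by
    intro P f hf hne
    have hf' := Submodule.mem_map_of_mem (f := (LieOmega k ar X).subtype) hf
    rw [Submodule.map_span, Set.image_image] at hf'
    obtain ⟨i, hi⟩ := exists_isLeading_of_mem_span
      (F := fun i : P => (i.1.1 : Poly k ar X)) (ℓ := fun i : P => (t i.1).word) har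
      (fun i => hlead i.1) (fun i j e => by
        rw [hinj _ _ e, sub_self]; exact Submodule.zero_mem _)
      (by convert hf' using 2; ext x; simp) (by simpa using hne)
    exact ⟨i.1, i.2, hi⟩
  rw [linearIndependent_iff_notMem_span]
  intro i hi
  have e : (fun h : Irr S => (Submodule.Quotient.mk h.1 : LieOmega k ar X ⧸ lieIdeal S)) ''
      (Set.univ \ {i}) = (lieIdeal S).mkQ '' (Subtype.val '' (Set.univ \ {i})) := by
    rw [Set.image_image]; rfl
  rw [e, ← Submodule.map_span] at hi
  obtain ⟨y, hy, hyi⟩ := hi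
  have hmem : i.1 - y ∈ lieIdeal S := (Submodule.Quotient.eq _).1 hyi.symm
  by_cases h0 : i.1 - y = 0
  · rw [sub_eq_zero] at h0
    rw [← h0] at hy
    obtain ⟨j, hj, hjl⟩ := key _ _ hy fun h => (hlead i).isLeading.1 (by simp [h])
    exact hj.2 (hinj j i (hjl.unique (hlead i).isLeading))
  · have hspan : i.1 - y ∈ Submodule.span k (Subtype.val '' (Set.univ : Set (Irr S))) :=
      Submodule.sub_mem _ (Submodule.subset_span ⟨i, Set.mem_univ _, rfl⟩)
        (Submodule.span_mono (Set.image_mono (Set.subset_univ _)) hy)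
    obtain ⟨j, -, hj⟩ := key _ _ hspan h0
    obtain ⟨w, hw, -, s, hs, v, hv, π, rfl⟩ := h _ hmem h0
    exact hirr j s hs v hv π (hj.unique hw)

/-- If `Irr(S)` is independent in the quotient, then reducing a composition leaves no
irreducible part, so that every composition is trivial. -/
theorem isGSBasis_of_linearIndependent (har : ∀ ω, 1 ≤ ar ω)
    (hS : ∀ s ∈ S, IsMonic (s : Poly k ar X))
    (hli : LinearIndependent k fun h : Irr S =>
      (Submodule.Quotient.mk h.1 : LieOmega k ar X ⧸ lieIdeal S)) : IsGSBasis S := by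
  intro f hf g hg w h hcomp
  have hfI := mem_lieIdealPoly.2 (subset_lieIdeal S hf)
  have hgI := mem_lieIdealPoly.2 (subset_lieIdeal S hg)
  obtain ⟨p, q, hpw, hqw, hpI, hqI, rfl⟩ : ∃ p q : Poly k ar X, MonicLead p w ∧ MonicLead q w ∧
      p ∈ lieIdealPoly S ∧ q ∈ lieIdealPoly S ∧ h = p - q := by
    obtain ⟨u, v, hu, hv, ⟨a, b, p, q, h1, h2, -, hp, hq, rfl⟩ |
      ⟨π, q, rfl, h2, hq, rfl⟩⟩ := hcomp
    · refine ⟨p, q, ?_, ?_, hp.mem_lieIdealPoly hfI, hq.mem_lieIdealPoly hgI, rfl⟩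
      · rw [h1, show u * a = (StarWord.top [] (letters a)).subst u from
          letters_injective (by simp [StarWord.subst])]
        exact hp.monicLead har ((hS f hf).monicLead hu) (isLyndon_of_isLeading har f hu)
      · rw [h2, show b * v = (StarWord.top (letters b) []).subst v from
          letters_injective (by simp [StarWord.subst])]
        exact hq.monicLead har ((hS g hg).monicLead hv) (isLyndon_of_isLeading har g hv)
    · refine ⟨f, q, (hS f hf).monicLead hu, ?_, hfI, hq.mem_lieIdealPoly hgI, rfl⟩
      rw [h2]
      exact hq.monicLead har ((hS g hg).monicLead hv) (isLyndon_of_isLeading har g hv)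
  change p - q ∈ normalSpan S (below w)
  by_cases h0 : p - q = 0
  · rw [h0]; exact Submodule.zero_mem _
  obtain ⟨r, hr, hre⟩ := Submodule.sub_mem _ hpI hqI
  have hlow : p - q ∈ supportedIn k (below w) := by
    have := Submodule.sub_mem _ (monicLead_iff.1 hpw) (monicLead_iff.1 hqw)
    rwa [sub_sub_sub_cancel_right] at this
  rw [← hre] at h0 hlow ⊢
  obtain ⟨t, -, ht⟩ := exists_isLeading_of_mem_lieOmega har r.2 h0
  have hlt : Word.lt t.word w := mem_supportedIn.1 hlow _ ht.1
  obtain ⟨_, ⟨a, ha, rfl⟩, b, hb, e⟩ := Submodule.mem_sup.1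
    (mem_irrSpan_sup_normalSpan har hS r.2 ht)
  obtain ⟨b', hb', rfl⟩ := normalSpan_le_lieIdealPoly _ hb
  have hab : a + b' = r := Subtype.ext e
  have haI : a ∈ lieIdeal S := by
    rw [← hab] at hr
    exact (Submodule.add_mem_iff_left _ hb').1 hr
  have ha0 : a = 0 := by
    refine Submodule.disjoint_def.1 (Submodule.range_ker_disjoint (f := (lieIdeal S).mkQ)
      (v := fun h : Irr S => h.1) hli) a (by simpa using ha) (by simpa using haI)
  rw [ha0, zero_add] at hab
  rw [← hab]
  exact normalSpan_mono (upTo_subset_below hlt) hb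

end Diamond

end OmegaLie

theorem mainTheorem2 {k Ω X : Type*} [Field k] [LinearOrder Ω] [WellFoundedLT Ω]
    [LinearOrder X] [WellFoundedLT X] (ar : Ω → ℕ) (har : ∀ ω, 1 ≤ ar ω)
    (S : Set (LieOmega k ar X)) (hS : ∀ s ∈ S, IsMonic (s : Poly k ar X)) :
    List.TFAE [
      IsGSBasis S,
      ∀ f ∈ lieIdeal S, f ≠ 0 → ∃ w : Word ar X, IsLeading (f : Poly k ar X) w ∧ Word.IsALSW w ∧
        ∃ s ∈ S, ∃ v, IsLeading (s : Poly k ar X) v ∧ ∃ π : StarWord ar X, w = π.subst v,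
      LinearIndependent k
          (fun h : Irr S => (Submodule.Quotient.mk h.1 : LieOmega k ar X ⧸ lieIdeal S)) ∧
        Submodule.span k (Set.range
          (fun h : Irr S => (Submodule.Quotient.mk h.1 : LieOmega k ar X ⧸ lieIdeal S))) = ⊤] := by
  tfae_have 1 → 2 := fun h _ hf hne => h.exists_isLeading har hS hf hne
  tfae_have 2 → 3 := fun h => ⟨linearIndependent_irr har h, span_irr_eq_top har hS⟩
  tfae_have 3 → 1 := fun h => isGSBasis_of_linearIndependent har hS h.1
  tfae_finish
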